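/- **Corollary ($R$-transform additivity).** Let $p\ge 2$ be an even integer. *Trace maps and free cumulants.* A $p$-regular trace map is a pair $\mathfrak b=(\pi,\alpha)$ of permutations of a finite set of half-edges, all cycles of $\pi$ (the vertices) having length $p$ and $\alpha$ being an involution without fixed point (its 2-cycles are the edges); $\gamma(\mathfrak b)$ is its number of connected components. Vertices may be decorated by letters. $\mathcal B_n$ is the set of connected $p$-regular trace maps with $n$ vertices and a root half-edge, up to isomorphism. On maps with the same $\pi$ (and the same decoration), $\le$ is the partial order generated by: $\mathfrak b'<\mathfrak b$ if $\mathfrak b'$ is obtained from $\mathfrak b$ by exchanging end points of two edges and $\gamma(\mathfrak b')=\gamma(\mathfrak b)+1$. A joint distribution of $(a,b)$ is a real function on $p$-regular trace maps with vertices decorated by $a$ or $b$ that is invariant under isomorphism, multiplicative over disjoint unions and equal to $1$ on the empty map; it is extended by multilinearity to decorations by linear combinations of $a$ and $b$. Its free cumulants $\kappa_{\mathfrak b}$ are defined by $\mathfrak b=\sum_{\mathfrak b'\le\mathfrak b}\kappa_{\mathfrak b'}$. For $c\in\{a,b,a+b\}$ put $m_0(c)=\kappa_0(c)=1$ and, for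 $n\ge1$, $m_n(c)=\sum_{\mathfrak b\in\mathcal B_n}\mathfrak b(c,\dots,c)$ and $\kappa_n(c)=\sum_{\mathfrak b\in\mathcal B_n}\kappa_{\mathfrak b}(c,\dots,c)$. We say that $a$ and $b$ are free if $\kappa_{\mathfrak b}=0$ for every connected $\mathfrak b$ on whose vertices both $a$ and $b$ occur. We say that $c$ has law $\mu$ if $\mu$ is a compactly supported probability measure on $\mathbb R$ with moments $\int x^n\,d\mu=m_n(c)$ for all $n\ge0$. *Measures.* For a compactly supported probability measure $\mu$ on $\mathbb R$ with moment series $M_\mu(z)=\sum_{n\ge0}z^n\int x^n\,d\mu$, let $C_\mu(z)=\sum_{n\ge0}\kappa_n(\mu)z^n$ be the formal power series determined by $M_\mu(z)=C_\mu\big(zM_\mu(z)^{p/2}\big)$, and let $$R_\mu(z)=\frac{C_\mu(z)-1}{z}=\sum_{n\ge1}\kappa_n(\mu)z^{n-1}.$$ A compactly supported probability measure $\rho$ is a tensorial free convolution $\mu\oplus_p\nu$ if there are free $a$, $b$ with laws $\mu$, $\nu$ such that $a+b$ has law $\rho$. *Statement.* Let $\mu,\nu$ be compactly supported probability measures on $\mathbb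 R$. There is $r>0$ such that for all $z\in\mathbb C$ with $|z|<r$ the series $R_\mu(z)$ and $R_\nu(z)$ converge absolutely and: 1. whenever $\mu\oplus_p\nu$ exists as a compactly supported probability measure, $R_{\mu\oplus_p\nu}(z)$ converges absolutely and $$R_{\mu\oplus_p\nu}(z)=R_\mu(z)+R_\nu(z);$$ 2. whether or not $\mu\oplus_p\nu$ exists as a probability measure, for all free $a,b$ with laws $\mu,\nu$, $$\sum_{n\ge1}\kappa_n(a)z^{n-1}=R_\mu(z),\qquad \sum_{n\ge1}\kappa_n(b)z^{n-1}=R_\nu(z),\qquad \sum_{n\ge1}\kappa_n(a+b)z^{n-1}=R_\mu(z)+R_\nu(z).$$ -/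

import Mathlib

open MeasureTheory

noncomputable section

namespace TensorFree

/-! ### Trace maps -/

/-- A `p`-regular trace map with set of half-edges `E`, whose vertices carry labels in `ι`.
The vertices are the cycles of `rot` (all of length `p`), the edges are the two-element cycles of
the fixed-point free involution `edge`. A label on the vertices is a function on half-edges that
is constant on the cycles of `rot`; the label records which tensor decorates the vertex.
Undecorated maps are the case `ι = Unit`. -/
structure TraceMap (p : ℕ) (ι E : Type) where
  rot : Equiv.Perm E
  edge : Equiv.Perm E
  label : E → ι
  rot_period : ∀ e, Function.minimalPeriod rot e = p
  edge_edge : ∀ e, edge (edge e) = e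
  edge_ne : ∀ e, edge e ≠ e
  label_rot : ∀ e, label (rot e) = label e

/-- Isomorphisms of (decorated) trace maps: relabelings of the half-edges. -/
structure TraceMap.Iso {p : ℕ} {ι E E' : Type} (b : TraceMap p ι E) (b' : TraceMap p ι E') where
  toEquiv : E ≃ E'
  map_rot : ∀ e, toEquiv (b.rot e) = b'.rot (toEquiv e)
  map_edge : ∀ e, toEquiv (b.edge e) = b'.edge (toEquiv e)
  map_label : ∀ e, b'.label (toEquiv e) = b.label e

/-- The number `γ(b)` of connected components: orbits of the group generated by the two
permutations. -/
def TraceMap.components {p : ℕ} {ι E : Type} (b : TraceMap p ι E) : ℕ :=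
  Nat.card (MulAction.orbitRel.Quotient
    (Subgroup.closure ({b.rot, b.edge} : Set (Equiv.Perm E))) E)

def TraceMap.Connected {p : ℕ} {ι E : Type} (b : TraceMap p ι E) : Prop :=
  b.components = 1

lemma minimalPeriod_sumCongr_inl {E₁ E₂ : Type} (f : Equiv.Perm E₁) (g : Equiv.Perm E₂) (e : E₁) :
    Function.minimalPeriod (Equiv.sumCongr f g) (Sum.inl e) = Function.minimalPeriod f e := by
  rw [Function.minimalPeriod_eq_minimalPeriod_iff]
  intro n
  have h : ∀ n : ℕ, (Equiv.sumCongr f g)^[n] (Sum.inl e) = Sum.inl (f^[n] e) := by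
    intro n
    induction n with
    | zero => rfl
    | succ k ih => rw [Function.iterate_succ_apply', ih, Function.iterate_succ_apply']; rfl
  simp [Function.IsPeriodicPt, Function.IsFixedPt, h]

lemma minimalPeriod_sumCongr_inr {E₁ E₂ : Type} (f : Equiv.Perm E₁) (g : Equiv.Perm E₂) (e : E₂) :
    Function.minimalPeriod (Equiv.sumCongr f g) (Sum.inr e) = Function.minimalPeriod g e := by
  rw [Function.minimalPeriod_eq_minimalPeriod_iff]
  intro n
  have h : ∀ n : ℕ, (Equiv.sumCongr f g)^[n] (Sum.inr e) = Sum.inr (g^[n] e) := by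
    intro n
    induction n with
    | zero => rfl
    | succ k ih => rw [Function.iterate_succ_apply', ih, Function.iterate_succ_apply']; rfl
  simp [Function.IsPeriodicPt, Function.IsFixedPt, h]

/-- Disjoint union of trace maps. -/
def TraceMap.disjUnion {p : ℕ} {ι E₁ E₂ : Type} (b₁ : TraceMap p ι E₁) (b₂ : TraceMap p ι E₂) :
    TraceMap p ι (E₁ ⊕ E₂) where
  rot := Equiv.sumCongr b₁.rot b₂.rot
  edge := Equiv.sumCongr b₁.edge b₂.edge
  label := Sum.elim b₁.label b₂.label
  rot_period := by
    rintro (e | e)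
    · rw [minimalPeriod_sumCongr_inl, b₁.rot_period]
    · rw [minimalPeriod_sumCongr_inr, b₂.rot_period]
  edge_edge := by rintro (e | e) <;> simp [b₁.edge_edge, b₂.edge_edge]
  edge_ne := by rintro (e | e) <;> simp [b₁.edge_ne, b₂.edge_ne]
  label_rot := by rintro (e | e) <;> simp [b₁.label_rot, b₂.label_rot]

/-- The labelings of the vertices of `b` by elements of `ι`. -/
abbrev TraceMap.Labeling {p : ℕ} {κ E : Type} (b : TraceMap p κ E) (ι : Type) : Type :=
  {l : E → ι // ∀ e, l (b.rot e) = l e}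

/-- The same map with new labels on its vertices. -/
def TraceMap.relabel {p : ℕ} {κ ι E : Type} (b : TraceMap p κ E) (l : b.Labeling ι) :
    TraceMap p ι E where
  rot := b.rot
  edge := b.edge
  label := l.1
  rot_period := b.rot_period
  edge_edge := b.edge_edge
  edge_ne := b.edge_ne
  label_rot := l.2

/-- The same map with all vertices labeled by `i`. -/
def TraceMap.constLabel {p : ℕ} {κ ι E : Type} (b : TraceMap p κ E) (i : ι) : TraceMap p ι E :=
  b.relabel ⟨fun _ => i, fun _ => rfl⟩

/-! ### The non-crossing poset -/

open Classical in
/-- `b'` is obtained from `b` by a switch (exchanging the end points of two edges, all vertices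
and their labels being kept) and has one more connected component. -/
def TraceMap.SwitchBelow {p : ℕ} {ι E : Type} (b' b : TraceMap p ι E) : Prop :=
  b'.rot = b.rot ∧ b'.label = b.label ∧
    (∃ x y : E, b'.edge = Equiv.swap x y * b.edge * Equiv.swap x y) ∧
    b'.components = b.components + 1

/-- The strict order of the non-crossing poset. -/
def TraceMap.Lt {p : ℕ} {ι E : Type} (b' b : TraceMap p ι E) : Prop :=
  Relation.TransGen TraceMap.SwitchBelow b' b

/-- The order of the non-crossing poset. -/
def TraceMap.Le {p : ℕ} {ι E : Type} (b' b : TraceMap p ι E) : Prop :=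
  Relation.ReflTransGen TraceMap.SwitchBelow b' b

lemma TraceMap.Lt.components_lt {p : ℕ} {ι E : Type} {b' b : TraceMap p ι E} (h : b'.Lt b) :
    b.components < b'.components := by
  unfold TraceMap.Lt at h
  induction h with
  | single h => have := h.2.2.2; omega
  | tail _ h ih => have := h.2.2.2; omega

lemma TraceMap.components_le_card {p : ℕ} {ι E : Type} [Finite E] (b : TraceMap p ι E) :
    b.components ≤ Nat.card E :=
  Nat.card_le_card_of_surjective _ Quotient.mk_surjective

lemma TraceMap.ext_perm {p : ℕ} {ι E : Type} {b b' : TraceMap p ι E} (h₁ : b.rot = b'.rot)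
    (h₂ : b.edge = b'.edge) (h₃ : b.label = b'.label) : b = b' := by
  cases b; cases b'; simp_all

instance {p : ℕ} {ι E : Type} [Finite ι] [Finite E] : Finite (TraceMap p ι E) :=
  Finite.of_injective (fun b : TraceMap p ι E => (b.rot, b.edge, b.label)) (by
    intro b b' h
    simp only [Prod.mk.injEq] at h
    exact TraceMap.ext_perm h.1 h.2.1 h.2.2)

/-! ### Distributions, cumulants, freeness -/

/-- A (joint) distribution of a family of tensors of order `p` indexed by `ι`: a real number for
each finite `p`-regular trace map with vertices decorated by `ι`, which only depends on the
isomorphism class, is multiplicative over disjoint unions, and is `1` on the empty map.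
The value on maps decorated by linear combinations of the family is given by multilinearity. -/
structure Distribution (p : ℕ) (ι : Type) where
  val : ∀ {E : Type} [Finite E], TraceMap p ι E → ℝ
  val_iso : ∀ {E E' : Type} [Finite E] [Finite E'] (b : TraceMap p ι E) (b' : TraceMap p ι E'),
    b.Iso b' → val b = val b'
  val_empty : ∀ {E : Type} [Finite E] [IsEmpty E] (b : TraceMap p ι E), val b = 1
  val_disjUnion : ∀ {E₁ E₂ : Type} [Finite E₁] [Finite E₂] (b₁ : TraceMap p ι E₁)
    (b₂ : TraceMap p ι E₂), val (b₁.disjUnion b₂) = val b₁ * val b₂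

/-- The free cumulant `κ_b`, defined by Moebius inversion of `b = ∑_{b' ≤ b} κ_{b'}`. -/
def Distribution.cumulant {p : ℕ} {ι : Type} (φ : Distribution p ι) {E : Type} [Finite E]
    (b : TraceMap p ι E) : ℝ :=
  φ.val b - ∑ᶠ b' : {b' : TraceMap p ι E // b'.Lt b}, φ.cumulant b'.1
termination_by Nat.card E - b.components
decreasing_by
  have h₁ := b'.2.components_lt
  have h₂ := b'.1.components_le_card
  omega

/-- The defining relation of the free cumulants. -/
lemma Distribution.val_eq_sum_cumulant {p : ℕ} {ι : Type} [Finite ι] (φ : Distribution p ι)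
    {E : Type} [Finite E] (b : TraceMap p ι E) :
    φ.val b = ∑ᶠ (b' : TraceMap p ι E) (_ : b'.Le b), φ.cumulant b' := by
  have hset : {b' : TraceMap p ι E | b'.Le b} = insert b {b' | b'.Lt b} := by
    ext b'
    simp only [Set.mem_ofPred_eq, Set.mem_insert_iff, TraceMap.Le, TraceMap.Lt,
      Relation.reflTransGen_iff_eq_or_transGen]
    exact or_congr eq_comm Iff.rfl
  have hb : b ∉ {b' : TraceMap p ι E | b'.Lt b} := fun h => lt_irrefl _ h.components_lt
  change φ.val b = ∑ᶠ b' ∈ {b' : TraceMap p ι E | b'.Le b}, φ.cumulant b'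
  rw [hset, finsum_mem_insert _ hb (Set.toFinite _), Distribution.cumulant,
    ← finsum_set_coe_eq_finsum_mem]
  change _ = _ - _ + (∑ᶠ b' : {b' : TraceMap p ι E // b'.Lt b}, φ.cumulant b'.1)
  ring

/-- The two tensors `a` (label `false`) and `b` (label `true`) are free: the mixed cumulants
vanish, that is the cumulants of the connected maps on whose vertices both tensors occur. -/
def Distribution.Free {p : ℕ} (φ : Distribution p Bool) : Prop :=
  ∀ {E : Type} [Finite E] (b : TraceMap p Bool E), b.Connected →
    (∃ e e', b.label e ≠ b.label e') → φ.cumulant b = 0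

/-- The distribution of the single tensor with index `i`. -/
def Distribution.marginal {p : ℕ} {ι : Type} (φ : Distribution p ι) (i : ι) :
    Distribution p Unit where
  val b := φ.val (b.constLabel i)
  val_iso b b' f := φ.val_iso _ _ ⟨f.toEquiv, f.map_rot, f.map_edge, fun _ => rfl⟩
  val_empty b := φ.val_empty _
  val_disjUnion b₁ b₂ := by
    rw [← φ.val_disjUnion]
    congr 1
    exact TraceMap.ext_perm rfl rfl (by funext e; cases e <;> rfl)

/-- Transport of labelings along an isomorphism. -/
def TraceMap.Iso.labelingEquiv {p : ℕ} {κ ι E E' : Type} {b : TraceMap p κ E}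
    {b' : TraceMap p κ E'} (f : b.Iso b') : b.Labeling ι ≃ b'.Labeling ι where
  toFun l := ⟨fun e => l.1 (f.toEquiv.symm e), fun e => by
    have h : f.toEquiv.symm (b'.rot e) = b.rot (f.toEquiv.symm e) := by
      rw [Equiv.symm_apply_eq, f.map_rot, Equiv.apply_symm_apply]
    change l.1 (f.toEquiv.symm (b'.rot e)) = _
    rw [h, l.2]⟩
  invFun l := ⟨fun e => l.1 (f.toEquiv e), fun e => by
    change l.1 (f.toEquiv (b.rot e)) = _
    rw [f.map_rot, l.2]⟩
  left_inv l := by ext e; simp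
  right_inv l := by ext e; simp

/-- Labelings of a disjoint union are pairs of labelings. -/
def TraceMap.labelingDisjUnionEquiv {p : ℕ} {κ ι E₁ E₂ : Type} (b₁ : TraceMap p κ E₁)
    (b₂ : TraceMap p κ E₂) : (b₁.disjUnion b₂).Labeling ι ≃ b₁.Labeling ι × b₂.Labeling ι where
  toFun l := (⟨fun e => l.1 (Sum.inl e), fun e => l.2 (Sum.inl e)⟩,
    ⟨fun e => l.1 (Sum.inr e), fun e => l.2 (Sum.inr e)⟩)
  invFun l := ⟨Sum.elim l.1.1 l.2.1, by
    rintro (e | e)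
    · exact l.1.2 e
    · exact l.2.2 e⟩
  left_inv l := by ext e; cases e <;> rfl
  right_inv l := rfl

/-- The distribution of the sum of the tensors of the family: by multilinearity, its value on a
map is the sum over all ways to decorate the vertices by members of the family. -/
def Distribution.sum {p : ℕ} {ι : Type} [Finite ι] (φ : Distribution p ι) :
    Distribution p Unit where
  val b := ∑ᶠ l : b.Labeling ι, φ.val (b.relabel l)
  val_iso b b' f := by
    rw [← finsum_comp_equiv f.labelingEquiv]
    refine finsum_congr fun l => φ.val_iso _ _ ⟨f.toEquiv, f.map_rot, f.map_edge, fun e => ?_⟩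
    simp [TraceMap.Iso.labelingEquiv, TraceMap.relabel]
  val_empty b := by
    have : Unique (b.Labeling ι) :=
      { default := ⟨isEmptyElim, isEmptyElim⟩
        uniq := fun l => Subtype.ext (Subsingleton.elim _ _) }
    rw [finsum_unique, φ.val_empty]
  val_disjUnion b₁ b₂ := by
    have := Fintype.ofFinite (b₁.Labeling ι)
    have := Fintype.ofFinite (b₂.Labeling ι)
    rw [← finsum_comp_equiv (b₁.labelingDisjUnionEquiv b₂).symm,
      finsum_eq_sum_of_fintype, finsum_eq_sum_of_fintype, finsum_eq_sum_of_fintype,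
      Finset.sum_mul_sum, Fintype.sum_prod_type]
    refine Finset.sum_congr rfl fun l₁ _ => Finset.sum_congr rfl fun l₂ _ => ?_
    rw [← φ.val_disjUnion]
    congr 1

/-! ### Moments and free cumulants of a distribution -/

/-- A connected `p`-regular trace map with `n` labeled vertices (hence `n * p` half-edges) and a
distinguished half-edge, its root. -/
structure PreRootedMap (p n : ℕ) where
  map : TraceMap p Unit (Fin (n * p))
  connected : map.Connected
  root : Fin (n * p)

instance (p n : ℕ) : Finite (PreRootedMap p n) :=
  Finite.of_injective (fun b : PreRootedMap p n => (b.map, b.root)) (by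
    intro b b' h
    cases b; cases b'; simp_all)

/-- Equivalence of rooted maps: root preserving isomorphism. -/
instance preRootedMapSetoid (p n : ℕ) : Setoid (PreRootedMap p n) where
  r b b' := ∃ f : b.map.Iso b'.map, f.toEquiv b.root = b'.root
  iseqv :=
    { refl := fun _ => ⟨⟨Equiv.refl _, fun _ => rfl, fun _ => rfl, fun _ => rfl⟩, rfl⟩
      symm := by
        rintro b b' ⟨f, hf⟩
        refine ⟨⟨f.toEquiv.symm, fun e => ?_, fun e => ?_, fun _ => rfl⟩, ?_⟩
        · rw [Equiv.symm_apply_eq, f.map_rot, Equiv.apply_symm_apply]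
        · rw [Equiv.symm_apply_eq, f.map_edge, Equiv.apply_symm_apply]
        · rw [Equiv.symm_apply_eq, hf]
      trans := by
        rintro b b' b'' ⟨f, hf⟩ ⟨g, hg⟩
        refine ⟨⟨f.toEquiv.trans g.toEquiv, fun e => ?_, fun e => ?_, fun _ => rfl⟩, ?_⟩
        · simp [f.map_rot, g.map_rot]
        · simp [f.map_edge, g.map_edge]
        · simp [hf, hg] }

/-- The set `B_n` of connected rooted `p`-regular trace maps with `n` unlabeled vertices. -/
def RootedMap (p n : ℕ) : Type := Quotient (preRootedMapSetoid p n)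

instance (p n : ℕ) : Finite (RootedMap p n) :=
  inferInstanceAs (Finite (Quotient (preRootedMapSetoid p n)))

/-- A representative of a rooted map, without its root. -/
def RootedMap.toTraceMap {p n : ℕ} (b : RootedMap p n) : TraceMap p Unit (Fin (n * p)) :=
  (Quotient.out b).map

/-- The moment `m_n(a) = ∑_{b ∈ B_n} a(b)`, with `m_0 = 1`. -/
def Distribution.moment {p : ℕ} (a : Distribution p Unit) (n : ℕ) : ℝ :=
  if n = 0 then 1 else ∑ᶠ b : RootedMap p n, a.val b.toTraceMap

/-- The free cumulant `κ_n(a) = ∑_{b ∈ B_n} κ_b(a)`, with `κ_0 = 1`. -/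
def Distribution.freeCumulant {p : ℕ} (a : Distribution p Unit) (n : ℕ) : ℝ :=
  if n = 0 then 1 else ∑ᶠ b : RootedMap p n, a.cumulant b.toTraceMap

/-! ### Measures -/

def CompactlySupported (μ : Measure ℝ) : Prop :=
  ∃ M : ℝ, 0 < M ∧ μ (Set.Icc (-M) M)ᶜ = 0

/-- `μ` is the compactly supported probability measure with the moments of `a`
(that is `μ = μ_a`). -/
def Distribution.HasLaw {p : ℕ} (a : Distribution p Unit) (μ : Measure ℝ) : Prop :=
  IsProbabilityMeasure μ ∧ CompactlySupported μ ∧ ∀ n, a.moment n = ∫ x, x ^ n ∂μ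

/-- `ρ = μ ⊕_p ν`, the tensorial free convolution: `ρ` is the compactly supported probability
measure which is the law of the sum of two free distributions with laws `μ` and `ν`. -/
def IsTensorFreeConvolution (p : ℕ) (μ ν ρ : Measure ℝ) : Prop :=
  ∃ φ : Distribution p Bool, φ.Free ∧ (φ.marginal false).HasLaw μ ∧ (φ.marginal true).HasLaw ν ∧
    φ.sum.HasLaw ρ

/-- The moment series `M_μ(z) = ∑ m_n(μ) z^n`. -/
def momentSeries (μ : Measure ℝ) : PowerSeries ℝ :=
  PowerSeries.mk fun n => ∫ x, x ^ n ∂μ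

/-- The free cumulants `κ_n(μ)`: the coefficients of the series `C_μ` determined by
`M_μ(z) = C_μ(z M_μ(z)^{p/2})`, computed recursively. -/
def measureCumulant (p : ℕ) (μ : Measure ℝ) (n : ℕ) : ℝ :=
  PowerSeries.coeff n (momentSeries μ) - ∑ s : Fin n, measureCumulant p μ s *
    PowerSeries.coeff n ((PowerSeries.X * momentSeries μ ^ (p / 2)) ^ (s : ℕ))
termination_by n
decreasing_by exact s.2

/-- The free cumulant series `C_μ(z) = ∑ κ_n(μ) z^n`. -/
def cumulantSeries (p : ℕ) (μ : Measure ℝ) : PowerSeries ℝ :=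
  PowerSeries.mk (measureCumulant p μ)

/-- The relation that characterizes `C_μ`. -/
lemma momentSeries_eq_subst (p : ℕ) (μ : Measure ℝ) [IsProbabilityMeasure μ] :
    momentSeries μ =
      (cumulantSeries p μ).subst (PowerSeries.X * momentSeries μ ^ (p / 2)) := by
  have hsub : PowerSeries.HasSubst (PowerSeries.X * momentSeries μ ^ (p / 2)) :=
    PowerSeries.HasSubst.of_constantCoeff_zero' (by simp)
  have h1 : PowerSeries.constantCoeff (momentSeries μ) = 1 := by simp [momentSeries]
  ext n
  rw [PowerSeries.coeff_subst' hsub]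
  have hz : ∀ s, n < s → PowerSeries.coeff n
      ((PowerSeries.X * momentSeries μ ^ (p / 2)) ^ s) = 0 := by
    intro s hs
    rw [mul_pow, PowerSeries.coeff_X_pow_mul', if_neg (by omega)]
  rw [finsum_eq_sum_of_support_subset (s := Finset.range (n + 1)) _ (by
    intro s hs
    by_contra h
    simp only [Finset.coe_range, Set.mem_Iio, not_lt] at h
    exact hs (by simp only [hz s (by omega), smul_zero]))]
  rw [Finset.sum_range_succ, ← Fin.sum_univ_eq_sum_range (fun s =>
    PowerSeries.coeff s (cumulantSeries p μ) •
      PowerSeries.coeff n ((PowerSeries.X * momentSeries μ ^ (p / 2)) ^ s))]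
  have hn : PowerSeries.coeff n ((PowerSeries.X * momentSeries μ ^ (p / 2)) ^ n) = 1 := by
    rw [mul_pow, PowerSeries.coeff_X_pow_mul', if_pos le_rfl]
    simp [h1]
  rw [hn]
  simp only [cumulantSeries, PowerSeries.coeff_mk, smul_eq_mul, mul_one]
  rw [measureCumulant]
  ring

/-- The `R`-transform `R_μ(z) = (C_μ(z) - 1) / z` as a formal power series. -/
def rTransform (p : ℕ) (μ : Measure ℝ) : PowerSeries ℝ :=
  PowerSeries.mk fun n => PowerSeries.coeff (n + 1) (cumulantSeries p μ - 1)

lemma X_mul_rTransform (p : ℕ) (μ : Measure ℝ) [IsProbabilityMeasure μ] :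
    PowerSeries.X * rTransform p μ = cumulantSeries p μ - 1 := by
  ext n
  cases n with
  | zero =>
    have : measureCumulant p μ 0 = 1 := by
      rw [measureCumulant]; simp [momentSeries]
    simp [cumulantSeries, this]
  | succ n => simp [PowerSeries.coeff_succ_X_mul, rTransform]

/-- The `n`-th term of the series `R_μ(z)` at a complex number `z`. -/
def rTerm (p : ℕ) (μ : Measure ℝ) (z : ℂ) (n : ℕ) : ℂ :=
  ((PowerSeries.coeff n (rTransform p μ) : ℝ) : ℂ) * z ^ n

/-- The value `R_μ(z)`, meaningful where the series converges. -/
def rValue (p : ℕ) (μ : Measure ℝ) (z : ℂ) : ℂ := ∑' n, rTerm p μ z n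

end TensorFree

end

noncomputable section

namespace TensorFree

open Equiv

/-! ### Perfect matchings, switches and orbits -/

/-! With the vertex rotation ρ fixed, a map is a matching α of the half-edges. The theorem needs
three things: the numbers κ_n add for free a and b, the κ_n of a distribution with law μ are the
coefficients of C_μ, and these coefficients grow at most exponentially.

Additivity. Cumulants are determined by their defining relation (`Distribution.cumulant_unique`), so
expanding a+b over labelings commutes with taking cumulants (`Distribution.sum_cumulant`). On a
connected map freeness kills every labeling that uses both letters, and only the two constant ones
remain (`Distribution.Free.sum_cumulant`).

Moments and cumulants. The identity M = C(z M^(p/2)) is proved for distributions in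
`Distribution.moment_succ`. Connected rooted maps have no automorphisms, so sums over B_n are, up to
explicit factors, sums over connected matchings of n labeled vertices (`mul_matchSum`). Expanding
the moments gives a sum of κ_β over pairs β ≤ α with α connected. Let V be the vertex set of the
root's component in β, with k vertices and restriction δ. Since κ is multiplicative
(`Distribution.cum_onSub_or`), κ_δ factors out (`matchSum_univ`). Each of the kp/2 edges of δ is
either still an edge of α, or is opened in α by one switch that attaches a connected piece along one
of its half-edges; summing over the pieces turns each edge into a factor M (`insSum_step`,
`insSum_eq`). Hence κ_k is multiplied by the coefficient of z^(n-k) in M^(kp/2).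

Edges of δ can be closed in any order because of `LeP.split`: on the way down from α to β, any edge
of β can be created first. This rests on a geodesic description of the order (`LeP.le_count`,
`count_le_and_leP`): β ≤ α exactly when the gain in components equals the number of edges minus the
number of loops of α superposed on β. The input is `switch_cases`: as p is even, a switch changes
the number of components by at most one.

Growth. Lagrange inversion gives (n+1)κ_{n+1} = [z^n] M' M^(-(n+1)p/2). Compact support bounds the
coefficients of M geometrically, and a weighted ℓ¹ estimate does the rest
(`CompactlySupported.abs_measureCumulant_le`). -/

/-- Involutions without fixed points. -/
def IsMatching {E : Type} (α : Perm E) : Prop := (∀ x, α (α x) = x) ∧ ∀ x, α x ≠ x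

lemma IsMatching.even_card {E : Type} {α : Perm E} (hα : IsMatching α) (T : Finset E)
    (hT : ∀ x ∈ T, α x ∈ T) : Even T.card := by
  have h : ∑ x ∈ T, (1 : ZMod 2) = 0 :=
    Finset.sum_involution (fun x _ => α x) (fun _ _ => by decide) (fun x _ _ => hα.2 x)
      (fun x hx => hT x hx) (fun x _ => hα.1 x)
  rw [Finset.sum_const, nsmul_eq_mul, mul_one] at h
  exact (ZMod.natCast_eq_zero_iff_even).1 h

open Classical in
/-- The permutation obtained from `α` by exchanging `x` and `y`. -/
def sw {E : Type} (α : Perm E) (x y : E) : Perm E := swap x y * α * swap x y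

lemma sw_apply {E : Type} [DecidableEq E] (α : Perm E) (x y z : E) :
    sw α x y z = swap x y (α (swap x y z)) := by
  simp only [sw, Perm.mul_apply]
  congr!

lemma sw_sw {E : Type} (α : Perm E) (x y : E) : sw (sw α x y) x y = α := by
  classical
  ext z; simp [sw_apply]

lemma sw_comm {E : Type} (α : Perm E) (x y : E) : sw α x y = sw α y x := by
  classical
  ext z; simp [sw_apply, swap_comm]

lemma IsMatching.sw {E : Type} {α : Perm E} (hα : IsMatching α) (x y : E) :
    IsMatching (sw α x y) := by
  classical
  refine ⟨fun z => by simp [sw_apply, hα.1], fun z h => ?_⟩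
  rw [sw_apply, Equiv.swap_apply_eq_iff] at h
  exact hα.2 _ h

lemma sw_apply_of_ne {E : Type} {α : Perm E} (hα : IsMatching α) {x y z : E} (h1 : z ≠ x)
    (h2 : z ≠ y) (h3 : z ≠ α x) (h4 : z ≠ α y) : TensorFree.sw α x y z = α z := by
  classical
  rw [sw_apply, swap_apply_of_ne_of_ne h1 h2, swap_apply_of_ne_of_ne]
  · intro h; exact h3 (by rw [← h, hα.1])
  · intro h; exact h4 (by rw [← h, hα.1])

/-- The picture of a switch: the edges {x, α x} and {y, α y} become {x, α y} and {y, α x}, and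
nothing else moves. -/
lemma sw_apply_left {E : Type} {α : Perm E} (hα : IsMatching α) {x y : E} (h : α y ≠ x) :
    TensorFree.sw α x y x = α y := by
  classical
  rw [sw_apply, swap_apply_left, swap_apply_of_ne_of_ne h (hα.2 y)]

lemma sw_apply_right {E : Type} {α : Perm E} (hα : IsMatching α) {x y : E} (h : α x ≠ y) :
    TensorFree.sw α x y y = α x := by
  rw [sw_comm, sw_apply_left hα h]

/-- The relation of being in the same orbit of the group generated by two permutations. -/
def connRel {E : Type} (ρ α : Perm E) : Setoid E :=
  MulAction.orbitRel (Subgroup.closure ({ρ, α} : Set (Perm E))) E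

lemma connRel_left {E : Type} (ρ α : Perm E) (x : E) : connRel ρ α x (ρ x) :=
  (connRel ρ α).symm ⟨⟨ρ, Subgroup.subset_closure (by simp)⟩, rfl⟩

lemma connRel_right {E : Type} (ρ α : Perm E) (x : E) : connRel ρ α x (α x) :=
  (connRel ρ α).symm ⟨⟨α, Subgroup.subset_closure (by simp)⟩, rfl⟩

/-- The universal property of the orbit relation. All later comparisons of components go through it,
so that no group words are handled again. -/
lemma connRel_le {E : Type} {ρ α : Perm E} {s : Setoid E} (h1 : ∀ x, s x (ρ x))
    (h2 : ∀ x, s x (α x)) : connRel ρ α ≤ s := by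
  rintro x y ⟨⟨g, hg⟩, rfl⟩
  change s (g y) y
  induction hg using Subgroup.closure_induction generalizing y with
  | mem g hg =>
    rcases hg with rfl | rfl
    · exact s.symm (h1 y)
    · exact s.symm (h2 y)
  | one => exact s.refl _
  | mul a b _ _ ha hb => exact s.trans (@ha (b y)) (@hb y)
  | inv a _ ha =>
    have := @ha (a⁻¹ y)
    rw [Perm.inv_def, apply_symm_apply] at this
    exact s.symm this

lemma connRel_prop {E : Type} {ρ α : Perm E} (P : E → Prop) (h1 : ∀ x, P (ρ x) ↔ P x)
    (h2 : ∀ x, P (α x) ↔ P x) {x y : E} (h : connRel ρ α x y) : P x ↔ P y := by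
  have : connRel ρ α ≤ Setoid.ker P :=
    connRel_le (fun x => propext (h1 x).symm) (fun x => propext (h2 x).symm)
  exact (this h : P x = P y) ▸ Iff.rfl

/-! ### Counting classes and merging two of them -/

/-- The number of classes of a setoid. -/
def numClasses {E : Type} (r : Setoid E) : ℕ := Nat.card (Quotient r)

open Classical in
/-- The setoid obtained by merging the classes of `a` and `b`. -/
def mergeRel {E : Type} (r : Setoid E) (a b : E) : Setoid E :=
  Setoid.ker (fun x => if r x b then (⟦a⟧ : Quotient r) else ⟦x⟧)

open Classical in
lemma le_mergeRel {E : Type} (r : Setoid E) (a b : E) : r ≤ mergeRel r a b := by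
  intro x y h
  change (if r x b then (⟦a⟧ : Quotient r) else ⟦x⟧) = if r y b then ⟦a⟧ else ⟦y⟧
  have : r x b ↔ r y b := ⟨fun h' => r.trans (r.symm h) h', fun h' => r.trans h h'⟩
  simp only [this]
  split_ifs
  · rfl
  · exact Quotient.sound h

open Classical in
lemma mergeRel_pair {E : Type} (r : Setoid E) (a b : E) : mergeRel r a b a b := by
  change (if r a b then (⟦a⟧ : Quotient r) else ⟦a⟧) = if r b b then ⟦a⟧ else ⟦b⟧
  rw [if_pos (r.refl b)]
  split_ifs <;> rfl

open Classical in
lemma mergeRel_le {E : Type} {r s : Setoid E} {a b : E} (h : r ≤ s) (hab : s a b) :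
    mergeRel r a b ≤ s := by
  intro x y hxy
  change (if r x b then (⟦a⟧ : Quotient r) else ⟦x⟧) = if r y b then ⟦a⟧ else ⟦y⟧ at hxy
  split_ifs at hxy with h1 h2 h2
  · exact s.trans (h h1) (s.symm (h h2))
  · exact s.trans (s.trans (h h1) (s.symm hab)) (h (Quotient.exact hxy))
  · exact s.trans (h (Quotient.exact hxy)) (s.trans hab (s.symm (h h2)))
  · exact h (Quotient.exact hxy)

open Classical in
lemma mergeRel_left {E : Type} {r : Setoid E} {a b z : E} (h : mergeRel r a b a z) :
    r a z ∨ r b z := by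
  change (if r a b then (⟦a⟧ : Quotient r) else ⟦a⟧) = if r z b then ⟦a⟧ else ⟦z⟧ at h
  rw [ite_self] at h
  split_ifs at h with h'
  · exact Or.inr (r.symm h')
  · exact Or.inl (Quotient.exact h)

/-- The new quotient is the range of the map defining `mergeRel`, and this range misses only the
class of `b`. -/
lemma numClasses_mergeRel {E : Type} [Finite E] {r : Setoid E} {a b : E} (h : ¬ r a b) :
    numClasses (mergeRel r a b) + 1 = numClasses r := by
  classical
  have e := Setoid.quotientKerEquivRange
    (fun x => if r x b then (⟦a⟧ : Quotient r) else ⟦x⟧)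
  have hr : Set.range (fun x => if r x b then (⟦a⟧ : Quotient r) else ⟦x⟧) = {⟦b⟧}ᶜ := by
    ext c
    simp only [Set.mem_range, Set.mem_compl_iff, Set.mem_singleton_iff]
    constructor
    · rintro ⟨x, rfl⟩
      split_ifs with hx
      · exact fun h' => h (Quotient.exact h')
      · exact fun h' => hx (Quotient.exact h')
    · intro hc
      induction c using Quotient.inductionOn with
      | h x => exact ⟨x, if_neg fun h' => hc (Quotient.sound h')⟩
  rw [numClasses, mergeRel, Nat.card_congr e, Nat.card_coe_set_eq, hr, numClasses]
  have := Set.ncard_add_ncard_compl ({⟦b⟧} : Set (Quotient r))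
  rw [Set.ncard_singleton] at this
  omega

/-- The orbits of `ρ` have even size in the strong sense that some matching preserves them. -/
def EvenOrbits {E : Type} (ρ : Perm E) : Prop :=
  ∃ τ : Perm E, IsMatching τ ∧ ∀ r : Setoid E, (∀ x, r x (ρ x)) → ∀ x, r x (τ x)

lemma IsMatching.evenOrbits {E : Type} {α : Perm E} (hα : IsMatching α) : EvenOrbits α :=
  ⟨α, hα, fun _ h => h⟩

/-- Cut the two edges involved. Every remaining component has an even number of half-edges, so it
contains an even number of the four loose ends, and the ends are connected in pairs in one of three
ways. According to the pairing the switch merges two components, splits one, or leaves the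
components as they are. -/
lemma switch_cases {E : Type} [Finite E] {ρ α : Perm E} (hρ : EvenOrbits ρ) (hα : IsMatching α)
    {x y : E} (hxy : y ≠ x) (hxy' : y ≠ α x) :
    (connRel ρ (sw α x y) = mergeRel (connRel ρ α) x y) ∨
    (connRel ρ α = mergeRel (connRel ρ (sw α x y)) x y) ∨
    (connRel ρ α = connRel ρ (sw α x y) ∧ connRel ρ α x y) := by
  classical
  have := Fintype.ofFinite E
  obtain ⟨τ, hτ, hτr⟩ := hρ
  let F : Finset E := {x, α x, y, α y}
  have hF : ∀ z, z ∈ F ↔ z = x ∨ z = α x ∨ z = y ∨ z = α y := fun z => by simp [F]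
  have hFα : ∀ z, z ∉ F → α z ∉ F := by
    intro z hz hz'
    apply hz
    rw [hF] at hz' ⊢
    rcases hz' with h | h | h | h
    · right; left; rw [← h, hα.1]
    · left; exact α.injective h
    · right; right; right; rw [← h, hα.1]
    · right; right; left; exact α.injective h
  -- `r` is connectivity after the two edges with ends in `F` have been cut. It is contained in the
  -- orbit relations before and after the switch.
  let r : Setoid E := Relation.EqvGen.setoid (fun a b => b = ρ a ∨ (a ∉ F ∧ b = α a))
  have hr1 : ∀ z, r z (ρ z) := fun z => Relation.EqvGen.rel _ _ (Or.inl rfl)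
  have hr2 : ∀ z, z ∉ F → r z (α z) := fun z hz => Relation.EqvGen.rel _ _ (Or.inr ⟨hz, rfl⟩)
  have hmin : ∀ s : Setoid E, (∀ z, s z (ρ z)) → (∀ z, z ∉ F → s z (α z)) → r ≤ s := by
    intro s h1 h2 a b hab
    refine Setoid.eqvGen_le (r := fun a b => b = ρ a ∨ (a ∉ F ∧ b = α a)) ?_ hab
    rintro a b (rfl | ⟨h, rfl⟩)
    · exact h1 a
    · exact h2 a h
  have hsw : ∀ z, z ∉ F → sw α x y z = α z := by
    intro z hz
    simp only [hF, not_or] at hz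
    exact sw_apply_of_ne hα hz.1 hz.2.2.1 hz.2.1 hz.2.2.2
  have hne : α y ≠ x := fun h => hxy' (by rw [← h, hα.1])
  have hswx : sw α x y x = α y := sw_apply_left hα hne
  have hswy : sw α x y y = α x := sw_apply_right hα (Ne.symm hxy')
  have hsw' := hα.sw x y
  have hsx' : sw α x y (α y) = x := by rw [← hswx, hsw'.1]
  have hsy' : sw α x y (α x) = y := by rw [← hswy, hsw'.1]
  -- parity
  have hpar : ∀ c : E, Even (F.filter (fun z => r c z)).card := by
    intro c
    have h1 : Even (Finset.univ.filter (fun z => r c z)).card :=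
      hτ.even_card _ (fun z hz => by
        simp only [Finset.mem_filter, Finset.mem_univ, true_and] at hz ⊢
        exact r.trans hz (hτr r hr1 z))
    have h2 : Even ((Finset.univ.filter (fun z => r c z)).filter (fun z => z ∉ F)).card :=
      hα.even_card _ (fun z hz => by
        simp only [Finset.mem_filter, Finset.mem_univ, true_and] at hz ⊢
        exact ⟨r.trans hz.1 (hr2 z hz.2), hFα z hz.2⟩)
    have h3 := Finset.card_filter_add_card_filter_not (s := Finset.univ.filter (fun z => r c z))
      (fun z => z ∈ F)
    have h4 : (Finset.univ.filter (fun z => r c z)).filter (fun z => z ∈ F) =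
        F.filter (fun z => r c z) := by
      ext z; simp [and_comm]
    rw [h4] at h3
    rw [← h3, Nat.even_add] at h1
    exact h1.2 h2
  have hcard : ∀ c : E, (F.filter (fun z => r c z)).card =
      (if r c x then 1 else 0) + (if r c (α x) then 1 else 0) + (if r c y then 1 else 0) +
      (if r c (α y) then 1 else 0) := by
    intro c
    rw [Finset.card_filter]
    change ∑ i ∈ ({x, α x, y, α y} : Finset E), _ = _
    have e1 : x ≠ α x := (hα.2 x).symm
    have e2 : y ≠ α y := (hα.2 y).symm
    have e3 : α x ≠ α y := fun h => hxy (α.injective h).symm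
    rw [Finset.sum_insert, Finset.sum_insert, Finset.sum_insert, Finset.sum_singleton]
    · ring
    · simpa using e2
    · simp only [Finset.mem_insert, Finset.mem_singleton, not_or]
      exact ⟨hxy'.symm, e3⟩
    · simp only [Finset.mem_insert, Finset.mem_singleton, not_or]
      exact ⟨e1, hxy.symm, hne.symm⟩
  have hx := hpar x
  have hy := hpar y
  rw [hcard] at hx hy
  -- The three perfect pairings of the loose ends. The parity count excludes a class with exactly
  -- one or three of them.
  have hcase : (r x (α x) ∧ r y (α y)) ∨ (r x (α y) ∧ r y (α x)) ∨ (r x y ∧ r (α x) (α y)) := by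
    have hxx := r.refl x
    have hyy := r.refl y
    by_cases h1 : r x y
    · by_cases h2 : r x (α x)
      · by_cases h3 : r x (α y)
        · exact Or.inr (Or.inr ⟨h1, r.trans (r.symm h2) h3⟩)
        · simp [h1, h2, h3] at hx; exact absurd hx (by decide)
      · by_cases h3 : r x (α y)
        · simp [h1, h2, h3] at hx; exact absurd hx (by decide)
        · by_cases h4 : r (α x) (α y)
          · exact Or.inr (Or.inr ⟨h1, h4⟩)
          · exfalso
            have hz := hpar (α x)
            rw [hcard] at hz
            have a1 : ¬ r (α x) x := fun h => h2 (r.symm h)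
            have a2 : ¬ r (α x) y := fun h => h2 (r.trans h1 (r.symm h))
            simp [a1, a2, h4] at hz
    · have h1' : ¬ r y x := fun h => h1 (r.symm h)
      by_cases h2 : r x (α x)
      · have h3 : ¬ r y (α x) := fun h => h1 (r.trans h2 (r.symm h))
        by_cases h4 : r y (α y)
        · exact Or.inl ⟨h2, h4⟩
        · simp [h1', h3, h4] at hy
      · by_cases h3 : r x (α y)
        · have h4 : ¬ r y (α y) := fun h => h1 (r.trans h3 (r.symm h))
          by_cases h5 : r y (α x)
          · exact Or.inr (Or.inl ⟨h3, h5⟩)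
          · simp [h1', h4, h5] at hy
        · simp [h1, h2, h3] at hx
  have hro : r ≤ connRel ρ α :=
    hmin _ (connRel_left ρ α) (fun z _ => connRel_right ρ α z)
  have hrn : r ≤ connRel ρ (sw α x y) :=
    hmin _ (connRel_left ρ _) (fun z hz => by rw [← hsw z hz]; exact connRel_right ρ _ z)
  -- Above `r`, only the two cut edges are left to check; `hnew` is the same for the two edges
  -- created by the switch.
  have hold : ∀ s : Setoid E, r ≤ s → s x (α x) → s y (α y) → connRel ρ α ≤ s := by
    intro s hs h1 h2
    refine connRel_le (fun z => hs (hr1 z)) (fun z => ?_)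
    by_cases hz : z ∈ F
    · rcases (hF z).1 hz with rfl | rfl | rfl | rfl
      · exact h1
      · rw [hα.1]; exact s.symm h1
      · exact h2
      · rw [hα.1]; exact s.symm h2
    · exact hs (hr2 z hz)
  have hnew : ∀ s : Setoid E, r ≤ s → s x (α y) → s y (α x) → connRel ρ (sw α x y) ≤ s := by
    intro s hs h1 h2
    refine connRel_le (fun z => hs (hr1 z)) (fun z => ?_)
    by_cases hz : z ∈ F
    · rcases (hF z).1 hz with h | h | h | h
      · rw [h, hswx]; exact h1
      · rw [h, hsy']; exact s.symm h2
      · rw [h, hswy]; exact h2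
      · rw [h, hsx']; exact s.symm h1
    · rw [hsw z hz]; exact hs (hr2 z hz)
  have ox : connRel ρ α x (α x) := connRel_right ρ α x
  have oy : connRel ρ α y (α y) := connRel_right ρ α y
  have nx : connRel ρ (sw α x y) x (α y) := by
    have := connRel_right ρ (sw α x y) x; rwa [hswx] at this
  have ny : connRel ρ (sw α x y) y (α x) := by
    have := connRel_right ρ (sw α x y) y; rwa [hswy] at this
  rcases hcase with ⟨h1, h2⟩ | ⟨h1, h2⟩ | ⟨h1, h2⟩
  · left
    have h0 : connRel ρ α = r := le_antisymm (hold r le_rfl h1 h2) hro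
    rw [h0]
    apply le_antisymm
    · have hp := mergeRel_pair r x y
      have hl := le_mergeRel r x y
      exact hnew _ hl ((mergeRel r x y).trans hp (hl h2))
        ((mergeRel r x y).trans ((mergeRel r x y).symm hp) (hl h1))
    · refine mergeRel_le hrn ?_
      exact (connRel ρ (sw α x y)).trans (hrn h1) ((connRel ρ (sw α x y)).symm ny)
  · right; left
    have h0 : connRel ρ (sw α x y) = r := le_antisymm (hnew r le_rfl h1 h2) hrn
    rw [h0]
    apply le_antisymm
    · have hp := mergeRel_pair r x y
      have hl := le_mergeRel r x y
      exact hold _ hl ((mergeRel r x y).trans hp (hl h2))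
        ((mergeRel r x y).trans ((mergeRel r x y).symm hp) (hl h1))
    · refine mergeRel_le hro ?_
      exact (connRel ρ α).trans (hro h1) ((connRel ρ α).symm oy)
  · right; right
    refine ⟨le_antisymm (hold _ hrn ?_ ?_) (hnew _ hro ?_ ?_), hro h1⟩
    · exact (connRel ρ (sw α x y)).trans (hrn h1)
        ((connRel ρ (sw α x y)).trans ny ((connRel ρ (sw α x y)).trans (hrn h2)
        ((connRel ρ (sw α x y)).trans ((connRel ρ (sw α x y)).symm nx)
        ((connRel ρ (sw α x y)).trans (hrn h1)
        ((connRel ρ (sw α x y)).trans ny ((connRel ρ (sw α x y)).refl _))))))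
    · exact (connRel ρ (sw α x y)).trans (hrn (r.symm h1)) nx
    · exact (connRel ρ α).trans (hro h1) oy
    · exact (connRel ρ α).trans (hro (r.symm h1)) ox

lemma sw_trivial {E : Type} {α : Perm E} (hα : IsMatching α) {x y : E} (h : y = x ∨ y = α x) :
    sw α x y = α := by
  classical
  rcases h with rfl | rfl
  · ext z; simp [sw_apply]
  · ext z
    rw [sw_apply]
    by_cases h1 : z = x
    · subst h1; rw [swap_apply_left, hα.1, swap_apply_left]
    · by_cases h2 : z = α x
      · rw [h2, swap_apply_right, swap_apply_right, hα.1]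
      · rw [swap_apply_of_ne_of_ne h1 h2, swap_apply_of_ne_of_ne]
        · intro h; apply h2; rw [← h, hα.1]
        · intro h; exact h1 (α.injective h)

lemma connRel_sw_of_not {E : Type} [Finite E] {ρ α : Perm E} (hρ : EvenOrbits ρ)
    (hα : IsMatching α) {x y : E} (h : ¬ connRel ρ (sw α x y) x y) :
    connRel ρ α = mergeRel (connRel ρ (sw α x y)) x y := by
  by_cases ht : y = x ∨ y = α x
  · exfalso
    apply h
    rw [sw_trivial hα ht]
    rcases ht with rfl | rfl
    · exact (connRel _ _).refl _
    · exact connRel_right _ _ _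
  · push Not at ht
    rcases switch_cases hρ hα ht.1 ht.2 with h' | h' | h'
    · rw [h'] at h
      exact absurd (mergeRel_pair _ _ _) h
    · exact h'
    · rw [h'.1] at h'
      exact absurd h'.2 h

lemma numClasses_sw_of_not {E : Type} [Finite E] {ρ α : Perm E} (hρ : EvenOrbits ρ)
    (hα : IsMatching α) {x y : E} (h : ¬ connRel ρ (sw α x y) x y) :
    numClasses (connRel ρ (sw α x y)) = numClasses (connRel ρ α) + 1 := by
  rw [connRel_sw_of_not hρ hα h, numClasses_mergeRel h]

lemma numClasses_mergeRel_le {E : Type} [Finite E] (r : Setoid E) (a b : E) :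
    numClasses (mergeRel r a b) ≤ numClasses r := by
  by_cases h : r a b
  · rw [le_antisymm (mergeRel_le le_rfl h) (le_mergeRel r a b)]
  · have := numClasses_mergeRel h
    omega

/-- Together with `numClasses_sw_of_not` this makes "one more component" equivalent to "`x` and `y`
are separated by the switch", the form used in `StepBelow`. -/
lemma numClasses_sw_le_of {E : Type} [Finite E] {ρ α : Perm E} (hρ : EvenOrbits ρ)
    (hα : IsMatching α) {x y : E} (h : connRel ρ (sw α x y) x y) :
    numClasses (connRel ρ (sw α x y)) ≤ numClasses (connRel ρ α) := by
  by_cases ht : y = x ∨ y = α x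
  · rw [sw_trivial hα ht]
  · push Not at ht
    rcases switch_cases hρ hα ht.1 ht.2 with h' | h' | h'
    · rw [h']; exact numClasses_mergeRel_le _ _ _
    · rw [h', le_antisymm (mergeRel_le le_rfl h) (le_mergeRel _ x y)]
    · rw [h'.1]

lemma numClasses_sw_le {E : Type} [Finite E] {ρ α : Perm E} (hρ : EvenOrbits ρ)
    (hα : IsMatching α) (x y : E) :
    numClasses (connRel ρ (sw α x y)) ≤ numClasses (connRel ρ α) + 1 := by
  by_cases h : connRel ρ (sw α x y) x y
  · exact (numClasses_sw_le_of hρ hα h).trans (Nat.le_succ _)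
  · exact (numClasses_sw_of_not hρ hα h).le

/-! ### The order on matchings -/

/-- `β` is obtained from `α` by a switch which increases the number of orbits. -/
def StepBelow {E : Type} (ρ β α : Perm E) : Prop :=
  ∃ x y, β = sw α x y ∧ ¬ connRel ρ β x y

/-- The non-crossing order on matchings. -/
def LeP {E : Type} (ρ : Perm E) : Perm E → Perm E → Prop :=
  Relation.ReflTransGen (StepBelow ρ)

lemma StepBelow.isMatching {E : Type} {ρ β α : Perm E} (h : StepBelow ρ β α)
    (hα : IsMatching α) : IsMatching β := by
  obtain ⟨x, y, rfl, -⟩ := h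
  exact hα.sw x y

lemma LeP.isMatching {E : Type} {ρ β α : Perm E} (h : LeP ρ β α) (hα : IsMatching α) :
    IsMatching β := by
  induction h using Relation.ReflTransGen.head_induction_on with
  | refl => exact hα
  | head h _ ih => exact h.isMatching ih

lemma StepBelow.connRel_le {E : Type} [Finite E] {ρ β α : Perm E} (hρ : EvenOrbits ρ)
    (hα : IsMatching α) (h : StepBelow ρ β α) : connRel ρ β ≤ connRel ρ α := by
  obtain ⟨x, y, rfl, h⟩ := h
  rw [connRel_sw_of_not hρ hα h]
  exact le_mergeRel _ _ _

lemma LeP.connRel_le {E : Type} [Finite E] {ρ β α : Perm E} (hρ : EvenOrbits ρ)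
    (hα : IsMatching α) (h : LeP ρ β α) : connRel ρ β ≤ connRel ρ α := by
  induction h with
  | refl => exact le_rfl
  | tail h1 h2 ih => exact (ih (h2.isMatching hα)).trans (h2.connRel_le hρ hα)

lemma LeP.preserves {E : Type} [Finite E] {ρ β α : Perm E} (hρ : EvenOrbits ρ)
    (hα : IsMatching α) (h : LeP ρ β α) {P : E → Prop} (hP : ∀ x, P (ρ x) ↔ P x)
    (hαP : ∀ x, P (α x) ↔ P x) (x : E) : P (β x) ↔ P x :=
  (connRel_prop P hP hαP (h.connRel_le hρ hα (connRel_right ρ β x))).symm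

lemma numClasses_anti {E : Type} [Finite E] {r s : Setoid E} (h : r ≤ s) :
    numClasses s ≤ numClasses r :=
  Nat.card_le_card_of_surjective (Quotient.map' (s₁ := r) (s₂ := s) id (fun _ _ hab => h hab))
    (fun c => by
      induction c using Quotient.inductionOn with
      | h x => exact ⟨⟦x⟧, rfl⟩)

lemma connRel_self_le {E : Type} (β α : Perm E) : connRel β β ≤ connRel β α :=
  TensorFree.connRel_le (connRel_left β α) (connRel_left β α)

/-- Here `numClasses (connRel β α)` counts the loops of the superposition of two matchings, and for
α = β it counts edges. Each step down to β gains exactly one component and, by `numClasses_sw_le`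
with β in the role of ρ, at most one loop. -/
lemma LeP.le_count {E : Type} [Finite E] {ρ β α : Perm E} (hρ : EvenOrbits ρ)
    (hα : IsMatching α) (h : LeP ρ β α) :
    numClasses (connRel ρ α) + numClasses (connRel β β) ≤
      numClasses (connRel ρ β) + numClasses (connRel β α) := by
  have hβ := (h.isMatching hα).evenOrbits
  induction h with
  | refl => exact le_rfl
  | tail h1 h2 ih =>
    have := ih (h2.isMatching hα)
    obtain ⟨x, y, rfl, h⟩ := h2
    have e1 := numClasses_sw_of_not hρ hα h
    have e2 := numClasses_sw_le hβ hα x y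
    omega

/-- After the switch both matchings join `x` to `β x`, so {x, β x} is a loop of its own, and `α x`
lies outside it. -/
lemma not_connRel_split {E : Type} {α β : Perm E} (hα : IsMatching α) (hβ : IsMatching β) {x : E}
    (hx : α x ≠ β x) : ¬ connRel β (sw α (β x) (α x)) (β x) (α x) := by
  intro h
  have h1 : sw α (β x) (α x) (β x) = x := by
    rw [sw_apply_left hα, hα.1]
    rw [hα.1]; exact (hβ.2 x).symm
  have hs := (hα.sw (β x) (α x)).1
  generalize sw α (β x) (α x) = s at *
  have h2 : s x = β x := by rw [← hs (β x), h1]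
  have key := connRel_prop (fun z => z = x ∨ z = β x) ?_ ?_ h
  · rcases key.1 (Or.inr rfl) with h | h
    · exact hα.2 _ h
    · exact hx h
  · intro z
    constructor
    · rintro (h | h)
      · right; rw [← h, hβ.1]
      · left; exact β.injective h
    · rintro (rfl | rfl)
      · exact Or.inr rfl
      · exact Or.inl (hβ.1 _)
  · intro z
    constructor
    · rintro (h | h)
      · right; rw [← h2, ← h, hs]
      · left; rw [← h1, ← h, hs]
    · rintro (rfl | rfl)
      · exact Or.inr h2
      · exact Or.inl h1

/-- The converse of `LeP.le_count`: while α differs from β, switch so as to create an edge of β.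
This gains a loop and at most one component. In the case of equality every such switch must gain a
component, so the switches form a descending chain from α to β. -/
lemma count_le_and_leP {E : Type} [Finite E] {ρ β : Perm E} (hρ : EvenOrbits ρ)
    (hβ : IsMatching β) (k : ℕ) : ∀ {α : Perm E}, IsMatching α →
      numClasses (connRel β β) - numClasses (connRel β α) = k →
      numClasses (connRel ρ β) + numClasses (connRel β α) ≤
        numClasses (connRel ρ α) + numClasses (connRel β β) ∧
      (numClasses (connRel ρ β) + numClasses (connRel β α) =
        numClasses (connRel ρ α) + numClasses (connRel β β) → LeP ρ β α) := by
  induction k using Nat.strong_induction_on with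
  | _ k ih =>
    intro α hα hk
    by_cases h : α = β
    · subst h; exact ⟨le_rfl, fun _ => Relation.ReflTransGen.refl⟩
    · obtain ⟨x, hx⟩ : ∃ x, α x ≠ β x := by
        by_contra! hc
        exact h (Equiv.ext hc)
      have hL := numClasses_sw_of_not hβ.evenOrbits hα (not_connRel_split hα hβ hx)
      have hle : numClasses (connRel β (sw α (β x) (α x))) ≤ numClasses (connRel β β) :=
        numClasses_anti (connRel_self_le β _)
      have := ih (numClasses (connRel β β) - numClasses (connRel β (sw α (β x) (α x))))
        (by omega) (hα.sw (β x) (α x)) rfl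
      have h1 := numClasses_sw_le hρ hα (β x) (α x)
      refine ⟨by omega, fun heq => ?_⟩
      refine Relation.ReflTransGen.tail (this.2 (by omega)) ⟨β x, α x, rfl, fun hc => ?_⟩
      have := numClasses_sw_le_of hρ hα hc
      omega

/-- If `β ≤ α`, then any edge of `β` can be created first on the way down from `α`. -/
lemma LeP.split {E : Type} [Finite E] {ρ β α : Perm E} (hρ : EvenOrbits ρ)
    (hα : IsMatching α) (h : LeP ρ β α) {x : E} (hx : α x ≠ β x) :
    LeP ρ β (sw α (β x) (α x)) ∧ ¬ connRel ρ (sw α (β x) (α x)) (β x) (α x) := by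
  have hβ := h.isMatching hα
  have h0 := h.le_count hρ hα
  have hL := numClasses_sw_of_not hβ.evenOrbits hα (not_connRel_split hα hβ hx)
  have h1 := count_le_and_leP hρ hβ _ (hα.sw (β x) (α x)) rfl
  have h2 := numClasses_sw_le hρ hα (β x) (α x)
  -- `h0` and the bound in `h1` squeeze the counts. Equality holds below the switched matching, and
  -- the switch itself must have gained a component.
  refine ⟨h1.2 (by omega), fun hc => ?_⟩
  have := numClasses_sw_le_of hρ hα hc
  omega

lemma StepBelow.conn {E : Type} [Finite E] {ρ α : Perm E} (hρ : EvenOrbits ρ)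
    (hα : IsMatching α) {x y : E} (h : ¬ connRel ρ (sw α x y) x y) : connRel ρ α x y := by
  rw [connRel_sw_of_not hρ hα h]
  exact mergeRel_pair _ _ _

/-! ### Restriction and extension of matchings -/

lemma IsMatching.subtypePerm {E : Type} {α : Perm E} (hα : IsMatching α) {P : E → Prop}
    (hP : ∀ x, P (α x) ↔ P x) : IsMatching (α.subtypePerm hP) :=
  ⟨fun x => Subtype.ext (hα.1 x), fun x h => hα.2 x (congrArg Subtype.val h)⟩

lemma connRel_subtypePerm {E : Type} {ρ α : Perm E} {P : E → Prop} (hρ : ∀ x, P (ρ x) ↔ P x)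
    (hα : ∀ x, P (α x) ↔ P x) (x y : {x // P x}) :
    connRel (ρ.subtypePerm hρ) (α.subtypePerm hα) x y ↔ connRel ρ α x y := by
  constructor
  · intro h
    have : connRel (ρ.subtypePerm hρ) (α.subtypePerm hα) ≤ (connRel ρ α).comap Subtype.val :=
      connRel_le (fun z => connRel_left ρ α z) (fun z => connRel_right ρ α z)
    exact this h
  · intro h
    -- Two points of `E` are equivalent when they are connected to the same points of the subtype.
    -- Points outside `P` are connected to none, so this is a setoid on all of `E` and `connRel_le`
    -- applies.
    let s : Setoid E :=
      { r := fun a b => ∀ c : {x // P x}, (∃ ha : P a,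
          connRel (ρ.subtypePerm hρ) (α.subtypePerm hα) c ⟨a, ha⟩) ↔
          ∃ hb : P b, connRel (ρ.subtypePerm hρ) (α.subtypePerm hα) c ⟨b, hb⟩
        iseqv := ⟨fun _ _ => Iff.rfl, fun h c => (h c).symm, fun h h' c => (h c).trans (h' c)⟩ }
    have hs : connRel ρ α ≤ s := by
      refine connRel_le (fun z c => ?_) (fun z c => ?_)
      · constructor
        · rintro ⟨ha, h⟩
          exact ⟨(hρ z).2 ha, (connRel _ _).trans' h (connRel_left (ρ.subtypePerm hρ) (α.subtypePerm hα) ⟨z, ha⟩)⟩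
        · rintro ⟨hb, h⟩
          exact ⟨(hρ z).1 hb, (connRel _ _).trans' h
            ((connRel _ _).symm' (connRel_left (ρ.subtypePerm hρ) (α.subtypePerm hα) ⟨z, (hρ z).1 hb⟩))⟩
      · constructor
        · rintro ⟨ha, h⟩
          exact ⟨(hα z).2 ha, (connRel _ _).trans' h (connRel_right (ρ.subtypePerm hρ) (α.subtypePerm hα) ⟨z, ha⟩)⟩
        · rintro ⟨hb, h⟩
          exact ⟨(hα z).1 hb, (connRel _ _).trans' h
            ((connRel _ _).symm' (connRel_right (ρ.subtypePerm hρ) (α.subtypePerm hα) ⟨z, (hα z).1 hb⟩))⟩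
    obtain ⟨_, h'⟩ := (hs h x).1 ⟨x.2, (connRel _ _).refl' _⟩
    exact h'

lemma sw_subtypePerm {E : Type} {α : Perm E} {P : E → Prop} (hα : ∀ x, P (α x) ↔ P x)
    (x y : {x // P x}) (h : ∀ z, P (sw α x y z) ↔ P z) :
    (sw α x y).subtypePerm h = sw (α.subtypePerm hα) x y := by
  classical
  have hsw : ∀ z : {x // P x}, (swap x y z : E) = swap (x : E) y z := by
    intro z
    simp only [swap_apply_def, Subtype.ext_iff]
    split_ifs <;> rfl
  ext z
  change sw α x y z = _
  rw [sw_apply, sw_apply, hsw, Perm.subtypePerm_apply]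
  simp only [hsw]

/-- A descending switch happens within one component of the upper matching, hence entirely inside
`P` or entirely outside. In the first case it restricts to a step, in the second it becomes
invisible. -/
lemma LeP.subtypePerm {E : Type} [Finite E] {ρ β α : Perm E} (hρ : EvenOrbits ρ)
    (hα : IsMatching α) (h : LeP ρ β α) {P : E → Prop} (hP : ∀ x, P (ρ x) ↔ P x)
    (hαP : ∀ x, P (α x) ↔ P x) (hβP : ∀ x, P (β x) ↔ P x) :
    LeP (ρ.subtypePerm hP) (β.subtypePerm hβP) (α.subtypePerm hαP) := by
  induction h with
  | refl => exact Relation.ReflTransGen.refl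
  | @tail a α h1 h2 ih =>
    have ha := h2.isMatching hα
    have haP := LeP.preserves hρ hα (Relation.ReflTransGen.single h2) hP hαP
    refine Relation.ReflTransGen.trans (ih ha haP) ?_
    obtain ⟨x, y, rfl, h⟩ := h2
    have hxy : P x ↔ P y := connRel_prop P hP hαP (StepBelow.conn hρ hα h)
    by_cases hx : P x
    · refine Relation.ReflTransGen.single ⟨⟨x, hx⟩, ⟨y, hxy.1 hx⟩, ?_, ?_⟩
      · exact sw_subtypePerm hαP ⟨x, hx⟩ ⟨y, hxy.1 hx⟩ haP
      · rw [connRel_subtypePerm]; exact h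
    · have : (sw α x y).subtypePerm haP = α.subtypePerm hαP := by
        ext z
        refine sw_apply_of_ne hα ?_ ?_ ?_ ?_
        · intro h; exact hx (h ▸ z.2)
        · intro h; exact hx (hxy.2 (h ▸ z.2))
        · intro h; exact hx ((hαP x).1 (h ▸ z.2))
        · intro h; exact hx (hxy.2 ((hαP y).1 (h ▸ z.2)))
      rw [this]

open Classical in
/-- The extension of a matching of an invariant subset by a matching of its complement. -/
def extend {E : Type} (P : E → Prop) (a : Perm {x // P x}) (c : Perm E) : Perm E :=
  -- The default 1 does not occur for matchings when `c` preserves `P`; see `extend_apply`.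
  if h : Function.Involutive (fun x => if h : P x then (a ⟨x, h⟩ : E) else c x) then h.toPerm else 1

open Classical in
lemma extend_apply {E : Type} {P : E → Prop} {a : Perm {x // P x}} {c : Perm E}
    (ha : IsMatching a) (hc : IsMatching c) (hcP : ∀ x, P (c x) ↔ P x) (x : E) :
    extend P a c x = if h : P x then (a ⟨x, h⟩ : E) else c x := by
  have h : Function.Involutive (fun x => if h : P x then (a ⟨x, h⟩ : E) else c x) := by
    intro x
    by_cases hx : P x
    · simp [hx, (a ⟨x, hx⟩).2, ha.1]
    · simp [hx, hcP, hc.1]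
  rw [extend, dif_pos h]
  rfl

lemma extend_of_mem {E : Type} {P : E → Prop} {a : Perm {x // P x}} {c : Perm E}
    (ha : IsMatching a) (hc : IsMatching c) (hcP : ∀ x, P (c x) ↔ P x) (x : {x // P x}) :
    extend P a c x = a x := by
  rw [extend_apply ha hc hcP, dif_pos x.2]

lemma extend_of_not {E : Type} {P : E → Prop} {a : Perm {x // P x}} {c : Perm E}
    (ha : IsMatching a) (hc : IsMatching c) (hcP : ∀ x, P (c x) ↔ P x) {x : E} (hx : ¬ P x) :
    extend P a c x = c x := by
  rw [extend_apply ha hc hcP, dif_neg hx]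

lemma extend_preserves {E : Type} {P : E → Prop} {a : Perm {x // P x}} {c : Perm E}
    (ha : IsMatching a) (hc : IsMatching c) (hcP : ∀ x, P (c x) ↔ P x) (x : E) :
    P (extend P a c x) ↔ P x := by
  by_cases hx : P x
  · have := extend_of_mem ha hc hcP ⟨x, hx⟩
    simp only at this
    rw [this]
    exact ⟨fun _ => hx, fun _ => (a ⟨x, hx⟩).2⟩
  · rw [extend_of_not ha hc hcP hx, hcP]

lemma isMatching_extend {E : Type} {P : E → Prop} {a : Perm {x // P x}} {c : Perm E}
    (ha : IsMatching a) (hc : IsMatching c) (hcP : ∀ x, P (c x) ↔ P x) :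
    IsMatching (extend P a c) := by
  constructor
  · intro x
    by_cases hx : P x
    · rw [extend_of_mem ha hc hcP ⟨x, hx⟩, extend_of_mem ha hc hcP, ha.1]
    · rw [extend_of_not ha hc hcP hx, extend_of_not ha hc hcP, hc.1]
      rwa [hcP]
  · intro x
    by_cases hx : P x
    · rw [extend_of_mem ha hc hcP ⟨x, hx⟩]
      exact fun h => ha.2 _ (Subtype.ext h)
    · rw [extend_of_not ha hc hcP hx]
      exact hc.2 x

lemma extend_subtypePerm {E : Type} {P : E → Prop} {a : Perm {x // P x}} {c : Perm E}
    (ha : IsMatching a) (hc : IsMatching c) (hcP : ∀ x, P (c x) ↔ P x)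
    (h : ∀ x, P (extend P a c x) ↔ P x) : (extend P a c).subtypePerm h = a := by
  ext x
  exact extend_of_mem ha hc hcP x

/-- A switch on `P` leaves `c` untouched elsewhere, and whether it separates its two ends can be
decided inside `P`. -/
lemma LeP.extend {E : Type} [Finite E] {ρ : Perm E} {P : E → Prop} (hP : ∀ x, P (ρ x) ↔ P x)
    {a b : Perm {x // P x}} (ha : IsMatching a) (h : LeP (ρ.subtypePerm hP) b a)
    {c : Perm E} (hc : IsMatching c) (hcP : ∀ x, P (c x) ↔ P x) :
    LeP ρ (extend P b c) (extend P a c) := by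
  induction h with
  | refl => exact Relation.ReflTransGen.refl
  | @tail a' a h1 h2 ih =>
    have ha' := h2.isMatching ha
    refine Relation.ReflTransGen.tail (ih ha') ?_
    obtain ⟨x, y, rfl, h⟩ := h2
    have hE := extend_preserves ha hc hcP
    have hE' := extend_preserves ha' hc hcP
    have hM := isMatching_extend ha hc hcP
    have heq : TensorFree.extend P (sw a x y) c = sw (TensorFree.extend P a c) x y := by
      classical
      have hsP : ∀ z, P (swap (x : E) y z) ↔ P z := by
        intro z
        rw [swap_apply_def]
        split_ifs with h1 h2
        · rw [h1]; exact ⟨fun _ => x.2, fun _ => y.2⟩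
        · rw [h2]; exact ⟨fun _ => y.2, fun _ => x.2⟩
        · rfl
      have hsw : ∀ z, P (sw (TensorFree.extend P a c) x y z) ↔ P z := by
        intro z
        rw [sw_apply, hsP, hE, hsP]
      have e := sw_subtypePerm hE x y hsw
      rw [extend_subtypePerm ha hc hcP] at e
      ext z
      by_cases hz : P z
      · rw [extend_of_mem ha' hc hcP ⟨z, hz⟩, ← e]
        rfl
      · rw [extend_of_not ha' hc hcP hz, sw_apply_of_ne hM, extend_of_not ha hc hcP hz]
        · rintro rfl; exact hz x.2
        · rintro rfl; exact hz y.2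
        · rintro rfl; exact hz ((hE _).2 x.2)
        · rintro rfl; exact hz ((hE _).2 y.2)
    refine ⟨x, y, heq, ?_⟩
    rw [← connRel_subtypePerm hP hE']
    rwa [extend_subtypePerm ha' hc hcP]

/-! ### Gluing two matchings along an invariant subset -/

open Classical in
/-- The matching which agrees with `a` on an invariant subset and with `b` elsewhere. -/
def glue {E : Type} (P : E → Prop) (a b : Perm E) : Perm E :=
  if h : Function.Involutive (fun x => if P x then a x else b x) then h.toPerm else 1

open Classical in
lemma glue_apply {E : Type} {P : E → Prop} {a b : Perm E} (ha : IsMatching a) (hb : IsMatching b)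
    (haP : ∀ x, P (a x) ↔ P x) (hbP : ∀ x, P (b x) ↔ P x) (x : E) :
    glue P a b x = if P x then a x else b x := by
  have h : Function.Involutive (fun x => if P x then a x else b x) := by
    intro x
    by_cases hx : P x
    · simp [hx, haP, ha.1]
    · simp [hx, hbP, hb.1]
  rw [glue, dif_pos h]
  rfl

lemma glue_of_mem {E : Type} {P : E → Prop} {a b : Perm E} (ha : IsMatching a)
    (hb : IsMatching b) (haP : ∀ x, P (a x) ↔ P x) (hbP : ∀ x, P (b x) ↔ P x) {x : E} (hx : P x) :
    glue P a b x = a x := by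
  rw [glue_apply ha hb haP hbP, if_pos hx]

lemma glue_of_not {E : Type} {P : E → Prop} {a b : Perm E} (ha : IsMatching a)
    (hb : IsMatching b) (haP : ∀ x, P (a x) ↔ P x) (hbP : ∀ x, P (b x) ↔ P x) {x : E}
    (hx : ¬ P x) : glue P a b x = b x := by
  rw [glue_apply ha hb haP hbP, if_neg hx]

lemma glue_eq_extend {E : Type} {P : E → Prop} {a b : Perm E} (ha : IsMatching a)
    (hb : IsMatching b) (haP : ∀ x, P (a x) ↔ P x) (hbP : ∀ x, P (b x) ↔ P x) :
    glue P a b = extend P (a.subtypePerm haP) b := by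
  classical
  ext x
  rw [glue_apply ha hb haP hbP, extend_apply (ha.subtypePerm haP) hb hbP]
  split_ifs <;> rfl

lemma glue_not {E : Type} {P : E → Prop} {a b : Perm E} (ha : IsMatching a)
    (hb : IsMatching b) (haP : ∀ x, P (a x) ↔ P x) (hbP : ∀ x, P (b x) ↔ P x) :
    glue (fun x => ¬ P x) b a = glue P a b := by
  classical
  ext x
  rw [glue_apply ha hb haP hbP, glue_apply hb ha (fun x => not_congr (hbP x))
    (fun x => not_congr (haP x))]
  split_ifs <;> rfl

lemma isMatching_glue {E : Type} {P : E → Prop} {a b : Perm E} (ha : IsMatching a)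
    (hb : IsMatching b) (haP : ∀ x, P (a x) ↔ P x) (hbP : ∀ x, P (b x) ↔ P x) :
    IsMatching (glue P a b) := by
  rw [glue_eq_extend ha hb haP hbP]
  exact isMatching_extend (ha.subtypePerm haP) hb hbP

lemma glue_preserves {E : Type} {P : E → Prop} {a b : Perm E} (ha : IsMatching a)
    (hb : IsMatching b) (haP : ∀ x, P (a x) ↔ P x) (hbP : ∀ x, P (b x) ↔ P x) (x : E) :
    P (glue P a b x) ↔ P x := by
  rw [glue_eq_extend ha hb haP hbP]
  exact extend_preserves (ha.subtypePerm haP) hb hbP x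

lemma LeP.glue_left {E : Type} [Finite E] {ρ β α c : Perm E} (hρ : EvenOrbits ρ)
    {P : E → Prop} (hP : ∀ x, P (ρ x) ↔ P x) (hα : IsMatching α) (h : LeP ρ β α)
    (hαP : ∀ x, P (α x) ↔ P x) (hc : IsMatching c) (hcP : ∀ x, P (c x) ↔ P x) :
    LeP ρ (glue P β c) (glue P α c) := by
  have hβP := h.preserves hρ hα hP hαP
  rw [glue_eq_extend hα hc hαP hcP, glue_eq_extend (h.isMatching hα) hc hβP hcP]
  exact LeP.extend hP (hα.subtypePerm hαP) (h.subtypePerm hρ hα hP hαP hβP) hc hcP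

lemma LeP.glue_right {E : Type} [Finite E] {ρ β α c : Perm E} (hρ : EvenOrbits ρ)
    {P : E → Prop} (hP : ∀ x, P (ρ x) ↔ P x) (hα : IsMatching α) (h : LeP ρ β α)
    (hαP : ∀ x, P (α x) ↔ P x) (hc : IsMatching c) (hcP : ∀ x, P (c x) ↔ P x) :
    LeP ρ (glue P c β) (glue P c α) := by
  have hβP := h.preserves hρ hα hP hαP
  rw [← glue_not hc hα hcP hαP, ← glue_not hc (h.isMatching hα) hcP hβP]
  exact h.glue_left hρ (fun x => not_congr (hP x)) hα (fun x => not_congr (hαP x)) hc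
    (fun x => not_congr (hcP x))

/-- Matchings that agree on an invariant subset have the same orbits there. -/
lemma connRel_congr {E : Type} {ρ α α' : Perm E} {P : E → Prop} (hP : ∀ x, P (ρ x) ↔ P x)
    (hα : ∀ x, P (α x) ↔ P x) (hα' : ∀ x, P (α' x) ↔ P x) (h : ∀ x, P x → α x = α' x) {x y : E}
    (hx : P x) : connRel ρ α x y ↔ connRel ρ α' x y := by
  have aux : ∀ {a b : Perm E}, (∀ x, P (a x) ↔ P x) → (∀ x, P (b x) ↔ P x) →
      (∀ x, P x → a x = b x) → connRel ρ a x y → connRel ρ b x y := by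
    intro a b ha hb hab hxy
    have hy := (connRel_prop P hP ha hxy).1 hx
    have e : a.subtypePerm ha = b.subtypePerm hb := by
      ext z; exact hab z z.2
    rw [← connRel_subtypePerm hP hb ⟨x, hx⟩ ⟨y, hy⟩, ← e, connRel_subtypePerm]
    exact hxy
  exact ⟨aux hα hα' h, aux hα' hα (fun x hx => (h x hx).symm)⟩

/-! ### The order on trace maps -/

/-- The half-turn `ρ ^ (p / 2)` is the required matching. This is how the evenness of `p` enters the
study of the order. -/
lemma evenOrbits_of_period {E : Type} {ρ : Perm E} {p : ℕ} (hp : Even p) (hp2 : 2 ≤ p)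
    (hρ : ∀ e, Function.minimalPeriod ρ e = p) : EvenOrbits ρ := by
  obtain ⟨k, rfl⟩ := hp
  have hpow : ∀ (n : ℕ) (x : E), (ρ ^ n) x = ρ^[n] x := fun n x => by
    rw [Perm.iterate_eq_pow]
  refine ⟨ρ ^ k, ⟨fun x => ?_, fun x h => ?_⟩, fun r hr x => ?_⟩
  · rw [← Perm.mul_apply, ← pow_add, hpow, ← hρ x, Function.iterate_minimalPeriod]
  · rw [hpow] at h
    have h1 : Function.IsPeriodicPt ρ k x := h
    have := h1.minimalPeriod_le (by omega)
    rw [hρ] at this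
    omega
  · induction k with
    | zero => omega
    | succ k ih =>
      clear ih hp2 hρ
      induction k + 1 with
      | zero => exact r.refl x
      | succ m ih =>
        rw [pow_succ', Perm.mul_apply]
        exact r.trans ih (hr _)

lemma TraceMap.isMatching {p : ℕ} {ι E : Type} (b : TraceMap p ι E) : IsMatching b.edge :=
  ⟨b.edge_edge, b.edge_ne⟩

lemma TraceMap.evenOrbits {p : ℕ} (hp : Even p) (hp2 : 2 ≤ p) {ι E : Type} (b : TraceMap p ι E) :
    EvenOrbits b.rot :=
  evenOrbits_of_period hp hp2 b.rot_period

lemma TraceMap.components_eq {p : ℕ} {ι E : Type} (b : TraceMap p ι E) :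
    b.components = numClasses (connRel b.rot b.edge) := rfl

lemma TraceMap.switchBelow_iff {p : ℕ} (hp : Even p) (hp2 : 2 ≤ p) {ι E : Type} [Finite E]
    (b' b : TraceMap p ι E) : b'.SwitchBelow b ↔
      b'.rot = b.rot ∧ b'.label = b.label ∧ StepBelow b.rot b'.edge b.edge := by
  refine and_congr_right fun h1 => and_congr_right fun _ => ?_
  constructor
  · rintro ⟨⟨x, y, h⟩, h2⟩
    refine ⟨x, y, h, fun hc => ?_⟩
    rw [TraceMap.components_eq, TraceMap.components_eq, h1] at h2
    have h' : b'.edge = sw b.edge x y := h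
    rw [h'] at hc h2
    have := numClasses_sw_le_of (b.evenOrbits hp hp2) b.isMatching hc
    omega
  · rintro ⟨x, y, h, hc⟩
    refine ⟨⟨x, y, h⟩, ?_⟩
    rw [TraceMap.components_eq, TraceMap.components_eq, h1]
    rw [h] at hc ⊢
    exact numClasses_sw_of_not (b.evenOrbits hp hp2) b.isMatching hc

lemma TraceMap.le_iff {p : ℕ} (hp : Even p) (hp2 : 2 ≤ p) {ι E : Type} [Finite E]
    (b' b : TraceMap p ι E) : b'.Le b ↔
      b'.rot = b.rot ∧ b'.label = b.label ∧ LeP b.rot b'.edge b.edge := by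
  constructor
  · intro h
    induction h with
    | refl => exact ⟨rfl, rfl, Relation.ReflTransGen.refl⟩
    | tail h1 h2 ih =>
      obtain ⟨e1, e2, e3⟩ := (TraceMap.switchBelow_iff hp hp2 _ _).1 h2
      refine ⟨ih.1.trans e1, ih.2.1.trans e2, ?_⟩
      rw [e1] at ih
      exact ih.2.2.tail e3
  · rintro ⟨h1, h2, h3⟩
    have key : ∀ β : Perm E, LeP b.rot β b.edge → ∀ c : TraceMap p ι E, c.rot = b.rot →
        c.label = b.label → c.edge = β → c.Le b := by
      intro β hβ
      induction hβ using Relation.ReflTransGen.head_induction_on with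
      | refl =>
        intro c h1 h2 h3
        rw [TraceMap.ext_perm h1 h3 h2]
        exact Relation.ReflTransGen.refl
      | @head β γ hs hl ih =>
        intro c h1 h2 h3
        have hγ := LeP.isMatching hl b.isMatching
        -- The intermediate matchings of a chain have to be turned back into trace maps; they stay
        -- matchings by `LeP.isMatching`.
        let d : TraceMap p ι E :=
          { b with
            edge := γ
            edge_edge := hγ.1
            edge_ne := hγ.2 }
        refine Relation.ReflTransGen.head ?_ (ih d rfl rfl rfl)
        rw [TraceMap.switchBelow_iff hp hp2]
        refine ⟨h1, h2, ?_⟩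
        rw [h3]
        exact hs
    exact key _ h3 b' h1 h2 rfl

/-! ### Characterization and invariance of the cumulants -/

lemma Distribution.val_eq_sum {p : ℕ} {ι : Type} [Finite ι] (φ : Distribution p ι) {E : Type}
    [Finite E] (b : TraceMap p ι E) [Fintype {b' : TraceMap p ι E // b'.Le b}] :
    φ.val b = ∑ b' : {b' : TraceMap p ι E // b'.Le b}, φ.cumulant b'.1 := by
  rw [φ.val_eq_sum_cumulant, ← finsum_eq_sum_of_fintype]
  exact (finsum_set_coe_eq_finsum_mem {b' : TraceMap p ι E | b'.Le b}).symm

lemma TraceMap.le_eq_or_lt {p : ℕ} {ι E : Type} {b' b : TraceMap p ι E} (h : b'.Le b) :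
    b' = b ∨ b'.Lt b := by
  rcases Relation.reflTransGen_iff_eq_or_transGen.1 h with h | h
  · exact Or.inl h.symm
  · exact Or.inr h

/-- The cumulants are characterized by their defining relation. -/
lemma Distribution.cumulant_unique {p : ℕ} {ι : Type} [Finite ι] (φ : Distribution p ι) {E : Type}
    [Finite E] (f : TraceMap p ι E → ℝ)
    (h : ∀ b : TraceMap p ι E, φ.val b = ∑ᶠ b' : {b' : TraceMap p ι E // b'.Le b}, f b'.1)
    (b : TraceMap p ι E) : φ.cumulant b = f b := by
  classical
  induction hn : Nat.card E - b.components using Nat.strong_induction_on generalizing b with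
  | _ n ih =>
    have := Fintype.ofFinite {b' : TraceMap p ι E // b'.Le b}
    have h1 := h b
    rw [φ.val_eq_sum b, finsum_eq_sum_of_fintype] at h1
    have hb : b.Le b := Relation.ReflTransGen.refl
    -- All terms other than `b` have more components, so the induction hypothesis cancels them.
    rw [Fintype.sum_eq_add_sum_compl ⟨b, hb⟩, Fintype.sum_eq_add_sum_compl ⟨b, hb⟩] at h1
    have h2 : ∑ b' ∈ ({⟨b, hb⟩}ᶜ : Finset {b' : TraceMap p ι E // b'.Le b}), φ.cumulant b'.1 =
        ∑ b' ∈ ({⟨b, hb⟩}ᶜ : Finset {b' : TraceMap p ι E // b'.Le b}), f b'.1 := by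
      refine Finset.sum_congr rfl fun b' hb' => ?_
      rcases TraceMap.le_eq_or_lt b'.2 with h3 | h3
      · simp only [Finset.mem_compl, Finset.mem_singleton] at hb'
        exact absurd (Subtype.ext h3) hb'
      · have h4 := h3.components_lt
        have h5 := b'.1.components_le_card
        exact ih _ (by omega) b'.1 rfl
    rw [h2] at h1
    exact add_right_cancel h1

/-- Transport of trace maps along a bijection of half-edges. -/
def TraceMap.transport {p : ℕ} {ι E E' : Type} (e : E ≃ E') (b : TraceMap p ι E) :
    TraceMap p ι E' where
  rot := e.permCongr b.rot
  edge := e.permCongr b.edge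
  label x := b.label (e.symm x)
  rot_period x := by
    refine Eq.trans ?_ (b.rot_period (e.symm x))
    rw [Function.minimalPeriod_eq_minimalPeriod_iff]
    intro n
    have h : ∀ n : ℕ, (e.permCongr b.rot)^[n] x = e (b.rot^[n] (e.symm x)) := by
      intro n
      induction n with
      | zero => simp
      | succ k ih =>
        rw [Function.iterate_succ_apply', ih, Function.iterate_succ_apply', permCongr_apply,
          symm_apply_apply]
    rw [Function.IsPeriodicPt, Function.IsFixedPt, h, Function.IsPeriodicPt, Function.IsFixedPt,
      ← Equiv.eq_symm_apply]
  edge_edge x := by simp [permCongr_apply, b.edge_edge]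
  edge_ne x h := by
    rw [permCongr_apply, ← Equiv.eq_symm_apply] at h
    exact b.edge_ne _ h
  label_rot x := by simp [permCongr_apply, b.label_rot]

/-- A trace map is isomorphic to its transport. -/
def TraceMap.transportIso {p : ℕ} {ι E E' : Type} (e : E ≃ E') (b : TraceMap p ι E) :
    b.Iso (b.transport e) where
  toEquiv := e
  map_rot x := by simp [TraceMap.transport, permCongr_apply]
  map_edge x := by simp [TraceMap.transport, permCongr_apply]
  map_label x := by simp [TraceMap.transport]

lemma TraceMap.Iso.transport_eq {p : ℕ} {ι E E' : Type} {b : TraceMap p ι E}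
    {b' : TraceMap p ι E'} (f : b.Iso b') : b.transport f.toEquiv = b' := by
  apply TraceMap.ext_perm
  · ext x; simp [TraceMap.transport, permCongr_apply, f.map_rot]
  · ext x; simp [TraceMap.transport, permCongr_apply, f.map_edge]
  · funext x
    simp [TraceMap.transport, ← f.map_label]

lemma TraceMap.transport_symm_transport {p : ℕ} {ι E E' : Type} (e : E ≃ E')
    (b : TraceMap p ι E) : (b.transport e).transport e.symm = b := by
  apply TraceMap.ext_perm
  · ext x; simp [TraceMap.transport, permCongr_apply]
  · ext x; simp [TraceMap.transport, permCongr_apply]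
  · funext x; simp [TraceMap.transport]

lemma TraceMap.Iso.connRel_iff {p : ℕ} {ι E E' : Type} {b : TraceMap p ι E}
    {b' : TraceMap p ι E'} (f : b.Iso b') (x y : E) :
    connRel b'.rot b'.edge (f.toEquiv x) (f.toEquiv y) ↔ connRel b.rot b.edge x y := by
  constructor
  · intro h
    have : connRel b'.rot b'.edge ≤ (connRel b.rot b.edge).comap f.toEquiv.symm := by
      refine connRel_le (fun z => ?_) (fun z => ?_)
      · change connRel b.rot b.edge (f.toEquiv.symm z) (f.toEquiv.symm (b'.rot z))
        have e : f.toEquiv.symm (b'.rot z) = b.rot (f.toEquiv.symm z) := by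
          rw [Equiv.symm_apply_eq, f.map_rot, apply_symm_apply]
        rw [e]
        exact connRel_left _ _ _
      · change connRel b.rot b.edge (f.toEquiv.symm z) (f.toEquiv.symm (b'.edge z))
        have e : f.toEquiv.symm (b'.edge z) = b.edge (f.toEquiv.symm z) := by
          rw [Equiv.symm_apply_eq, f.map_edge, apply_symm_apply]
        rw [e]
        exact connRel_right _ _ _
    have h1 := this h
    change connRel b.rot b.edge (f.toEquiv.symm _) (f.toEquiv.symm _) at h1
    simpa using h1
  · intro h
    have : connRel b.rot b.edge ≤ (connRel b'.rot b'.edge).comap f.toEquiv := by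
      refine connRel_le (fun z => ?_) (fun z => ?_)
      · change connRel b'.rot b'.edge (f.toEquiv z) (f.toEquiv (b.rot z))
        rw [f.map_rot]
        exact connRel_left _ _ _
      · change connRel b'.rot b'.edge (f.toEquiv z) (f.toEquiv (b.edge z))
        rw [f.map_edge]
        exact connRel_right _ _ _
    exact this h

lemma TraceMap.Iso.components_eq {p : ℕ} {ι E E' : Type} {b : TraceMap p ι E}
    {b' : TraceMap p ι E'} (f : b.Iso b') : b.components = b'.components :=
  Nat.card_congr (Quotient.congr f.toEquiv fun x y => (f.connRel_iff x y).symm)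

lemma TraceMap.Le.transport {p : ℕ} {ι E E' : Type} (e : E ≃ E') {b' b : TraceMap p ι E}
    (h : b'.Le b) : (b'.transport e).Le (b.transport e) := by
  induction h with
  | refl => exact Relation.ReflTransGen.refl
  | @tail c d _ h ih =>
  refine ih.tail ?_
  obtain ⟨h1, h2, ⟨x, y, h3⟩, h4⟩ := h
  refine ⟨?_, ?_, ⟨e x, e y, ?_⟩, ?_⟩
  · simp [TraceMap.transport, h1]
  · simp [TraceMap.transport, h2]
  · classical
    ext z
    have hs : ∀ z, swap (e x) (e y) z = e (swap x y (e.symm z)) := by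
      intro z
      rw [← Equiv.symm_trans_swap_trans]
      rfl
    have h3' : ∀ z, c.edge z = swap x y (d.edge (swap x y z)) := by
      intro z
      rw [h3, Perm.mul_apply, Perm.mul_apply]
    have : (e.permCongr c.edge) z = swap (e x) (e y) (e.permCongr d.edge (swap (e x) (e y) z)) := by
      rw [permCongr_apply, permCongr_apply, h3', hs, hs]
      simp
    rw [Perm.mul_apply, Perm.mul_apply]
    exact this.trans (by congr!)
  · rw [← (c.transportIso e).components_eq, ← (d.transportIso e).components_eq, h4]

/-- Transport is an isomorphism for the order, so the transported cumulants satisfy the defining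
relation too, and uniqueness applies. -/
lemma Distribution.cumulant_iso {p : ℕ} {ι : Type} [Finite ι] (φ : Distribution p ι)
    {E E' : Type} [Finite E] [Finite E'] (b : TraceMap p ι E) (b' : TraceMap p ι E')
    (f : b.Iso b') : φ.cumulant b = φ.cumulant b' := by
  rw [← f.transport_eq]
  generalize f.toEquiv = e
  refine φ.cumulant_unique (fun b => φ.cumulant (b.transport e)) (fun b => ?_) b
  have := Fintype.ofFinite {c : TraceMap p ι E' // c.Le (b.transport e)}
  rw [φ.val_iso b _ (b.transportIso e), φ.val_eq_sum, ← finsum_eq_sum_of_fintype]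
  let E : {c : TraceMap p ι E // c.Le b} ≃ {c : TraceMap p ι E' // c.Le (b.transport e)} :=
    { toFun := fun c => ⟨c.1.transport e, c.2.transport e⟩
      invFun := fun c => ⟨c.1.transport e.symm, by
        have := c.2.transport e.symm
        rwa [TraceMap.transport_symm_transport] at this⟩
      left_inv := fun c => Subtype.ext (c.1.transport_symm_transport e)
      right_inv := fun c => Subtype.ext (c.1.transport_symm_transport e.symm) }
  exact (finsum_comp_equiv E).symm

/-! ### Cumulants of a sum -/

lemma TraceMap.Le.constLabel {p : ℕ} {ι κ E : Type} {b' b : TraceMap p ι E} (h : b'.Le b)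
    (i : κ) : (b'.constLabel i).Le (b.constLabel i) := by
  induction h with
  | refl => exact Relation.ReflTransGen.refl
  | tail _ h ih => exact ih.tail ⟨h.1, rfl, h.2.2.1, h.2.2.2⟩

lemma TraceMap.Le.rot_eq {p : ℕ} {ι E : Type} {b' b : TraceMap p ι E} (h : b'.Le b) :
    b'.rot = b.rot := by
  induction h with
  | refl => rfl
  | tail _ h ih => exact ih.trans h.1

lemma TraceMap.Le.label_eq {p : ℕ} {ι E : Type} {b' b : TraceMap p ι E} (h : b'.Le b) :
    b'.label = b.label := by
  induction h with
  | refl => rfl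
  | tail _ h ih => exact ih.trans h.2.1

lemma TraceMap.Le.relabel {p : ℕ} {ι κ E : Type} {b' b : TraceMap p κ E} (h : b'.Le b)
    (l : E → ι) (hl : ∀ e, l (b.rot e) = l e) (hl' : ∀ e, l (b'.rot e) = l e) :
    (b'.relabel ⟨l, hl'⟩).Le (b.relabel ⟨l, hl⟩) := by
  induction h with
  | refl => exact Relation.ReflTransGen.refl
  | @tail c d h1 h2 ih =>
    have hc : ∀ e, l (c.rot e) = l e := by rw [h2.1]; exact hl
    exact (ih hc).tail ⟨h2.1, rfl, h2.2.2.1, h2.2.2.2⟩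

/-- The cumulants of a sum are obtained by summing over the labelings. -/
lemma Distribution.sum_cumulant {p : ℕ} {ι : Type} [Finite ι] (φ : Distribution p ι) {E : Type}
    [Finite E] (b : TraceMap p Unit E) :
    φ.sum.cumulant b = ∑ᶠ l : b.Labeling ι, φ.cumulant (b.relabel l) := by
  refine φ.sum.cumulant_unique
    (fun b => ∑ᶠ l : b.Labeling ι, φ.cumulant (b.relabel l)) (fun b => ?_) b
  change ∑ᶠ l : b.Labeling ι, φ.val (b.relabel l) = _
  have i1 : ∀ c : TraceMap p Unit E, Fintype (c.Labeling ι) := fun c => Fintype.ofFinite _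
  have i2 : ∀ l : b.Labeling ι, Fintype {c : TraceMap p ι E // c.Le (b.relabel l)} :=
    fun l => Fintype.ofFinite _
  have i3 : Fintype {c : TraceMap p Unit E // c.Le b} := Fintype.ofFinite _
  simp only [finsum_eq_sum_of_fintype]
  simp only [φ.val_eq_sum]
  rw [← Fintype.sum_sigma' (fun (l : b.Labeling ι) (c : {c : TraceMap p ι E // c.Le (b.relabel l)})
      => φ.cumulant c.1),
    ← Fintype.sum_sigma' (fun (c : {c : TraceMap p Unit E // c.Le b}) (l : c.1.Labeling ι)
      => φ.cumulant (c.1.relabel l))]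
  -- The order changes neither vertices nor labels, so labeling and then going down is the same as
  -- going down and then labeling.
  let e : (Σ l : b.Labeling ι, {c : TraceMap p ι E // c.Le (b.relabel l)}) ≃
      (Σ c : {c : TraceMap p Unit E // c.Le b}, c.1.Labeling ι) :=
    { toFun := fun x => ⟨⟨x.2.1.constLabel (), by
          have := TraceMap.Le.constLabel x.2.2 ()
          exact this⟩, ⟨x.2.1.label, x.2.1.label_rot⟩⟩
      invFun := fun x => ⟨⟨x.2.1, fun e => by rw [← x.1.2.rot_eq, x.2.2]⟩,
        ⟨x.1.1.relabel x.2, x.1.2.relabel _ _ _⟩⟩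
      left_inv := by
        rintro ⟨⟨l, hl⟩, ⟨c, hc⟩⟩
        have h1 : c.label = l := hc.label_eq
        subst h1
        rfl
      right_inv := by
        rintro ⟨⟨c, hc⟩, l⟩
        rfl }
  exact Fintype.sum_equiv e _ _ (fun x => rfl)

lemma Distribution.marginal_cumulant {p : ℕ} {ι : Type} [Finite ι] (φ : Distribution p ι) (i : ι)
    {E : Type} [Finite E] (b : TraceMap p Unit E) :
    (φ.marginal i).cumulant b = φ.cumulant (b.constLabel i) := by
  refine (φ.marginal i).cumulant_unique (fun b => φ.cumulant (b.constLabel i)) (fun b => ?_) b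
  change φ.val (b.constLabel i) = _
  have := Fintype.ofFinite {c : TraceMap p ι E // c.Le (b.constLabel i)}
  rw [φ.val_eq_sum, ← finsum_eq_sum_of_fintype]
  let e : {c : TraceMap p Unit E // c.Le b} ≃ {c : TraceMap p ι E // c.Le (b.constLabel i)} :=
    { toFun := fun c => ⟨c.1.constLabel i, c.2.constLabel i⟩
      invFun := fun c => ⟨c.1.constLabel (), by
        have := c.2.constLabel ()
        exact this⟩
      left_inv := fun c => rfl
      right_inv := fun c => Subtype.ext (TraceMap.ext_perm rfl rfl c.2.label_eq.symm) }
  exact (finsum_comp_equiv e).symm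

lemma TraceMap.Connected.connRel {p : ℕ} {ι E : Type} [Finite E] {b : TraceMap p ι E}
    (h : b.Connected) (x y : E) : connRel b.rot b.edge x y := by
  have h1 : Nat.card (Quotient (TensorFree.connRel b.rot b.edge)) = 1 := h
  have := (Nat.card_eq_one_iff_unique.1 h1).1
  exact Quotient.exact (Subsingleton.elim (⟦x⟧ : Quotient (TensorFree.connRel b.rot b.edge)) ⟦y⟧)

lemma TraceMap.connected_of_connRel {p : ℕ} {ι E : Type} [Finite E] [Nonempty E]
    {b : TraceMap p ι E} (h : ∀ x y, TensorFree.connRel b.rot b.edge x y) : b.Connected := by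
  change Nat.card (Quotient (TensorFree.connRel b.rot b.edge)) = 1
  rw [Nat.card_eq_one_iff_unique]
  refine ⟨⟨fun c d => ?_⟩, ⟨⟦Classical.arbitrary E⟧⟩⟩
  induction c, d using Quotient.inductionOn₂ with
  | h x y => exact Quotient.sound (h x y)

/-- The free cumulants linearize the addition of free tensors. -/
lemma Distribution.Free.sum_cumulant {p : ℕ} {φ : Distribution p Bool} (hφ : φ.Free) {E : Type}
    [Finite E] [Nonempty E] (b : TraceMap p Unit E) (hb : b.Connected) :
    φ.sum.cumulant b = (φ.marginal false).cumulant b + (φ.marginal true).cumulant b := by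
  classical
  have := Fintype.ofFinite (b.Labeling Bool)
  rw [φ.sum_cumulant, finsum_eq_sum_of_fintype, φ.marginal_cumulant, φ.marginal_cumulant]
  obtain ⟨c, hci, h0⟩ : ∃ c : Bool → b.Labeling Bool, (∀ i e, (c i).1 e = i) ∧
      ∀ i, b.constLabel i = b.relabel (c i) :=
    ⟨fun i => ⟨fun _ => i, fun _ => rfl⟩, fun _ _ => rfl, fun _ => rfl⟩
  have hc : c false ≠ c true := by
    intro h
    have := congrFun (congrArg Subtype.val h) (Classical.arbitrary E)
    simp [hci] at this
  rw [h0, h0, ← Finset.sum_pair hc (f := fun l => φ.cumulant (b.relabel l))]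
  symm
  -- A labeling other than the two constant ones uses both letters on a connected map, so its
  -- cumulant vanishes by freeness.
  apply Finset.sum_subset (Finset.subset_univ {c false, c true})
  · intro l _ hl
    have hl' : (b.relabel l).Connected := hb
    refine hφ (b.relabel l) hl' ?_
    by_contra! hcon
    replace hcon : ∀ e e', l.1 e = l.1 e' := hcon
    apply hl
    have : l = c (l.1 (Classical.arbitrary E)) :=
      Subtype.ext (funext fun e => (hcon e (Classical.arbitrary E)).trans (hci _ _).symm)
    rw [this]
    cases l.1 (Classical.arbitrary E) <;> simp

/-! ### Weights of restricted maps -/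

lemma minimalPeriod_subtypePerm {E : Type} {ρ : Perm E} {P : E → Prop} (hP : ∀ x, P (ρ x) ↔ P x)
    (x : {x // P x}) :
    Function.minimalPeriod (ρ.subtypePerm hP) x = Function.minimalPeriod ρ x := by
  rw [Function.minimalPeriod_eq_minimalPeriod_iff]
  intro n
  have h : ∀ n : ℕ, (((ρ.subtypePerm hP)^[n] x : {x // P x}) : E) = ρ^[n] x := by
    intro n
    induction n with
    | zero => rfl
    | succ k ih => rw [Function.iterate_succ_apply', Function.iterate_succ_apply', ← ih]; rfl
  rw [Function.IsPeriodicPt, Function.IsFixedPt, Function.IsPeriodicPt, Function.IsFixedPt, ← h,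
    Subtype.ext_iff]

/-- The trace map with vertices the cycles of `ρ` in the invariant subset `P` and with edges
given by `α`. -/
def subMap {p : ℕ} {E : Type} {ρ α : Perm E} {P : E → Prop}
    (hρ : ∀ e, Function.minimalPeriod ρ e = p) (hP : ∀ x, P (ρ x) ↔ P x) (hα : IsMatching α)
    (hαP : ∀ x, P (α x) ↔ P x) : TraceMap p Unit {x // P x} where
  rot := ρ.subtypePerm hP
  edge := α.subtypePerm hαP
  label _ := ()
  rot_period x := by rw [minimalPeriod_subtypePerm, hρ]
  edge_edge := (hα.subtypePerm hαP).1
  edge_ne := (hα.subtypePerm hαP).2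
  label_rot _ := rfl

/-- Functions of trace maps. -/
abbrev MapFun (p : ℕ) : Type 1 := ∀ (E : Type) [Finite E], TraceMap p Unit E → ℝ

open Classical in
/-- The value of a function of trace maps on the restriction of a matching to an invariant
subset. -/
def onSub {p : ℕ} (w : MapFun p) {E : Type} [Finite E] (ρ : Perm E) (P : E → Prop) (α : Perm E) :
    ℝ :=
  -- The default 0 removes proof arguments, so that sums can range over plain permutations.
  if h : (∀ e, Function.minimalPeriod ρ e = p) ∧ (∀ x, P (ρ x) ↔ P x) ∧ IsMatching α ∧
    (∀ x, P (α x) ↔ P x) then w _ (subMap h.1 h.2.1 h.2.2.1 h.2.2.2) else 0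

lemma onSub_eq {p : ℕ} (w : MapFun p) {E : Type} [Finite E] {ρ α : Perm E} {P : E → Prop}
    (hρ : ∀ e, Function.minimalPeriod ρ e = p) (hP : ∀ x, P (ρ x) ↔ P x) (hα : IsMatching α)
    (hαP : ∀ x, P (α x) ↔ P x) : onSub w ρ P α = w _ (subMap hρ hP hα hαP) :=
  dif_pos ⟨hρ, hP, hα, hαP⟩

/-- The values of a distribution. -/
abbrev Distribution.valFun {p : ℕ} (a : Distribution p Unit) : MapFun p := fun _ _ b => a.val b

/-- The cumulants of a distribution. -/
abbrev Distribution.cumFun {p : ℕ} (a : Distribution p Unit) : MapFun p :=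
  fun _ _ b => a.cumulant b

lemma onSub_congr {p : ℕ} (w : MapFun p) {E : Type} [Finite E] {ρ α α' : Perm E} {P : E → Prop}
    (hρ : ∀ e, Function.minimalPeriod ρ e = p) (hP : ∀ x, P (ρ x) ↔ P x) (hα : IsMatching α)
    (hαP : ∀ x, P (α x) ↔ P x) (hα' : IsMatching α') (hαP' : ∀ x, P (α' x) ↔ P x)
    (h : ∀ x, P x → α x = α' x) : onSub w ρ P α = onSub w ρ P α' := by
  rw [onSub_eq w hρ hP hα hαP, onSub_eq w hρ hP hα' hαP']
  congr 1
  refine TraceMap.ext_perm rfl ?_ rfl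
  ext x
  exact h x x.2

open Classical in
/-- The matchings below `α` that agree with `α` outside of `P`. -/
def below {E : Type} [Fintype E] (ρ : Perm E) (P : E → Prop) (α : Perm E) : Finset (Perm E) :=
  Finset.univ.filter fun β => LeP ρ β α ∧ ∀ x, ¬ P x → β x = α x

lemma mem_below {E : Type} [Fintype E] {ρ : Perm E} {P : E → Prop} {α β : Perm E} :
    β ∈ below ρ P α ↔ LeP ρ β α ∧ ∀ x, ¬ P x → β x = α x := by
  simp [below]

/-- The moment-cumulant relation of the restricted map, written on the full set of half-edges:
extension by α and restriction to `P` are inverse to each other. -/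
lemma Distribution.val_onSub {p : ℕ} (hp : Even p) (hp2 : 2 ≤ p) (a : Distribution p Unit)
    {E : Type} [Fintype E] {ρ α : Perm E} {P : E → Prop}
    (hρ : ∀ e, Function.minimalPeriod ρ e = p) (hP : ∀ x, P (ρ x) ↔ P x) (hα : IsMatching α)
    (hαP : ∀ x, P (α x) ↔ P x) :
    onSub a.valFun ρ P α = ∑ β ∈ below ρ P α, onSub a.cumFun ρ P β := by
  classical
  have hev := evenOrbits_of_period hp hp2 hρ
  have := Fintype.ofFinite {b // TraceMap.Le b (subMap hρ hP hα hαP)}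
  rw [onSub_eq _ hρ hP hα hαP]
  refine (a.val_eq_sum _).trans (Eq.symm ?_)
  have hM : ∀ β ∈ below ρ P α, IsMatching β ∧ ∀ x, P (β x) ↔ P x := fun β hβ =>
    ⟨(mem_below.1 hβ).1.isMatching hα, (mem_below.1 hβ).1.preserves hev hα hP hαP⟩
  refine Finset.sum_bij (fun β hβ => ⟨subMap hρ hP (hM β hβ).1 (hM β hβ).2, ?_⟩)
    (fun _ _ => Finset.mem_univ _) ?_ ?_ ?_
  · rw [TraceMap.le_iff hp hp2]
    exact ⟨rfl, rfl, (mem_below.1 hβ).1.subtypePerm hev hα hP hαP (hM β hβ).2⟩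
  · intro β hβ γ hγ h
    have h1 := congrArg (fun b => TraceMap.edge b.1) h
    ext x
    by_cases hx : P x
    · exact congrArg Subtype.val (Equiv.congr_fun h1 ⟨x, hx⟩)
    · rw [(mem_below.1 hβ).2 x hx, (mem_below.1 hγ).2 x hx]
  · rintro ⟨b, hb⟩ -
    have hb' := (TraceMap.le_iff hp hp2 _ _).1 hb
    have hext : extend P (α.subtypePerm hαP) α = α := by
      ext x
      by_cases hx : P x
      · exact extend_of_mem (hα.subtypePerm hαP) hα hαP ⟨x, hx⟩
      · exact extend_of_not (hα.subtypePerm hαP) hα hαP hx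
    have hbM := b.isMatching
    refine ⟨extend P b.edge α, mem_below.2 ⟨?_, ?_⟩, ?_⟩
    · have h1 : LeP ρ (extend P b.edge α) (extend P (α.subtypePerm hαP) α) :=
        LeP.extend hP (hα.subtypePerm hαP) hb'.2.2 hα hαP
      rwa [hext] at h1
    · intro x hx
      exact extend_of_not hbM hα hαP hx
    · refine Subtype.ext (TraceMap.ext_perm hb'.1.symm ?_ rfl)
      exact extend_subtypePerm hbM hα hαP (extend_preserves hbM hα hαP)
  · intro β hβ
    exact onSub_eq _ hρ hP (hM β hβ).1 (hM β hβ).2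

/-- Disjoint invariant subsets give a disjoint union. -/
def subMapOrIso {p : ℕ} {E : Type} {ρ α : Perm E} {P Q : E → Prop} [DecidablePred P]
    (hPQ : ∀ x, P x → ¬ Q x) (hρ : ∀ e, Function.minimalPeriod ρ e = p)
    (hP : ∀ x, P (ρ x) ↔ P x) (hQ : ∀ x, Q (ρ x) ↔ Q x) (hα : IsMatching α)
    (hαP : ∀ x, P (α x) ↔ P x) (hαQ : ∀ x, Q (α x) ↔ Q x) :
    ((subMap hρ hP hα hαP).disjUnion (subMap hρ hQ hα hαQ)).Iso
      (subMap (P := fun x => P x ∨ Q x) hρ (fun x => or_congr (hP x) (hQ x)) hα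
        (fun x => or_congr (hαP x) (hαQ x))) where
  toEquiv :=
    { toFun := Sum.elim (fun x => ⟨x.1, Or.inl x.2⟩) (fun x => ⟨x.1, Or.inr x.2⟩)
      invFun := fun x => if h : P x.1 then Sum.inl ⟨x.1, h⟩ else Sum.inr ⟨x.1, x.2.resolve_left h⟩
      left_inv := by
        rintro (x | x)
        · simp [x.2]
        · have : ¬ P x.1 := fun h => hPQ _ h x.2
          simp [this]
      right_inv := by
        rintro ⟨x, hx⟩
        by_cases h : P x <;> simp [h] }
  map_rot := by rintro (x | x) <;> rfl
  map_edge := by rintro (x | x) <;> rfl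
  map_label _ := rfl

lemma Distribution.val_onSub_or {p : ℕ} (a : Distribution p Unit) {E : Type} [Finite E]
    {ρ α : Perm E} {P Q : E → Prop} (hPQ : ∀ x, P x → ¬ Q x)
    (hρ : ∀ e, Function.minimalPeriod ρ e = p)
    (hP : ∀ x, P (ρ x) ↔ P x) (hQ : ∀ x, Q (ρ x) ↔ Q x) (hα : IsMatching α)
    (hαP : ∀ x, P (α x) ↔ P x) (hαQ : ∀ x, Q (α x) ↔ Q x) :
    onSub a.valFun ρ (fun x => P x ∨ Q x) α = onSub a.valFun ρ P α * onSub a.valFun ρ Q α := by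
  classical
  rw [onSub_eq _ hρ hP hα hαP, onSub_eq _ hρ hQ hα hαQ,
    onSub_eq _ hρ (fun x => or_congr (hP x) (hQ x)) hα (fun x => or_congr (hαP x) (hαQ x))]
  refine Eq.trans ?_ (a.val_disjUnion _ _)
  exact (a.val_iso _ _ (subMapOrIso hPQ hρ hP hQ hα hαP hαQ)).symm

lemma LeP.eq_or_numClasses_lt {E : Type} [Finite E] {ρ β α : Perm E} (hρ : EvenOrbits ρ)
    (hα : IsMatching α) (h : LeP ρ β α) :
    β = α ∨ numClasses (connRel ρ α) < numClasses (connRel ρ β) := by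
  induction h with
  | refl => exact Or.inl rfl
  | tail h1 h2 ih =>
    right
    have := ih (h2.isMatching hα)
    obtain ⟨x, y, rfl, h⟩ := h2
    have e1 := numClasses_sw_of_not hρ hα h
    rcases this with rfl | h'
    · omega
    · omega

/-- The cumulants are multiplicative over disjoint unions. -/
lemma Distribution.cum_onSub_or {p : ℕ} (hp : Even p) (hp2 : 2 ≤ p) (a : Distribution p Unit)
    {E : Type} [Fintype E] {ρ : Perm E} {P Q : E → Prop} (hPQ : ∀ x, P x → ¬ Q x)
    (hρ : ∀ e, Function.minimalPeriod ρ e = p)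
    (hP : ∀ x, P (ρ x) ↔ P x) (hQ : ∀ x, Q (ρ x) ↔ Q x) {α : Perm E} (hα : IsMatching α)
    (hαP : ∀ x, P (α x) ↔ P x) (hαQ : ∀ x, Q (α x) ↔ Q x) :
    onSub a.cumFun ρ (fun x => P x ∨ Q x) α = onSub a.cumFun ρ P α * onSub a.cumFun ρ Q α := by
  classical
  have hev := evenOrbits_of_period hp hp2 hρ
  induction hn : Nat.card E - numClasses (connRel ρ α) using Nat.strong_induction_on
    generalizing α with
  | _ n ih =>
    have hR : ∀ x, (P (ρ x) ∨ Q (ρ x)) ↔ (P x ∨ Q x) := fun x => or_congr (hP x) (hQ x)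
    have hαR : ∀ x, (P (α x) ∨ Q (α x)) ↔ (P x ∨ Q x) := fun x => or_congr (hαP x) (hαQ x)
    have h1 := a.val_onSub_or hPQ hρ hP hQ hα hαP hαQ
    rw [a.val_onSub hp hp2 hρ hP hα hαP, a.val_onSub hp hp2 hρ hQ hα hαQ,
      a.val_onSub (P := fun x => P x ∨ Q x) hp hp2 hρ hR hα hαR,
      Finset.sum_mul_sum, ← Finset.sum_product'] at h1
    -- Going down from α on P ∪ Q means going down independently on `P` and on `Q`; `glue` combines
    -- and separates the two parts.
    have h2 : ∑ x ∈ below ρ P α ×ˢ below ρ Q α, onSub a.cumFun ρ P x.1 * onSub a.cumFun ρ Q x.2 =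
        ∑ β ∈ below ρ (fun x => P x ∨ Q x) α, onSub a.cumFun ρ P β * onSub a.cumFun ρ Q β := by
      symm
      refine Finset.sum_bij' (fun β _ => (glue P β α, glue P α β))
        (fun x _ => glue P x.1 x.2) ?_ ?_ ?_ ?_ ?_
      · intro β hβ
        obtain ⟨hβ1, hβ2⟩ := mem_below.1 hβ
        have hβP := hβ1.preserves hev hα hP hαP
        have hβM := hβ1.isMatching hα
        have e : glue P α α = α := by
          ext x; rw [glue_apply hα hα hαP hαP]; simp
        rw [Finset.mem_product, mem_below, mem_below]
        refine ⟨⟨?_, fun x hx => glue_of_not hβM hα hβP hαP hx⟩, ?_, fun x hx => ?_⟩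
        · have := hβ1.glue_left hev hP hα hαP hα hαP
          rwa [e] at this
        · have := hβ1.glue_right hev hP hα hαP hα hαP
          rwa [e] at this
        · by_cases hx' : P x
          · exact glue_of_mem hα hβM hαP hβP hx'
          · exact (glue_of_not hα hβM hαP hβP hx').trans (hβ2 x (by tauto))
      · rintro ⟨β, γ⟩ h
        rw [Finset.mem_product, mem_below, mem_below] at h
        obtain ⟨⟨hβ1, hβ2⟩, hγ1, hγ2⟩ := h
        simp only at hβ1 hβ2 hγ1 hγ2 ⊢
        have hβP := hβ1.preserves hev hα hP hαP
        have hβM := hβ1.isMatching hα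
        have hγP := hγ1.preserves hev hα hP hαP
        have hγM := hγ1.isMatching hα
        have e : glue P α α = α := by
          ext x; rw [glue_apply hα hα hαP hαP]; simp
        refine mem_below.2 ⟨?_, fun x hx => ?_⟩
        · have h1 := hβ1.glue_left hev hP hα hαP hγM hγP
          have h2 := hγ1.glue_right hev hP hα hαP hα hαP
          rw [e] at h2
          exact h1.trans h2
        · push Not at hx
          exact (glue_of_not hβM hγM hβP hγP hx.1).trans (hγ2 x hx.2)
      · intro β hβ
        obtain ⟨hβ1, hβ2⟩ := mem_below.1 hβ
        have hβP := hβ1.preserves hev hα hP hαP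
        have hβM := hβ1.isMatching hα
        simp only
        ext x
        rw [glue_apply (isMatching_glue hβM hα hβP hαP) (isMatching_glue hα hβM hαP hβP)
          (glue_preserves hβM hα hβP hαP) (glue_preserves hα hβM hαP hβP)]
        split_ifs with hx
        · exact glue_of_mem hβM hα hβP hαP hx
        · exact glue_of_not hα hβM hαP hβP hx
      · rintro ⟨β, γ⟩ h
        rw [Finset.mem_product, mem_below, mem_below] at h
        obtain ⟨⟨hβ1, hβ2⟩, hγ1, hγ2⟩ := h
        simp only at hβ1 hβ2 hγ1 hγ2 ⊢
        have hβP := hβ1.preserves hev hα hP hαP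
        have hβM := hβ1.isMatching hα
        have hγP := hγ1.preserves hev hα hP hαP
        have hγM := hγ1.isMatching hα
        have hM := isMatching_glue hβM hγM hβP hγP
        have hG := glue_preserves hβM hγM hβP hγP
        refine Prod.ext ?_ ?_
        · ext x
          simp only
          rw [glue_apply hM hα hG hαP]
          split_ifs with hx
          · exact glue_of_mem hβM hγM hβP hγP hx
          · exact (hβ2 x hx).symm
        · ext x
          simp only
          rw [glue_apply hα hM hαP hG]
          split_ifs with hx
          · exact (hγ2 x (hPQ x hx)).symm
          · exact glue_of_not hβM hγM hβP hγP hx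
      · intro β hβ
        obtain ⟨hβ1, hβ2⟩ := mem_below.1 hβ
        have hβP := hβ1.preserves hev hα hP hαP
        have hβQ := hβ1.preserves hev hα hQ hαQ
        have hβM := hβ1.isMatching hα
        have hM1 := isMatching_glue hβM hα hβP hαP
        have hM2 := isMatching_glue hα hβM hαP hβP
        have hQ2 : ∀ x, Q x → glue P α β x = β x := fun x hx =>
          glue_of_not hα hβM hαP hβP (fun h => hPQ x h hx)
        have hQ3 : ∀ x, Q (glue P α β x) ↔ Q x := by
          intro x
          rw [glue_apply hα hβM hαP hβP]
          split_ifs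
          · exact hαQ x
          · exact hβQ x
        congr 1
        · exact onSub_congr _ hρ hP hβM hβP hM1 (glue_preserves hβM hα hβP hαP)
            (fun x hx => (glue_of_mem hβM hα hβP hαP hx).symm)
        · exact onSub_congr _ hρ hQ hβM hβQ hM2 hQ3 (fun x hx => (hQ2 x hx).symm)
    rw [h2] at h1
    have hmem : α ∈ below ρ (fun x => P x ∨ Q x) α :=
      mem_below.2 ⟨Relation.ReflTransGen.refl, fun _ _ => rfl⟩
    -- Both sides now run over the same matchings. Those strictly below α agree by induction, which
    -- leaves the terms at α.
    rw [← Finset.add_sum_erase _ _ hmem, ← Finset.add_sum_erase _ _ hmem] at h1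
    have h3 : ∑ β ∈ (below ρ (fun x => P x ∨ Q x) α).erase α,
        onSub a.cumFun ρ (fun x => P x ∨ Q x) β =
        ∑ β ∈ (below ρ (fun x => P x ∨ Q x) α).erase α,
        onSub a.cumFun ρ P β * onSub a.cumFun ρ Q β := by
      refine Finset.sum_congr rfl fun β hβ => ?_
      rw [Finset.mem_erase] at hβ
      have hβ1 := (mem_below.1 hβ.2).1
      have hlt := (hβ1.eq_or_numClasses_lt hev hα).resolve_left hβ.1
      have hle : numClasses (connRel ρ β) ≤ Nat.card E :=
        Nat.card_le_card_of_surjective _ Quotient.mk_surjective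
      exact ih _ (by omega) (hβ1.isMatching hα) (hβ1.preserves hev hα hP hαP)
        (hβ1.preserves hev hα hQ hαQ) rfl
    rw [h3] at h1
    exact add_right_cancel h1

/-! ### The standard model of half-edges -/

/-- The cyclic rotation of the half-edges around the vertices. -/
def shift (p : ℕ) (W : Type) : Perm (W × ZMod p) :=
  Equiv.prodCongr (Equiv.refl W) (Equiv.addRight 1)

/-- A reference matching which joins opposite half-edges of every vertex. -/
def opp (p : ℕ) (W : Type) : Perm (W × ZMod p) :=
  Equiv.prodCongr (Equiv.refl W) (Equiv.addRight ((p / 2 : ℕ) : ZMod p))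

lemma opp_fst {p : ℕ} {W : Type} (x : W × ZMod p) : (opp p W x).1 = x.1 := rfl

lemma shift_iterate {p : ℕ} {W : Type} (n : ℕ) (x : W × ZMod p) :
    (shift p W)^[n] x = (x.1, x.2 + n) := by
  induction n with
  | zero => simp
  | succ n ih =>
    rw [Function.iterate_succ_apply', ih]
    simp [shift, add_assoc]

lemma shift_period {p : ℕ} {W : Type} (x : W × ZMod p) :
    Function.minimalPeriod (shift p W) x = p := by
  apply Nat.dvd_antisymm
  · rw [← Function.isPeriodicPt_iff_minimalPeriod_dvd, Function.IsPeriodicPt, Function.IsFixedPt,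
      shift_iterate]
    simp
  · have h := Function.isPeriodicPt_minimalPeriod (shift p W) x
    rw [Function.IsPeriodicPt, Function.IsFixedPt, shift_iterate] at h
    have h2 := congrArg Prod.snd h
    simp only [add_eq_left] at h2
    exact (ZMod.natCast_eq_zero_iff _ _).1 h2

lemma isMatching_opp {p : ℕ} (hp : Even p) (hp2 : 2 ≤ p) (W : Type) : IsMatching (opp p W) := by
  obtain ⟨k, rfl⟩ := hp
  have hk : (k + k) / 2 = k := by omega
  constructor
  · rintro ⟨w, i⟩
    simp only [opp, hk, prodCongr_apply, Prod.map, refl_apply, coe_addRight, add_assoc]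
    have : ((k : ZMod (k + k)) + k) = 0 := by
      rw [← Nat.cast_add]; exact ZMod.natCast_self _
    rw [this, add_zero]
  · rintro ⟨w, i⟩ h
    have h2 := congrArg Prod.snd h
    simp only [opp, hk, prodCongr_apply, Prod.map, refl_apply, coe_addRight, add_eq_left] at h2
    rw [ZMod.natCast_eq_zero_iff] at h2
    have := Nat.le_of_dvd (by omega) h2
    omega

lemma rel_of_fst_eq {p : ℕ} [NeZero p] {W : Type} {r : Setoid (W × ZMod p)}
    (h : ∀ x, r x (shift p W x)) {x y : W × ZMod p} (hxy : x.1 = y.1) : r x y := by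
  have h1 : ∀ n : ℕ, r x ((shift p W)^[n] x) := by
    intro n
    induction n with
    | zero => exact r.refl x
    | succ n ih => rw [Function.iterate_succ_apply']; exact r.trans ih (h _)
  have h2 := h1 (y.2 - x.2).val
  rw [shift_iterate, ZMod.natCast_zmod_val, hxy, add_sub_cancel] at h2
  exact h2

lemma connRel_of_fst_eq {p : ℕ} [NeZero p] {W : Type} (α : Perm (W × ZMod p))
    {x y : W × ZMod p} (hxy : x.1 = y.1) : connRel (shift p W) α x y :=
  rel_of_fst_eq (connRel_left _ _) hxy

lemma evenOrbits_shift {p : ℕ} (hp : Even p) (hp2 : 2 ≤ p) (W : Type) :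
    EvenOrbits (shift p W) :=
  evenOrbits_of_period hp hp2 shift_period

/-- The half-edges at the vertices of `S`. -/
abbrev On {p : ℕ} {W : Type} (S : Finset W) : W × ZMod p → Prop := fun x => x.1 ∈ S

/-- The matchings that join half-edges of `S` in an arbitrary way, and are the reference matching
outside. -/
def IsPM {p : ℕ} {W : Type} (S : Finset W) (α : Perm (W × ZMod p)) : Prop :=
  IsMatching α ∧ ∀ x, x.1 ∉ S → α x = opp p W x

/-- All vertices of `S` are connected. -/
def ConnOn {p : ℕ} {W : Type} (S : Finset W) (α : Perm (W × ZMod p)) : Prop :=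
  ∀ x y, On S x → On S y → connRel (shift p W) α x y

lemma IsPM.mem_iff {p : ℕ} {W : Type} {S : Finset W} {α : Perm (W × ZMod p)} (h : IsPM S α)
    (x : W × ZMod p) : (α x).1 ∈ S ↔ x.1 ∈ S := by
  by_cases hx : x.1 ∈ S
  · simp only [hx, iff_true]
    by_contra hc
    have h1 := h.2 _ hc
    rw [h.1.1] at h1
    apply hc
    rw [← opp_fst, ← h1]
    exact hx
  · rw [h.2 x hx, opp_fst]

lemma IsPM.mem_iff_of_disjoint {p : ℕ} {W : Type} {S T : Finset W} {α : Perm (W × ZMod p)}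
    (h : IsPM S α) (hST : Disjoint S T) (x : W × ZMod p) : (α x).1 ∈ T ↔ x.1 ∈ T := by
  by_cases hx : x.1 ∈ S
  · exact ⟨fun h' => absurd h' (Finset.disjoint_left.1 hST ((h.mem_iff x).2 hx)),
      fun h' => absurd h' (Finset.disjoint_left.1 hST hx)⟩
  · rw [h.2 x hx, opp_fst]

/-- A reference edge stays within one vertex, and so does β there. If β changed it, `LeP.split`
would separate two half-edges of a single vertex. -/
lemma IsPM.of_le {p : ℕ} [NeZero p] (hp : Even p) (hp2 : 2 ≤ p) {W : Type} [Finite W]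
    {S : Finset W} {α β : Perm (W × ZMod p)} (hα : IsPM S α) (h : LeP (shift p W) β α) :
    IsPM S β := by
  have hev := evenOrbits_shift hp hp2 W
  refine ⟨h.isMatching hα.1, fun x hx => ?_⟩
  rw [← hα.2 x hx]
  by_contra hne
  have h1 := (h.split hev hα.1 (Ne.symm hne)).2
  apply h1
  apply connRel_of_fst_eq
  have h2 : Disjoint S {x.1} := by simpa using hx
  have h3 := hα.mem_iff_of_disjoint h2
  have h4 := h.preserves hev hα.1 (P := On {x.1}) (fun _ => Iff.rfl) h3 x
  have h5 := h3 x
  simp only [Finset.mem_singleton, iff_true] at h4 h5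
  rw [h4, h5]

lemma isPM_glue {p : ℕ} {W : Type} {R S : Finset W} {a b : Perm (W × ZMod p)} (ha : IsMatching a)
    (hb : IsMatching b) (haR : ∀ x, On R (a x) ↔ On R x) (hbR : ∀ x, On R (b x) ↔ On R x)
    (h1 : ∀ x, x.1 ∈ R → x.1 ∉ S → a x = opp p W x)
    (h2 : ∀ x, x.1 ∉ R → x.1 ∉ S → b x = opp p W x) : IsPM S (glue (On R) a b) := by
  refine ⟨isMatching_glue ha hb haR hbR, fun x hx => ?_⟩
  by_cases hxR : x.1 ∈ R
  · rw [glue_of_mem ha hb haR hbR hxR]; exact h1 x hxR hx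
  · rw [glue_of_not ha hb haR hbR hxR]; exact h2 x hxR hx

/-! ### Splitting off the part inserted at an edge -/

/-- Pairs of comparable matchings of `V ∪ U` such that the upper one is connected, the lower one
restricts to `δ` on `V`, and both agree on `V` away from the half-edges in `D`. -/
def InsertionPair {p : ℕ} {W : Type} [DecidableEq W] (V : Finset W) (δ : Perm (W × ZMod p))
    (D : Finset (W × ZMod p)) (U : Finset W)
    (q : Perm (W × ZMod p) × Perm (W × ZMod p)) : Prop :=
  IsPM (V ∪ U) q.1 ∧ ConnOn (V ∪ U) q.1 ∧ LeP (shift p W) q.2 q.1 ∧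
    (∀ x, x.1 ∈ V → q.2 x = δ x) ∧ ∀ x, x.1 ∈ V → q.1 x ≠ δ x → x ∈ D

/-- Pairs of comparable matchings of `S` such that the upper one is connected. -/
def ConnectedPair {p : ℕ} {W : Type} (S : Finset W)
    (q : Perm (W × ZMod p) × Perm (W × ZMod p)) : Prop :=
  IsPM S q.1 ∧ ConnOn S q.1 ∧ LeP (shift p W) q.2 q.1

open Classical in
/-- The vertices of `U` that are not connected to `x`. -/
def splitSet {p : ℕ} {W : Type} (U : Finset W) (α : Perm (W × ZMod p)) (x : W × ZMod p) :
    Finset W :=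
  U.filter fun w => ¬ connRel (shift p W) α x (w, 0)

lemma mem_splitSet {p : ℕ} [NeZero p] {W : Type} {U : Finset W} {α : Perm (W × ZMod p)}
    {x z : W × ZMod p} :
    z.1 ∈ splitSet U α x ↔ z.1 ∈ U ∧ ¬ connRel (shift p W) α x z := by
  classical
  rw [splitSet, Finset.mem_filter]
  refine and_congr_right fun _ => not_congr ?_
  have h : connRel (shift p W) α (z.1, 0) z := connRel_of_fst_eq α rfl
  exact ⟨fun h' => (connRel _ _).trans' h' h, fun h' => (connRel _ _).trans' h' ((connRel _ _).symm' h)⟩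

section Split

variable {p : ℕ} [NeZero p] {W : Type} [Fintype W] [DecidableEq W] {V U : Finset W}
  {δ : Perm (W × ZMod p)} {D : Finset (W × ZMod p)} {x : W × ZMod p}

/-- Closing the edge {x, δ x} of δ by a switch stays above β and cuts α into two components. One
contains all of `V`; the other is the piece that was attached through `α x`, with vertex set
`splitSet`. -/
lemma InsertionPair.split (hp : Even p) (hp2 : 2 ≤ p) (hδ : IsPM V δ) (hδc : ConnOn V δ)
    (hx : x.1 ∈ V)
    {α β : Perm (W × ZMod p)} (h : InsertionPair V δ D U (α, β)) (hne : α x ≠ δ x) :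
    LeP (shift p W) β (sw α (δ x) (α x)) ∧ IsPM (V ∪ U) (sw α (δ x) (α x)) ∧
    (∀ z, z.1 ∈ V → connRel (shift p W) (sw α (δ x) (α x)) x z) ∧
    (∀ z, On (splitSet U (sw α (δ x) (α x)) x) (sw α (δ x) (α x) z) ↔
      On (splitSet U (sw α (δ x) (α x)) x) z) ∧
    (α x).1 ∈ splitSet U (sw α (δ x) (α x)) x ∧
    (∀ z, z.1 ∈ splitSet U (sw α (δ x) (α x)) x →
      connRel (shift p W) (sw α (δ x) (α x)) (α x) z) := by
  have hev := evenOrbits_shift hp hp2 W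
  obtain ⟨h1, h2, h3, h4, h5⟩ := h
  simp only at h1 h2 h3 h4 h5
  have hβx : β x = δ x := h4 x hx
  obtain ⟨hs1, hs2⟩ := h3.split hev h1.1 (x := x) (by rw [hβx]; exact hne)
  rw [hβx] at hs1 hs2
  have hold := connRel_sw_of_not hev h1.1 hs2
  have hstep : StepBelow (shift p W) (sw α (δ x) (α x)) α := ⟨_, _, rfl, hs2⟩
  have hPM : IsPM (V ∪ U) (sw α (δ x) (α x)) :=
    h1.of_le hp hp2 (Relation.ReflTransGen.single hstep)
  have hβPM := hPM.of_le hp hp2 hs1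
  have hβV : ∀ z, On V (β z) ↔ On V z := by
    have aux : ∀ z, z.1 ∈ V → (β z).1 ∈ V := fun z hz => by
      rw [h4 z hz]; exact (hδ.mem_iff z).2 hz
    refine fun z => ⟨fun hz => ?_, aux z⟩
    have := aux _ hz
    rwa [hβPM.1.1] at this
  have hle := hs1.connRel_le hev hPM.1
  generalize hα' : sw α (δ x) (α x) = α' at *
  -- `V` cannot be torn apart: β lies below the switched matching and already connects `V` through
  -- δ.
  have hV : ∀ z, z.1 ∈ V → connRel (shift p W) α' x z := by
    intro z hz
    apply hle
    rw [connRel_congr (P := On V) (fun _ => Iff.rfl) hβV hδ.mem_iff h4 hx]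
    exact hδc x z hx hz
  have hxy : connRel (shift p W) α' x (δ x) := hV _ ((hδ.mem_iff x).2 hx)
  have hxh : ¬ connRel (shift p W) α' x (α x) := fun h =>
    hs2 ((connRel _ _).trans' ((connRel _ _).symm' hxy) h)
  have hdich : ∀ z, z.1 ∈ V ∪ U → connRel (shift p W) α' x z ∨ connRel (shift p W) α' (α x) z := by
    intro z hz
    have hc := h2 (δ x) z (Finset.mem_union_left _ ((hδ.mem_iff x).2 hx)) hz
    rw [hold] at hc
    exact (mergeRel_left hc).imp (fun h => (connRel _ _).trans' hxy h) id
  have hmem : ∀ z : W × ZMod p, z.1 ∈ splitSet U α' x ↔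
      z.1 ∈ V ∪ U ∧ ¬ connRel (shift p W) α' x z := by
    intro z
    rw [mem_splitSet, Finset.mem_union]
    constructor
    · exact fun h => ⟨Or.inr h.1, h.2⟩
    · rintro ⟨h | h, h'⟩
      · exact absurd (hV z h) h'
      · exact ⟨h, h'⟩
  refine ⟨hs1, hPM, hV, fun z => ?_, ?_, fun z hz => ?_⟩
  · change _ ∈ _ ↔ _ ∈ _
    rw [hmem, hmem, hPM.mem_iff]
    refine and_congr_right fun _ => not_congr ?_
    have := connRel_right (shift p W) α' z
    exact ⟨fun h => (connRel _ _).trans' h ((connRel _ _).symm' this),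
      fun h => (connRel _ _).trans' h this⟩
  · rw [hmem]
    exact ⟨(h1.mem_iff x).2 (Finset.mem_union_left _ hx), hxh⟩
  · rw [hmem] at hz
    exact (hdich z hz.1).resolve_left hz.2

end Split

/-! ### Detaching an inserted piece and putting it back -/

lemma sw_apply_partner {E : Type} {α : Perm E} {x y h : E} (hα : IsMatching α)
    (hx : α x = y) (hh : x ≠ h) : sw α y h x = h := by
  classical
  have : x ≠ y := fun e => hα.2 x (hx.trans e.symm)
  rw [sw_apply, swap_apply_of_ne_of_ne this hh, hx, swap_apply_left]

lemma opp_on {p : ℕ} {W : Type} (R : Finset W) (x : W × ZMod p) :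
    On R (opp p W x) ↔ On R x := Iff.rfl

section Split

variable {p : ℕ} [NeZero p] {W : Type} [Fintype W] [DecidableEq W] {V U : Finset W}
  {δ : Perm (W × ZMod p)} {D : Finset (W × ZMod p)} {x : W × ZMod p}

lemma InsertionPair.lower_mem_left {α β : Perm (W × ZMod p)} (hp : Even p) (hp2 : 2 ≤ p)
    (hδ : IsPM V δ) (h : InsertionPair V δ D U (α, β)) (z : W × ZMod p) :
    On V (β z) ↔ On V z := by
  obtain ⟨h1, -, h3, h4, -⟩ := h
  have hβ := h1.of_le hp hp2 h3
  have aux : ∀ z, z.1 ∈ V → (β z).1 ∈ V := fun z hz => by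
    rw [h4 z hz]; exact (hδ.mem_iff z).2 hz
  refine ⟨fun hz => ?_, aux z⟩
  have := aux _ hz
  rwa [hβ.1.1] at this

lemma InsertionPair.lower_mem_right {α β : Perm (W × ZMod p)} (hp : Even p) (hp2 : 2 ≤ p)
    (hVU : Disjoint V U) (hδ : IsPM V δ) (h : InsertionPair V δ D U (α, β)) (z : W × ZMod p) :
    On U (β z) ↔ On U z := by
  have h1 := h.lower_mem_left hp hp2 hδ z
  have h2 := (h.1.of_le hp hp2 h.2.2.1).mem_iff z
  simp only [Finset.mem_union] at h2
  have h3 := fun w (hw : w ∈ V) => Finset.disjoint_left.1 hVU hw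
  have h4 := h3 z.1
  have h5 := h3 (β z).1
  simp only [On] at h1 ⊢
  tauto

/-- After the switch the piece on `R` and the rest share no edge, so each can be completed by
reference edges. The edge {x, δ x} is now settled and leaves `D`. -/
lemma InsertionPair.forward (hp : Even p) (hp2 : 2 ≤ p) (hVU : Disjoint V U) (hδ : IsPM V δ)
    (hδc : ConnOn V δ) (hx : x.1 ∈ V) {α β α' : Perm (W × ZMod p)} {R : Finset W}
    (h : InsertionPair V δ D U (α, β)) (hne : α x ≠ δ x) (hα' : α' = sw α (δ x) (α x))
    (hR : R = splitSet U α' x) :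
    InsertionPair V δ ((D.erase x).erase (δ x)) (U \ R)
      (glue (On R) (opp p W) α', glue (On R) (opp p W) β) ∧
    ConnectedPair R (glue (On R) α' (opp p W), glue (On R) β (opp p W)) := by
  have hev := evenOrbits_shift hp hp2 W
  obtain ⟨hs1, hs2, hs3, hs4, hs5, hs6⟩ := h.split hp hp2 hδ hδc hx hne
  rw [← hα'] at hs1 hs2 hs3 hs4 hs5 hs6
  rw [← hR] at hs4 hs5 hs6
  have hRU : R ⊆ U := by
    classical
    rw [hR, splitSet]; exact Finset.filter_subset _ _
  have hVR : ∀ z : W × ZMod p, z.1 ∈ V → ¬ On R z := fun z hz hz' =>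
    Finset.disjoint_left.1 hVU hz (hRU hz')
  have hopp := isMatching_opp hp hp2 W
  have hβPM := hs2.of_le hp hp2 hs1
  have hβR := hs1.preserves hev hs2.1 (P := On R) (fun _ => Iff.rfl) hs4
  obtain ⟨h1, h2, h3, h4, h5⟩ := h
  simp only at h1 h2 h3 h4 h5
  have hα'x : α' x = δ x := by
    rw [hα', sw_comm]
    exact sw_apply_partner h1.1 rfl (fun e => hδ.1.2 x e.symm)
  have hδx : (δ x).1 ∈ V := (hδ.mem_iff x).2 hx
  have hα'y : α' (δ x) = x := by rw [← hα'x, hs2.1.1]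
  refine ⟨⟨?_, ?_, ?_, ?_, ?_⟩, ?_, ?_, ?_⟩
  · refine isPM_glue hopp hs2.1 (opp_on R) hs4 (fun _ _ _ => rfl) (fun z hz hz' => hs2.2 z ?_)
    simp only [Finset.mem_union, Finset.mem_sdiff] at hz' ⊢
    tauto
  · have key : ∀ z, On (V ∪ (U \ R)) z →
        connRel (shift p W) (glue (On R) (opp p W) α') x z := by
      intro z hz
      rw [← connRel_congr (α := α') (P := fun z => ¬ On R z) (fun _ => Iff.rfl)
        (fun z => not_congr (hs4 z))
        (fun z => not_congr (glue_preserves hopp hs2.1 (opp_on R) hs4 z))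
        (fun z hz => (glue_of_not hopp hs2.1 (opp_on R) hs4 hz).symm) (hVR x hx)]
      rcases Finset.mem_union.1 hz with hz | hz
      · exact hs3 z hz
      · rw [Finset.mem_sdiff, hR, mem_splitSet] at hz
        tauto
    exact fun z w hz hw => (connRel _ _).trans' ((connRel _ _).symm' (key z hz)) (key w hw)
  · exact hs1.glue_right hev (fun _ => Iff.rfl) hs2.1 hs4 hopp (opp_on R)
  · intro z hz
    exact (glue_of_not hopp hβPM.1 (opp_on R) hβR (hVR z hz)).trans (h4 z hz)
  · intro z hz hz'
    simp only at hz'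
    rw [glue_of_not hopp hs2.1 (opp_on R) hs4 (hVR z hz)] at hz'
    have hzx : z ≠ x := fun e => hz' (by rw [e, hα'x])
    have hzy : z ≠ δ x := fun e => hz' (by rw [e, hα'y, hδ.1.1])
    refine Finset.mem_erase.2 ⟨hzy, Finset.mem_erase.2 ⟨hzx, h5 z hz ?_⟩⟩
    have hα'h : α' (α x) = α (δ x) := by
      rw [hα']
      refine sw_apply_right h1.1 (fun e => hδ.1.2 x ?_)
      exact (α.injective e)
    have : α' z = α z := by
      rw [hα']
      refine sw_apply_of_ne h1.1 hzy ?_ ?_ ?_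
      · rintro rfl; exact hVR _ hz hs5
      · rw [← hα'h]
        rintro rfl; exact hVR _ hz ((hs4 _).2 hs5)
      · rw [h1.1.1]; exact hzx
    rwa [← this]
  · exact isPM_glue hs2.1 hopp hs4 (opp_on R) (fun _ hz hz' => absurd hz hz') (fun _ _ _ => rfl)
  · have key : ∀ z, On R z → connRel (shift p W) (glue (On R) α' (opp p W)) (α x) z := by
      intro z hz
      rw [← connRel_congr (α := α') (P := On R) (fun _ => Iff.rfl) hs4
        (glue_preserves hs2.1 hopp hs4 (opp_on R))
        (fun z hz => (glue_of_mem hs2.1 hopp hs4 (opp_on R) hz).symm) hs5]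
      exact hs6 z hz
    exact fun z w hz hw => (connRel _ _).trans' ((connRel _ _).symm' (key z hz)) (key w hw)
  · exact hs1.glue_left hev (fun _ => Iff.rfl) hs2.1 hs4 hopp (opp_on R)

/-- The inverse of `InsertionPair.forward`. Besides the two pairs only the half-edge `h` of the
piece that was joined to `x` is needed: switching `δ x` with `h` is its own inverse and reopens the
edge. -/
lemma InsertionPair.backward (hp : Even p) (hp2 : 2 ≤ p) (hVU : Disjoint V U) (hδ : IsPM V δ)
    (hx : x.1 ∈ V) (hxD : x ∈ D) (hyD : δ x ∈ D) {R : Finset W} (hRU : R ⊆ U)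
    {h : W × ZMod p} (hh : h.1 ∈ R) {α₁ β₁ α₂ β₂ : Perm (W × ZMod p)}
    (h1 : InsertionPair V δ ((D.erase x).erase (δ x)) (U \ R) (α₁, β₁))
    (h2 : ConnectedPair R (α₂, β₂)) {α' : Perm (W × ZMod p)} (hα' : α' = glue (On R) α₂ α₁) :
    InsertionPair V δ D U (sw α' (δ x) h, glue (On R) β₂ β₁) ∧ sw α' (δ x) h x = h ∧
    IsMatching α' ∧ α' x = δ x ∧ splitSet U α' x = R := by
  have hev := evenOrbits_shift hp hp2 W
  obtain ⟨h1a, h1b, h1c, h1d, h1e⟩ := h1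
  obtain ⟨h2a, h2b, h2c⟩ := h2
  simp only at h1a h1b h1c h1d h1e h2a h2b h2c
  have hdis : Disjoint (V ∪ (U \ R)) R := by
    rw [Finset.disjoint_union_left]
    exact ⟨hVU.mono_right hRU, Finset.sdiff_disjoint⟩
  have hVR : ∀ z : W × ZMod p, z.1 ∈ V → ¬ On R z := fun z hz hz' =>
    Finset.disjoint_left.1 hVU hz (hRU hz')
  have hα₁R : ∀ z, On R (α₁ z) ↔ On R z := h1a.mem_iff_of_disjoint hdis
  have hα₂R : ∀ z, On R (α₂ z) ↔ On R z := h2a.mem_iff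
  have hβ₁ := h1a.of_le hp hp2 h1c
  have hβ₂ := h2a.of_le hp hp2 h2c
  have hβ₁R : ∀ z, On R (β₁ z) ↔ On R z := hβ₁.mem_iff_of_disjoint hdis
  have hβ₂R : ∀ z, On R (β₂ z) ↔ On R z := hβ₂.mem_iff
  have hPM : IsPM (V ∪ U) α' := by
    rw [hα']
    refine isPM_glue h2a.1 h1a.1 hα₂R hα₁R (fun z hz hz' => ?_) (fun z hz hz' => h1a.2 z ?_)
    · exact absurd (Finset.mem_union_right _ (hRU hz)) hz'
    · simp only [Finset.mem_union, Finset.mem_sdiff] at hz' ⊢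
      tauto
  have hα'R : ∀ z, On R (α' z) ↔ On R z := by
    rw [hα']; exact glue_preserves h2a.1 h1a.1 hα₂R hα₁R
  have hin : ∀ z, On R z → α' z = α₂ z := fun z hz => by
    rw [hα']; exact glue_of_mem h2a.1 h1a.1 hα₂R hα₁R hz
  have hout : ∀ z, ¬ On R z → α' z = α₁ z := fun z hz => by
    rw [hα']; exact glue_of_not h2a.1 h1a.1 hα₂R hα₁R hz
  have hle : LeP (shift p W) (glue (On R) β₂ β₁) α' := by
    rw [hα']
    exact (h2c.glue_left hev (fun _ => Iff.rfl) h2a.1 hα₂R hβ₁.1 hβ₁R).trans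
      (h1c.glue_right hev (fun _ => Iff.rfl) h1a.1 hα₁R h2a.1 hα₂R)
  clear hα'
  have hδx : (δ x).1 ∈ V := (hδ.mem_iff x).2 hx
  -- Because `x` was erased from `D`, the upper matching has to agree with δ at `x`.
  have hα'x : α' x = δ x := by
    rw [hout x (hVR x hx)]
    by_contra hc
    have := h1e x hx hc
    simp at this
  have hα'y : α' (δ x) = x := by rw [← hα'x, hPM.1.1]
  have hnc : ¬ connRel (shift p W) α' (δ x) h := fun hc =>
    hVR _ hδx ((connRel_prop (On R) (fun _ => Iff.rfl) hα'R hc).2 hh)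
  have hM := hPM.1.sw (δ x) h
  have hnc' : ¬ connRel (shift p W) (sw (sw α' (δ x) h) (δ x) h) (δ x) h := by rwa [sw_sw]
  have hstep : StepBelow (shift p W) α' (sw α' (δ x) h) :=
    ⟨δ x, h, (sw_sw _ _ _).symm, hnc⟩
  have hcle := hstep.connRel_le hev hM
  have hxh : x ≠ h := fun e => hVR x hx (e ▸ hh)
  have hmem : ∀ z : W × ZMod p, z.1 ∈ V → z.1 ∈ V ∪ U := fun z => Finset.mem_union_left _
  have hhU : h.1 ∈ V ∪ U := Finset.mem_union_right _ (hRU hh)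
  have hconn1 : ∀ z, z.1 ∈ V ∪ U → ¬ On R z → connRel (shift p W) α' x z := by
    intro z hz hzR
    rw [connRel_congr (P := fun z => ¬ On R z) (fun _ => Iff.rfl) (fun z => not_congr (hα'R z))
      (fun z => not_congr (hα₁R z)) hout (hVR x hx)]
    refine h1b x z (Finset.mem_union_left _ hx) ?_
    simp only [On, Finset.mem_union, Finset.mem_sdiff] at hz hzR ⊢
    tauto
  refine ⟨⟨⟨hM, fun z hz => ?_⟩, ?_, hle.tail hstep, fun z hz => ?_, fun z hz hz' => ?_⟩,
    sw_apply_partner hPM.1 hα'x hxh, hPM.1, hα'x, ?_⟩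
  · simp only at hz ⊢
    rw [sw_apply_of_ne hPM.1]
    · exact hPM.2 z hz
    · rintro rfl; exact hz (hmem _ hδx)
    · rintro rfl; exact hz hhU
    · rw [hα'y]; rintro rfl; exact hz (hmem _ hx)
    · rintro rfl; exact hz ((hPM.mem_iff _).2 hhU)
  -- The reopening switch joins the component of `x`, through `δ x`, to that of `h`, which is all of
  -- `R`.
  · have hxy := hcle (connRel_right (shift p W) α' x)
    rw [hα'x] at hxy
    have hyh := StepBelow.conn hev hM hnc'
    have key : ∀ z, On (V ∪ U) z → connRel (shift p W) (sw α' (δ x) h) x z := by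
      intro z hz
      by_cases hzR : On R z
      · refine (connRel _ _).trans' ((connRel _ _).trans' hxy hyh) (hcle ?_)
        rw [connRel_congr (P := On R) (fun _ => Iff.rfl) hα'R hα₂R hin hh]
        exact h2b h z hh hzR
      · exact hcle (hconn1 z hz hzR)
    exact fun z w hz hw => (connRel _ _).trans' ((connRel _ _).symm' (key z hz)) (key w hw)
  · exact (glue_of_not hβ₂.1 hβ₁.1 hβ₂R hβ₁R (hVR z hz)).trans (h1d z hz)
  · by_cases hzx : z = x
    · exact hzx ▸ hxD
    by_cases hzy : z = δ x
    · exact hzy ▸ hyD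
    simp only at hz'
    rw [sw_apply_of_ne hPM.1 hzy, hout z (hVR z hz)] at hz'
    · exact Finset.mem_of_mem_erase (Finset.mem_of_mem_erase (h1e z hz hz'))
    · rintro rfl; exact hVR _ hz hh
    · rwa [hα'y]
    · rintro rfl; exact hVR _ hz ((hα'R _).2 hh)
  · ext w
    have hw := mem_splitSet (U := U) (α := α') (x := x) (z := (w, (0 : ZMod p)))
    simp only at hw
    rw [hw]
    constructor
    · rintro ⟨hwU, hwc⟩
      by_contra hwR
      exact hwc (hconn1 (w, 0) (Finset.mem_union_right _ hwU) hwR)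
    · intro hwR
      refine ⟨hRU hwR, fun hc => hVR x hx ?_⟩
      exact (connRel_prop (On R) (fun _ => Iff.rfl) hα'R hc).2 hwR

end Split

lemma sum_below_eq {p : ℕ} [NeZero p] {W : Type} [Fintype W] {a : Distribution p Unit} (hp : Even p) (hp2 : 2 ≤ p) {R : Finset W}
    {α : Perm (W × ZMod p)} (hα : IsPM R α) :
    onSub a.valFun (shift p W) (On R) α =
      ∑ β ∈ below (shift p W) (On R) α, onSub a.cumFun (shift p W) (On R) β :=
  a.val_onSub hp hp2 shift_period (fun _ => Iff.rfl) hα.1 hα.mem_iff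

lemma cum_onSub_empty {p : ℕ} [NeZero p] {W : Type} [Fintype W] (hp : Even p) (hp2 : 2 ≤ p) (a : Distribution p Unit)
    {α : Perm (W × ZMod p)} (hα : IsMatching α) :
    onSub a.cumFun (shift p W) (On (∅ : Finset W)) α = 1 := by
  have hαP : ∀ z, On (∅ : Finset W) (α z) ↔ On ∅ z := by simp
  have hb : below (shift p W) (On (∅ : Finset W)) α = {α} := by
    ext β
    rw [mem_below, Finset.mem_singleton]
    constructor
    · exact fun h => Equiv.ext fun z => h.2 z (by simp)
    · rintro rfl; exact ⟨Relation.ReflTransGen.refl, fun _ _ => rfl⟩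
  have h := a.val_onSub hp hp2 shift_period (fun _ => Iff.rfl) hα hαP
  rw [hb, Finset.sum_singleton] at h
  rw [← h, onSub_eq _ shift_period (fun _ => Iff.rfl) hα hαP]
  have : IsEmpty {z : W × ZMod p // On (∅ : Finset W) z} := ⟨fun z => by simpa using z.2⟩
  exact a.val_empty _

/-! ### Sums over comparable pairs and their recursion -/

section Sums

variable {p : ℕ} [NeZero p] {W : Type} [Fintype W] [DecidableEq W]

open Classical in
/-- The sum of the cumulants over the insertion pairs. -/
def insSum (a : Distribution p Unit) (V : Finset W)
    (δ : Perm (W × ZMod p)) (D : Finset (W × ZMod p)) (U : Finset W) : ℝ :=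
  ∑ q : Perm (W × ZMod p) × Perm (W × ZMod p) with InsertionPair V δ D U q,
    onSub a.cumFun (shift p W) (On U) q.2

open Classical in
/-- The sum of the cumulants over the connected pairs. -/
def connSum (a : Distribution p Unit) (R : Finset W) :
    ℝ :=
  ∑ q : Perm (W × ZMod p) × Perm (W × ZMod p) with ConnectedPair R q,
    onSub a.cumFun (shift p W) (On R) q.2

open Classical in
/-- The sum of a function of trace maps over the connected matchings of `R`. -/
def matchSum (w : MapFun p) (R : Finset W) : ℝ :=
  ∑ α : Perm (W × ZMod p) with IsPM R α ∧ ConnOn R α, onSub w (shift p W) (On R) α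

variable {V U : Finset W} {δ : Perm (W × ZMod p)} {D : Finset (W × ZMod p)} {x : W × ZMod p}

/-- For fixed α the cumulants below it sum to its value. -/
lemma connSum_eq (hp : Even p) (hp2 : 2 ≤ p) (a : Distribution p Unit) (R : Finset W) :
    connSum a R = matchSum a.valFun R := by
  classical
  rw [connSum, matchSum]
  have h1 : ∑ α : Perm (W × ZMod p) with IsPM R α ∧ ConnOn R α,
        onSub a.valFun (shift p W) (On R) α =
      ∑ α : Perm (W × ZMod p) with IsPM R α ∧ ConnOn R α,
        ∑ β ∈ below (shift p W) (On R) α, onSub a.cumFun (shift p W) (On R) β := by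
    refine Finset.sum_congr rfl fun α hα => sum_below_eq hp hp2 (Finset.mem_filter.1 hα).2.1
  rw [h1, Finset.sum_sigma']
  refine Finset.sum_bij' (fun q _ => ⟨q.1, q.2⟩) (fun q _ => (q.1, q.2)) ?_ ?_ ?_ ?_ ?_
  · rintro ⟨α, β⟩ h
    obtain ⟨h1, h2, h3⟩ := (Finset.mem_filter.1 h).2
    simp only at h1 h2 h3
    refine Finset.mem_sigma.2 ⟨Finset.mem_filter.2 ⟨Finset.mem_univ _, h1, h2⟩,
      mem_below.2 ⟨h3, fun z hz => ?_⟩⟩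
    rw [h1.2 z hz, (h1.of_le hp hp2 h3).2 z hz]
  · rintro ⟨α, β⟩ h
    obtain ⟨h1, h2⟩ := Finset.mem_sigma.1 h
    obtain ⟨-, h1, h3⟩ := Finset.mem_filter.1 h1
    exact Finset.mem_filter.2 ⟨Finset.mem_univ _, h1, h3, (mem_below.1 h2).1⟩
  · rintro ⟨α, β⟩ _; rfl
  · rintro ⟨α, β⟩ _; rfl
  · rintro ⟨α, β⟩ _; rfl

/-- With `D` empty α equals δ on `V`, so `V` is closed off; connectedness leaves no room for
vertices in `U`. -/
lemma insSum_empty (hp : Even p) (hp2 : 2 ≤ p) (a : Distribution p Unit) (hVU : Disjoint V U)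
    (hδ : IsPM V δ) (hδc : ConnOn V δ) (hV : V.Nonempty) :
    insSum a V δ ∅ U = if U = ∅ then 1 else 0 := by
  classical
  rw [insSum]
  split_ifs with hU
  · subst hU
    have : (Finset.univ.filter fun q : Perm (W × ZMod p) × Perm (W × ZMod p) =>
        InsertionPair V δ ∅ ∅ q) = {(δ, δ)} := by
      ext ⟨α, β⟩
      simp only [Finset.mem_filter, Finset.mem_univ, true_and, Finset.mem_singleton, Prod.mk.injEq]
      constructor
      · rintro ⟨h1, h2, h3, h4, h5⟩
        have hβ := h1.of_le hp hp2 h3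
        simp only [Finset.union_empty] at h1 h2 h3 h4 h5 hβ
        constructor
        · ext z : 1
          by_cases hz : z.1 ∈ V
          · by_contra hc; simpa using h5 z hz hc
          · rw [h1.2 z hz, hδ.2 z hz]
        · ext z : 1
          by_cases hz : z.1 ∈ V
          · exact h4 z hz
          · rw [hβ.2 z hz, hδ.2 z hz]
      · rintro ⟨rfl, rfl⟩
        refine ⟨?_, ?_, Relation.ReflTransGen.refl, fun _ _ => rfl, fun z _ h => absurd rfl h⟩
        · simpa using hδ
        · simpa using hδc
    rw [this, Finset.sum_singleton, cum_onSub_empty hp hp2 a hδ.1]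
  · refine Finset.sum_eq_zero fun q hq => ?_
    exfalso
    obtain ⟨h1, h2, h3, h4, h5⟩ := (Finset.mem_filter.1 hq).2
    obtain ⟨v, hv⟩ := hV
    obtain ⟨u, hu⟩ := Finset.nonempty_iff_ne_empty.2 hU
    have h6 : ∀ z, On V (q.1 z) ↔ On V z := by
      have e : ∀ z, On V z → q.1 z = δ z := fun z hz => by
        by_contra hc; simpa using h5 z hz hc
      have aux : ∀ z, On V z → On V (q.1 z) := fun z hz => by
        rw [e z hz]; exact (hδ.mem_iff z).2 hz
      refine fun z => ⟨fun hz => ?_, aux z⟩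
      have := aux _ hz
      rwa [h1.1.1] at this
    have h7 := h2 (v, 0) (u, 0) (Finset.mem_union_left _ hv) (Finset.mem_union_right _ hu)
    have h8 := (connRel_prop (On V) (fun _ => Iff.rfl) h6 h7).1 hv
    exact Finset.disjoint_left.1 hVU h8 hu

/-- One edge of δ is treated: either α keeps it, or a nonempty connected piece on `R` is attached at
it. The factor |R|p counts the half-edge of the piece that is joined to `x`. -/
lemma insSum_step (hp : Even p) (hp2 : 2 ≤ p) (a : Distribution p Unit) (hVU : Disjoint V U)
    (hδ : IsPM V δ) (hδc : ConnOn V δ) (hx : x.1 ∈ V) (hxD : x ∈ D) (hyD : δ x ∈ D) :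
    insSum a V δ D U = insSum a V δ ((D.erase x).erase (δ x)) U +
      ∑ R ∈ U.powerset with R.Nonempty,
        (R.card * p : ℝ) * connSum a R * insSum a V δ ((D.erase x).erase (δ x)) (U \ R) := by
  classical
  set D' := (D.erase x).erase (δ x) with hD'
  rw [insSum, ← Finset.sum_filter_add_sum_filter_not _ (fun q => q.1 x = δ x),
    Finset.filter_filter, Finset.filter_filter]
  congr 1
  · rw [insSum]
    refine Finset.sum_congr ?_ fun _ _ => rfl
    ext ⟨α, β⟩
    simp only [Finset.mem_filter, Finset.mem_univ, true_and]
    constructor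
    · rintro ⟨⟨h1, h2, h3, h4, h5⟩, h6⟩
      refine ⟨h1, h2, h3, h4, fun z hz hz' => ?_⟩
      rw [hD', Finset.mem_erase, Finset.mem_erase]
      refine ⟨?_, ?_, h5 z hz hz'⟩
      · rintro rfl
        apply hz'
        simp only at h6 ⊢
        rw [hδ.1.1, ← h6, h1.1.1]
      · rintro rfl; exact hz' h6
    · rintro ⟨h1, h2, h3, h4, h5⟩
      refine ⟨⟨h1, h2, h3, h4, fun z hz hz' =>
        Finset.mem_of_mem_erase (Finset.mem_of_mem_erase (h5 z hz hz'))⟩, ?_⟩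
      by_contra hc
      have := h5 x hx hc
      rw [hD'] at this
      simp at this
  · have hprod : ∀ R ∈ U.powerset.filter Finset.Nonempty,
        (R.card * p : ℝ) * connSum a R * insSum a V δ D' (U \ R) =
        ∑ y ∈ (Finset.univ.filter fun h : W × ZMod p => h.1 ∈ R) ×ˢ
          (Finset.univ.filter fun q : Perm (W × ZMod p) × Perm (W × ZMod p) =>
            InsertionPair V δ D' (U \ R) q) ×ˢ
          (Finset.univ.filter fun q : Perm (W × ZMod p) × Perm (W × ZMod p) =>
            ConnectedPair R q),
          onSub a.cumFun (shift p W) (On (U \ R)) y.2.1.2 *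
            onSub a.cumFun (shift p W) (On R) y.2.2.2 := by
      intro R _
      rw [Finset.sum_product]
      simp only
      rw [Finset.sum_const, Finset.sum_product]
      simp only
      rw [← Finset.sum_mul_sum]
      have hc : (Finset.univ.filter fun h : W × ZMod p => h.1 ∈ R).card = R.card * p := by
        have : (Finset.univ.filter fun h : W × ZMod p => h.1 ∈ R) = R ×ˢ Finset.univ := by
          ext z; simp
        rw [this, Finset.card_product, Finset.card_univ, ZMod.card]
      rw [hc, nsmul_eq_mul, insSum, connSum]
      push_cast
      ring
    rw [Finset.sum_congr rfl hprod, Finset.sum_sigma']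
    -- A pair (α, β) corresponds to the set R, the half-edge `α x`, the pair outside R and the pair
    -- on R.
    refine Finset.sum_bij'
      (fun q _ => ⟨splitSet U (sw q.1 (δ x) (q.1 x)) x, q.1 x,
        (glue (On (splitSet U (sw q.1 (δ x) (q.1 x)) x)) (opp p W) (sw q.1 (δ x) (q.1 x)),
         glue (On (splitSet U (sw q.1 (δ x) (q.1 x)) x)) (opp p W) q.2),
        (glue (On (splitSet U (sw q.1 (δ x) (q.1 x)) x)) (sw q.1 (δ x) (q.1 x)) (opp p W),
         glue (On (splitSet U (sw q.1 (δ x) (q.1 x)) x)) q.2 (opp p W))⟩)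
      (fun y _ => (sw (glue (On y.1) y.2.2.2.1 y.2.2.1.1) (δ x) y.2.1,
        glue (On y.1) y.2.2.2.2 y.2.2.1.2)) ?_ ?_ ?_ ?_ ?_
    · rintro ⟨α, β⟩ hq
      obtain ⟨-, hq, hne⟩ := Finset.mem_filter.1 hq
      have hf := hq.forward hp hp2 hVU hδ hδc hx hne rfl rfl
      have hs := (hq.split hp hp2 hδ hδc hx hne).2.2.2.2.1
      refine Finset.mem_sigma.2 ⟨Finset.mem_filter.2 ⟨Finset.mem_powerset.2 ?_, ⟨_, hs⟩⟩, ?_⟩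
      · rw [splitSet]; exact Finset.filter_subset _ _
      · refine Finset.mem_product.2 ⟨Finset.mem_filter.2 ⟨Finset.mem_univ _, hs⟩,
          Finset.mem_product.2 ⟨Finset.mem_filter.2 ⟨Finset.mem_univ _, hf.1⟩,
          Finset.mem_filter.2 ⟨Finset.mem_univ _, hf.2⟩⟩⟩
    · rintro ⟨R, h, ⟨α₁, β₁⟩, ⟨α₂, β₂⟩⟩ hy
      simp only [Finset.mem_sigma, Finset.mem_filter, Finset.mem_product, Finset.mem_univ,
        true_and, Finset.mem_powerset] at hy
      obtain ⟨⟨hRU, -⟩, hh, h1, h2⟩ := hy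
      have hb := InsertionPair.backward hp hp2 hVU hδ hx hxD hyD hRU hh h1 h2 rfl
      refine Finset.mem_filter.2 ⟨Finset.mem_univ _, hb.1, ?_⟩
      simp only
      rw [hb.2.1]
      rintro rfl
      exact Finset.disjoint_left.1 hVU ((hδ.mem_iff x).2 hx) (hRU hh)
    · rintro ⟨α, β⟩ hq
      obtain ⟨-, hq, hne⟩ := Finset.mem_filter.1 hq
      obtain ⟨hs1, hs2, hs3, hs4, hs5, hs6⟩ := hq.split hp hp2 hδ hδc hx hne
      have hopp := isMatching_opp hp hp2 W
      have hβM := hs1.isMatching hs2.1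
      simp only at hne ⊢
      generalize hα' : sw α (δ x) (α x) = α' at *
      generalize splitSet U α' x = R at *
      have hβR := hs1.preserves (evenOrbits_shift hp hp2 W) hs2.1 (P := On R)
        (fun _ => Iff.rfl) hs4
      have key : ∀ γ, IsMatching γ → (∀ z, On R (γ z) ↔ On R z) →
          glue (On R) (glue (On R) γ (opp p W)) (glue (On R) (opp p W) γ) = γ := by
        intro γ hγ hγR
        ext z : 1
        rw [glue_apply (isMatching_glue hγ hopp hγR (opp_on R))
          (isMatching_glue hopp hγ (opp_on R) hγR) (glue_preserves hγ hopp hγR (opp_on R))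
          (glue_preserves hopp hγ (opp_on R) hγR)]
        split_ifs with hz
        · exact glue_of_mem hγ hopp hγR (opp_on R) hz
        · exact glue_of_not hopp hγ (opp_on R) hγR hz
      rw [key _ hs2.1 hs4, key _ hβM hβR, ← hα', sw_sw]
    · rintro ⟨R, h, ⟨α₁, β₁⟩, ⟨α₂, β₂⟩⟩ hy
      simp only [Finset.mem_sigma, Finset.mem_filter, Finset.mem_product, Finset.mem_univ,
        true_and, Finset.mem_powerset] at hy
      obtain ⟨⟨hRU, -⟩, hh, h1, h2⟩ := hy
      obtain ⟨hb1, hb2, hb3, hb4, hb5⟩ :=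
        InsertionPair.backward hp hp2 hVU hδ hx hxD hyD hRU hh h1 h2 rfl
      have hopp := isMatching_opp hp hp2 W
      have hdis : Disjoint (V ∪ (U \ R)) R := by
        rw [Finset.disjoint_union_left]
        exact ⟨hVU.mono_right hRU, Finset.sdiff_disjoint⟩
      have key : ∀ a b : Perm (W × ZMod p), IsPM (V ∪ (U \ R)) a → IsPM R b →
          glue (On R) (opp p W) (glue (On R) b a) = a ∧
          glue (On R) (glue (On R) b a) (opp p W) = b := by
        intro a b ha hb
        have haR : ∀ z, On R (a z) ↔ On R z := ha.mem_iff_of_disjoint hdis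
        have hbR : ∀ z, On R (b z) ↔ On R z := hb.mem_iff
        have hM := isMatching_glue hb.1 ha.1 hbR haR
        have hG := glue_preserves hb.1 ha.1 hbR haR
        constructor
        · ext z : 1
          rw [glue_apply hopp hM (opp_on R) hG]
          split_ifs with hz
          · exact (ha.2 z (Finset.disjoint_right.1 hdis hz)).symm
          · exact glue_of_not hb.1 ha.1 hbR haR hz
        · ext z : 1
          rw [glue_apply hM hopp hG (opp_on R)]
          split_ifs with hz
          · exact glue_of_mem hb.1 ha.1 hbR haR hz
          · exact (hb.2 z hz).symm
      have k1 := key α₁ α₂ h1.1 h2.1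
      have k2 := key β₁ β₂ (h1.1.of_le hp hp2 h1.2.2.1) (h2.1.of_le hp hp2 h2.2.2)
      simp only [hb2, sw_sw, hb5, k1.1, k1.2, k2.1, k2.2]
    · rintro ⟨α, β⟩ hq
      obtain ⟨-, hq, hne⟩ := Finset.mem_filter.1 hq
      obtain ⟨hs1, hs2, hs3, hs4, hs5, hs6⟩ := hq.split hp hp2 hδ hδc hx hne
      have hopp := isMatching_opp hp hp2 W
      have hβM := hs1.isMatching hs2.1
      have hRU : splitSet U (sw α (δ x) (α x)) x ⊆ U := by
        rw [splitSet]; exact Finset.filter_subset _ _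
      have hβU := hq.lower_mem_right hp hp2 hVU hδ
      simp only at hne ⊢
      generalize hα' : sw α (δ x) (α x) = α' at *
      generalize splitSet U α' x = R at *
      have hβR := hs1.preserves (evenOrbits_shift hp hp2 W) hs2.1 (P := On R)
        (fun _ => Iff.rfl) hs4
      have hβUR : ∀ z, On (U \ R) (β z) ↔ On (U \ R) z := by
        intro z
        have h1 := hβU z
        have h2 := hβR z
        simp only [On, Finset.mem_sdiff] at h1 h2 ⊢
        tauto
      have hOn : (On U : W × ZMod p → Prop) = fun z => On (U \ R) z ∨ On R z := by
        funext z
        simp only [On, Finset.mem_sdiff, eq_iff_iff]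
        have := @hRU z.1
        tauto
      -- β preserves `R` and its complement in `U`, so its cumulant on `U` is the product of the
      -- cumulants of the two lower matchings.
      rw [hOn, a.cum_onSub_or hp hp2 (fun z h => by
        simp only [On, Finset.mem_sdiff] at h ⊢; exact h.2) shift_period (fun _ => Iff.rfl)
        (fun _ => Iff.rfl) hβM hβUR hβR]
      have hg1 := glue_preserves hopp hβM (opp_on R) hβR
      congr 1
      · refine onSub_congr _ shift_period (fun _ => Iff.rfl) hβM hβUR
          (isMatching_glue hopp hβM (opp_on R) hβR) (fun z => ?_) (fun z hz => ?_)
        · rw [glue_apply hopp hβM (opp_on R) hβR]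
          split_ifs
          · exact Iff.rfl
          · exact hβUR z
        · refine (glue_of_not hopp hβM (opp_on R) hβR ?_).symm
          simp only [On, Finset.mem_sdiff] at hz ⊢; exact hz.2
      · exact onSub_congr _ shift_period (fun _ => Iff.rfl) hβM hβR
          (isMatching_glue hβM hopp hβR (opp_on R)) (glue_preserves hβM hopp hβR (opp_on R))
          (fun z hz => (glue_of_mem hβM hopp hβR (opp_on R) hz).symm)

open Classical in
/-- Decomposition of the connected matchings according to the component of a root in the lower
map. -/
lemma matchSum_univ (hp : Even p) (hp2 : 2 ≤ p) (a : Distribution p Unit) (x : W × ZMod p) :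
    matchSum a.valFun (Finset.univ : Finset W) =
      ∑ V : Finset W with x.1 ∈ V, ∑ δ : Perm (W × ZMod p) with IsPM V δ ∧ ConnOn V δ,
        onSub a.cumFun (shift p W) (On V) δ *
          insSum a V δ (V ×ˢ Finset.univ) Vᶜ := by
  classical
  have hev := evenOrbits_shift hp hp2 W
  have hopp := isMatching_opp hp hp2 W
  rw [← connSum_eq hp hp2, connSum, Finset.sum_sigma']
  -- The vertex set of the component of `x` in β. The pairs are then sorted by this set and by the
  -- restriction of β to it; each fiber is a set of insertion pairs with every half-edge of `V`
  -- allowed in `D`.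
  let C : Perm (W × ZMod p) → Finset W := fun β => (splitSet Finset.univ β x)ᶜ
  have hC : ∀ β (z : W × ZMod p), z.1 ∈ C β ↔ connRel (shift p W) β x z := by
    intro β z
    rw [Finset.mem_compl, mem_splitSet]
    simp
  have hCβ : ∀ β z, On (C β) (β z) ↔ On (C β) z := by
    intro β z
    simp only [On, hC]
    have := connRel_right (shift p W) β z
    exact ⟨fun h => (connRel _ _).trans' h ((connRel _ _).symm' this),
      fun h => (connRel _ _).trans' h this⟩
  have hmap : ∀ q ∈ (Finset.univ.filter fun q : Perm (W × ZMod p) × Perm (W × ZMod p) =>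
      ConnectedPair Finset.univ q),
      (⟨C q.2, glue (On (C q.2)) q.2 (opp p W)⟩ : Σ _ : Finset W, Perm (W × ZMod p)) ∈
      (Finset.univ.filter fun V : Finset W => x.1 ∈ V).sigma fun V =>
        Finset.univ.filter fun δ : Perm (W × ZMod p) => IsPM V δ ∧ ConnOn V δ := by
    rintro ⟨α, β⟩ hq
    obtain ⟨-, h1, h2, h3⟩ := Finset.mem_filter.1 hq
    simp only at h1 h2 h3
    have hβ := h1.of_le hp hp2 h3
    have hxC : x.1 ∈ C β := (hC β x).2 ((connRel _ _).refl' x)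
    simp only [Finset.mem_sigma, Finset.mem_filter, Finset.mem_univ, true_and]
    refine ⟨hxC, isPM_glue hβ.1 hopp (hCβ β) (opp_on _) (fun _ h h' => absurd h h')
      (fun _ _ _ => rfl), fun z w hz hw => ?_⟩
    rw [← connRel_congr (α := β) (P := On (C β)) (fun _ => Iff.rfl) (hCβ β)
        (glue_preserves hβ.1 hopp (hCβ β) (opp_on _))
        (fun z hz => (glue_of_mem hβ.1 hopp (hCβ β) (opp_on _) hz).symm) hz]
    exact (connRel _ _).trans' ((connRel _ _).symm' ((hC β z).1 hz)) ((hC β w).1 hw)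
  rw [← Finset.sum_fiberwise_of_maps_to hmap]
  refine Finset.sum_congr rfl fun y hy => ?_
  obtain ⟨V, δ⟩ := y
  simp only [Finset.mem_sigma, Finset.mem_filter, Finset.mem_univ, true_and] at hy
  obtain ⟨hxV, hδ, hδc⟩ := hy
  simp only
  rw [insSum, Finset.mul_sum, Finset.filter_filter]
  refine Finset.sum_congr ?_ ?_
  · ext ⟨α, β⟩
    simp only [Finset.mem_filter, Finset.mem_univ, true_and, Sigma.mk.injEq, heq_eq_eq]
    constructor
    · rintro ⟨⟨h1, h2, h3⟩, h4, h5⟩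
      have hβ := h1.of_le hp hp2 h3
      refine ⟨by simpa using h1, by simpa using h2, h3, fun z hz => ?_, fun z hz _ => by simpa⟩
      rw [← h5]
      rw [← h4] at hz
      exact (glue_of_mem hβ.1 hopp (hCβ β) (opp_on _) hz).symm
    · rintro hq
      have hβV := hq.lower_mem_left hp hp2 hδ
      obtain ⟨h1, h2, h3, h4, h5⟩ := hq
      have hβ := h1.of_le hp hp2 h3
      simp only [Finset.union_compl] at h1 h2 h3 h4
      have e : C β = V := by
        ext w
        have hw := hC β (w, 0)
        simp only at hw
        rw [hw]
        constructor
        · intro h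
          exact (connRel_prop (On V) (fun _ => Iff.rfl) hβV h).1 hxV
        · intro h
          rw [connRel_congr (P := On V) (fun _ => Iff.rfl) hβV hδ.mem_iff h4 hxV]
          exact hδc _ _ hxV h
      refine ⟨⟨h1, h2, h3⟩, e, ?_⟩
      rw [e]
      ext z : 1
      rw [glue_apply hβ.1 hopp hβV (opp_on _)]
      split_ifs with hz
      · exact h4 z hz
      · exact (hδ.2 z hz).symm
  · rintro ⟨α, β⟩ hq
    replace hq := (Finset.mem_filter.1 hq).2
    have hβV := hq.lower_mem_left hp hp2 hδ
    have hβ := hq.1.of_le hp hp2 hq.2.2.1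
    have hβV' : ∀ z, On Vᶜ (β z) ↔ On Vᶜ z := fun z => by
      simp only [On, Finset.mem_compl]
      exact not_congr (hβV z)
    have hOn : (On Finset.univ : W × ZMod p → Prop) = fun z => On V z ∨ On Vᶜ z := by
      funext z
      simp [On, Classical.em]
    simp only
    rw [hOn, a.cum_onSub_or hp hp2 (fun z h => by simpa [On] using h) shift_period
      (fun _ => Iff.rfl) (fun _ => Iff.rfl) hβ.1 hβV hβV']
    congr 1
    exact onSub_congr _ shift_period (fun _ => Iff.rfl) hβ.1 hβV hδ.1 hδ.mem_iff
      (fun z hz => hq.2.2.2.1 z hz)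

end Sums

/-! ### Counting rooted maps through labeled matchings -/

lemma cycleType_of_period {E : Type} [Fintype E] [DecidableEq E] {ρ : Perm E} {p n : ℕ}
    (hp2 : 2 ≤ p) (hρ : ∀ e, Function.minimalPeriod ρ e = p) (hn : Fintype.card E = n * p) :
    ρ.cycleType = Multiset.replicate n p := by
  have hall : ∀ m ∈ ρ.cycleType, m = p := by
    intro m hm
    rw [Perm.cycleType_def, Multiset.mem_map] at hm
    obtain ⟨c, hc, rfl⟩ := hm
    have hcyc := (Perm.mem_cycleFactorsFinset_iff.1 hc).1
    obtain ⟨x, hx, -⟩ := id hcyc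
    have hceq : c = ρ.cycleOf x :=
      Perm.cycle_is_cycleOf (Perm.mem_support.2 hx) hc
    rw [Function.comp_apply, ← hcyc.orderOf]
    have key : ∀ k : ℕ, c ^ k = 1 ↔ p ∣ k := by
      intro k
      rw [hcyc.pow_eq_one_iff' hx, hceq, Perm.cycleOf_pow_apply_self, ← Perm.iterate_eq_pow,
        ← hρ x]
      exact Function.isPeriodicPt_iff_minimalPeriod_dvd
    exact Nat.dvd_antisymm (orderOf_dvd_of_pow_eq_one ((key p).2 dvd_rfl))
      ((key _).1 (pow_orderOf_eq_one c))
  have h1 := Multiset.eq_replicate_card.2 hall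
  have h2 := ρ.sum_cycleType
  have h3 : ρ.support = Finset.univ := by
    ext x
    simp only [Perm.mem_support, Finset.mem_univ, iff_true]
    intro h
    have := (Function.minimalPeriod_eq_one_iff_isFixedPt (f := ρ) (x := x)).2 h
    rw [hρ] at this
    omega
  rw [h1, h3, Finset.card_univ, hn, Multiset.sum_replicate, smul_eq_mul] at h2
  rw [h1, Nat.eq_of_mul_eq_mul_right (by omega) h2]

/-- Equal cycle types make ρ and σ conjugate, so the intertwiners correspond bijectively to the
centralizer of σ, whose order is known from the cycle type. -/
lemma card_intertwiners {E F : Type} [Fintype E] [Fintype F] {ρ : Perm E} {σ : Perm F} {p n : ℕ}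
    (hp2 : 2 ≤ p) (hn0 : n ≠ 0) (hρ : ∀ e, Function.minimalPeriod ρ e = p)
    (hσ : ∀ e, Function.minimalPeriod σ e = p)
    (hE : Fintype.card E = n * p) (hF : Fintype.card F = n * p) :
    Nat.card {τ : E ≃ F // ∀ x, τ (ρ x) = σ (τ x)} = n.factorial * p ^ n := by
  classical
  let e : E ≃ F := Fintype.equivOfCardEq (hE.trans hF.symm)
  have hρ' : ∀ x, Function.minimalPeriod (e.permCongr ρ) x = p := by
    intro x
    rw [← hρ (e.symm x), Function.minimalPeriod_eq_minimalPeriod_iff]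
    intro n
    have h : ∀ n : ℕ, (e.permCongr ρ)^[n] x = e (ρ^[n] (e.symm x)) := by
      intro n
      induction n with
      | zero => simp
      | succ k ih =>
        rw [Function.iterate_succ_apply', ih, Function.iterate_succ_apply', permCongr_apply,
          symm_apply_apply]
    rw [Function.IsPeriodicPt, Function.IsFixedPt, h, Function.IsPeriodicPt, Function.IsFixedPt,
      ← Equiv.eq_symm_apply]
  have hc : IsConj (e.permCongr ρ) σ := by
    rw [Perm.isConj_iff_cycleType_eq, cycleType_of_period hp2 hρ' hF,
      cycleType_of_period hp2 hσ hF]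
  obtain ⟨g, hg⟩ := isConj_iff.1 hc
  have hg' : ∀ z, g (e (ρ (e.symm z))) = σ (g z) := by
    intro z
    rw [← hg]
    simp [Perm.mul_apply, permCongr_apply]
  let f : {τ : E ≃ F // ∀ x, τ (ρ x) = σ (τ x)} ≃ Subgroup.centralizer {σ} :=
    { toFun := fun τ => ⟨((e.trans g).symm.trans τ.1 : Perm F), by
        rw [Subgroup.mem_centralizer_singleton_iff]
        ext z
        simp only [Perm.mul_apply, Equiv.trans_apply, symm_trans_apply]
        rw [← τ.2]
        congr 1
        rw [Equiv.symm_apply_eq, Equiv.symm_apply_eq]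
        have := hg' (g.symm z)
        rw [Equiv.apply_symm_apply] at this
        exact this.symm⟩
      invFun := fun c => ⟨(e.trans g).trans c.1, fun x => by
        have h1 := Subgroup.mem_centralizer_singleton_iff.1 c.2
        have h2 := Equiv.congr_fun h1 (g (e x))
        simp only [Perm.mul_apply] at h2
        have h3 := hg' (e x)
        rw [symm_apply_apply] at h3
        simp only [Equiv.trans_apply]
        rw [h3, h2]⟩
      left_inv := fun τ => by ext x; simp
      right_inv := fun c => by ext x; simp }
  rw [Nat.card_congr f, Perm.nat_card_centralizer, cycleType_of_period hp2 hσ hF, hF,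
    Multiset.sum_replicate, smul_eq_mul, Nat.sub_self, Nat.factorial_zero, one_mul,
    Multiset.prod_replicate, Multiset.toFinset_replicate, if_neg hn0, Finset.prod_singleton,
    Multiset.count_replicate_self, mul_comm]

/-- Rigidity of rooted connected maps: the set where two isomorphisms agree is invariant under both
permutations. -/
lemma TraceMap.Iso.eq_of_root {p : ℕ} {ι E E' : Type} [Finite E] {b : TraceMap p ι E}
    {b' : TraceMap p ι E'} (hb : b.Connected) (f g : b.Iso b') {x : E}
    (h : f.toEquiv x = g.toEquiv x) : f.toEquiv = g.toEquiv := by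
  ext y
  refine (connRel_prop (fun y => f.toEquiv y = g.toEquiv y) (fun z => ?_) (fun z => ?_)
    (hb.connRel x y)).1 h
  · rw [f.map_rot, g.map_rot, b'.rot.injective.eq_iff]
  · rw [f.map_edge, g.map_edge, b'.edge.injective.eq_iff]

/-- Invariance under isomorphism. -/
def MapFun.Invariant {p : ℕ} (w : MapFun p) : Prop :=
  ∀ (E E' : Type) [Finite E] [Finite E'] (b : TraceMap p Unit E) (b' : TraceMap p Unit E'),
    b.Iso b' → w E b = w E' b'

lemma Distribution.valFun_invariant {p : ℕ} (a : Distribution p Unit) : a.valFun.Invariant :=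
  fun _ _ _ _ b b' f => a.val_iso b b' f

lemma Distribution.cumFun_invariant {p : ℕ} (a : Distribution p Unit) : a.cumFun.Invariant :=
  fun _ _ _ _ b b' f => a.cumulant_iso b b' f

/-- The composition of isomorphisms. -/
def TraceMap.Iso.trans {p : ℕ} {ι E E' E'' : Type} {b : TraceMap p ι E}
    {b' : TraceMap p ι E'} {b'' : TraceMap p ι E''} (f : b.Iso b') (g : b'.Iso b'') :
    b.Iso b'' where
  toEquiv := f.toEquiv.trans g.toEquiv
  map_rot e := by simp [f.map_rot, g.map_rot]
  map_edge e := by simp [f.map_edge, g.map_edge]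
  map_label e := by simp [f.map_label, g.map_label]

/-- The inverse of an isomorphism. -/
def TraceMap.Iso.symm {p : ℕ} {ι E E' : Type} {b : TraceMap p ι E}
    {b' : TraceMap p ι E'} (f : b.Iso b') : b'.Iso b where
  toEquiv := f.toEquiv.symm
  map_rot e := by rw [Equiv.symm_apply_eq, f.map_rot, apply_symm_apply]
  map_edge e := by rw [Equiv.symm_apply_eq, f.map_edge, apply_symm_apply]
  map_label e := by rw [← f.map_label, apply_symm_apply]

lemma TraceMap.Iso.connected {p : ℕ} {ι E E' : Type} {b : TraceMap p ι E}
    {b' : TraceMap p ι E'} (f : b.Iso b') (h : b.Connected) : b'.Connected := by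
  rw [TraceMap.Connected, ← f.components_eq]
  exact h

/-- Double counting: a connected map on `E` with rotation ρ and a chosen root is the same as a class
in B_n together with an intertwiner from `E` to its representative. The left factor counts roots,
the right one intertwiners. -/
lemma sum_connected_eq {p n : ℕ} (hp2 : 2 ≤ p) (hn0 : n ≠ 0) (w : MapFun p) (hw : w.Invariant)
    {E : Type} [Fintype E] {ρ : Perm E} (hρ : ∀ e, Function.minimalPeriod ρ e = p)
    (hE : Fintype.card E = n * p) [Fintype {b : TraceMap p Unit E // b.rot = ρ ∧ b.Connected}] :
    (n * p : ℝ) * ∑ b : {b : TraceMap p Unit E // b.rot = ρ ∧ b.Connected}, w E b.1 =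
      (n.factorial * p ^ n : ℝ) * ∑ᶠ c : RootedMap p n, w _ c.toTraceMap := by
  classical
  have := Fintype.ofFinite (RootedMap p n)
  let I : RootedMap p n → Type := fun c =>
    {τ : E ≃ Fin (n * p) // ∀ x, τ (ρ x) = c.toTraceMap.rot (τ x)}
  have hI : ∀ c, Fintype (I c) := fun c => Fintype.ofFinite _
  have hIc : ∀ c, Fintype.card (I c) = n.factorial * p ^ n := fun c => by
    rw [← Nat.card_eq_fintype_card]
    exact card_intertwiners hp2 hn0 hρ c.toTraceMap.rot_period hE (Fintype.card_fin _)
  have hLHS : (n * p : ℝ) * ∑ b : {b : TraceMap p Unit E // b.rot = ρ ∧ b.Connected}, w E b.1 =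
      ∑ y : {b : TraceMap p Unit E // b.rot = ρ ∧ b.Connected} × E, w E y.1.1 := by
    rw [Fintype.sum_prod_type, Finset.mul_sum]
    refine Finset.sum_congr rfl fun b _ => ?_
    simp only
    rw [Finset.sum_const, Finset.card_univ, hE, nsmul_eq_mul]
    push_cast
    ring
  have hRHS : (n.factorial * p ^ n : ℝ) * ∑ᶠ c : RootedMap p n, w _ c.toTraceMap =
      ∑ y : (Σ c : RootedMap p n, I c), w _ y.1.toTraceMap := by
    rw [finsum_eq_sum_of_fintype, Fintype.sum_sigma, Finset.mul_sum]
    refine Finset.sum_congr rfl fun c _ => ?_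
    simp only
    rw [Finset.sum_const, Finset.card_univ, hIc, nsmul_eq_mul]
    push_cast
    ring
  rw [hLHS, hRHS]
  symm
  have hroot : ∀ (c : RootedMap p n) (τ : I c),
      (TraceMap.transport τ.1.symm c.toTraceMap).rot = ρ := by
    intro c τ
    ext x
    change τ.1.symm (c.toTraceMap.rot (τ.1.symm.symm x)) = ρ x
    rw [Equiv.symm_apply_eq, τ.2]
    rfl
  refine Fintype.sum_bijective (fun y : (Σ c : RootedMap p n, I c) =>
    (⟨⟨TraceMap.transport y.2.1.symm y.1.toTraceMap, hroot y.1 y.2,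
      (TraceMap.transportIso _ _).connected (Quotient.out y.1).connected⟩,
      y.2.1.symm (Quotient.out y.1).root⟩ :
      {b : TraceMap p Unit E // b.rot = ρ ∧ b.Connected} × E)) ⟨?_, ?_⟩ _ _ ?_
  -- Equal images give a root-preserving isomorphism of the representatives, hence the same class;
  -- rigidity then identifies the intertwiners.
  · rintro ⟨c, τ⟩ ⟨c', τ'⟩ h
    simp only [Prod.mk.injEq, Subtype.mk.injEq] at h
    obtain ⟨h1, h2⟩ := h
    let f := TraceMap.transportIso τ.1.symm c.toTraceMap
    have hcc : c = c' := by
      refine Quotient.out_equiv_out.1 ?_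
      refine ⟨f.trans ⟨τ'.1, fun e => ?_, fun e => ?_, fun e => rfl⟩, ?_⟩
      · rw [h1]
        exact (TraceMap.transportIso τ'.1.symm c'.toTraceMap).symm.map_rot e
      · rw [h1]
        exact (TraceMap.transportIso τ'.1.symm c'.toTraceMap).symm.map_edge e
      · change τ'.1 (τ.1.symm (Quotient.out c).root) = _
        rw [h2, apply_symm_apply]
    subst hcc
    congr 1
    apply Subtype.ext
    have key := TraceMap.Iso.eq_of_root (x := (Quotient.out c).root) (Quotient.out c).connected f
      { toEquiv := τ'.1.symm
        map_rot := by rw [h1]; exact (TraceMap.transportIso τ'.1.symm c.toTraceMap).map_rot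
        map_edge := by rw [h1]; exact (TraceMap.transportIso τ'.1.symm c.toTraceMap).map_edge
        map_label := fun _ => rfl } h2
    have key' : τ.1.symm = τ'.1.symm := key
    rw [← Equiv.symm_symm τ.1, key', Equiv.symm_symm]
  · rintro ⟨⟨b, hb, hbc⟩, x⟩
    let e : E ≃ Fin (n * p) := Fintype.equivFinOfCardEq hE
    let q : PreRootedMap p n := ⟨b.transport e, (b.transportIso e).connected hbc, e x⟩
    obtain ⟨f, hf⟩ : (⟦q⟧ : RootedMap p n).out ≈ q := Quotient.mk_out q
    let g : b.Iso (⟦q⟧ : RootedMap p n).out.map := (b.transportIso e).trans f.symm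
    refine ⟨⟨⟦q⟧, g.toEquiv, fun z => ?_⟩, ?_⟩
    · rw [← hb, g.map_rot]; rfl
    · refine Prod.ext (Subtype.ext ?_) ?_
      · exact g.symm.transport_eq
      · change g.toEquiv.symm (⟦q⟧ : RootedMap p n).out.root = x
        rw [Equiv.symm_apply_eq]
        change _ = f.toEquiv.symm (e x)
        rw [Equiv.eq_symm_apply]
        exact hf
  · rintro ⟨c, τ⟩
    exact hw _ _ _ _ (TraceMap.transportIso _ _)

lemma mul_matchSum {p : ℕ} [NeZero p] (hp : Even p) (hp2 : 2 ≤ p) (w : MapFun p)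
    (hw : w.Invariant) {W : Type} [Fintype W] [DecidableEq W] {R : Finset W} (hR : R.Nonempty) :
    (R.card * p : ℝ) * matchSum w R =
      (R.card.factorial * p ^ R.card : ℝ) * ∑ᶠ c : RootedMap p R.card, w _ c.toTraceMap := by
  classical
  have hcard : Fintype.card {x : W × ZMod p // On R x} = R.card * p := by
    rw [Fintype.card_subtype]
    have : (Finset.univ.filter fun h : W × ZMod p => On R h) = R ×ˢ Finset.univ := by
      ext z; simp
    rw [this, Finset.card_product, Finset.card_univ, ZMod.card]
  have hsP : ∀ x : W × ZMod p, On R (shift p W x) ↔ On R x := fun _ => Iff.rfl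
  have hper : ∀ x, Function.minimalPeriod ((shift p W).subtypePerm hsP) x = p := fun x => by
    rw [minimalPeriod_subtypePerm, shift_period]
  have hopp := isMatching_opp hp hp2 W
  obtain ⟨v, hv⟩ := hR
  have hne : Nonempty {x : W × ZMod p // On R x} := ⟨⟨(v, 0), hv⟩⟩
  have := Fintype.ofFinite {b : TraceMap p Unit {x : W × ZMod p // On R x} //
    b.rot = (shift p W).subtypePerm hsP ∧ b.Connected}
  rw [← sum_connected_eq hp2 (Finset.card_ne_zero_of_mem hv) w hw hper hcard, matchSum]
  congr 1
  have hM : ∀ α ∈ Finset.univ.filter fun α : Perm (W × ZMod p) => IsPM R α ∧ ConnOn R α,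
      IsPM R α ∧ ConnOn R α := fun α hα => (Finset.mem_filter.1 hα).2
  refine Finset.sum_bij (fun α hα =>
    ⟨subMap shift_period hsP (hM α hα).1.1 (hM α hα).1.mem_iff, rfl,
      TraceMap.connected_of_connRel fun x y => ?_⟩) (fun _ _ => Finset.mem_univ _) ?_ ?_ ?_
  · exact (connRel_subtypePerm hsP (hM α hα).1.mem_iff x y).2 ((hM α hα).2 x y x.2 y.2)
  · intro α hα β hβ h
    have h1 := congrArg (fun b => TraceMap.edge b.1) h
    ext z : 1
    by_cases hz : On R z
    · exact congrArg Subtype.val (Equiv.congr_fun h1 ⟨z, hz⟩)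
    · rw [(hM α hα).1.2 z hz, (hM β hβ).1.2 z hz]
  · rintro ⟨b, hb, hbc⟩ -
    have hbM := b.isMatching
    have hE := extend_subtypePerm hbM hopp (opp_on R) (extend_preserves hbM hopp (opp_on R))
    refine ⟨extend (On R) b.edge (opp p W), Finset.mem_filter.2 ⟨Finset.mem_univ _,
      ⟨isMatching_extend hbM hopp (opp_on R), fun z hz => extend_of_not hbM hopp (opp_on R) hz⟩,
      fun z u hz hu => ?_⟩, ?_⟩
    · have h1 := hbc.connRel ⟨z, hz⟩ ⟨u, hu⟩
      rw [hb, ← hE, connRel_subtypePerm] at h1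
      exact h1
    · exact Subtype.ext (TraceMap.ext_perm hb.symm hE rfl)
  · intro α hα
    exact onSub_eq w shift_period hsP (hM α hα).1.1 (hM α hα).1.mem_iff

lemma Distribution.mul_matchSum_val {p : ℕ} [NeZero p] (hp : Even p) (hp2 : 2 ≤ p)
    (a : Distribution p Unit) {W : Type} [Fintype W] [DecidableEq W] {R : Finset W}
    (hR : R.Nonempty) :
    (R.card * p : ℝ) * matchSum a.valFun R =
      (R.card.factorial * p ^ R.card : ℝ) * a.moment R.card := by
  rw [mul_matchSum hp hp2 _ a.valFun_invariant hR, Distribution.moment,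
    if_neg hR.card_ne_zero]

lemma Distribution.mul_matchSum_cum {p : ℕ} [NeZero p] (hp : Even p) (hp2 : 2 ≤ p)
    (a : Distribution p Unit) {W : Type} [Fintype W] [DecidableEq W] {R : Finset W}
    (hR : R.Nonempty) :
    (R.card * p : ℝ) * matchSum a.cumFun R =
      (R.card.factorial * p ^ R.card : ℝ) * a.freeCumulant R.card := by
  rw [mul_matchSum hp hp2 _ a.cumFun_invariant hR, Distribution.freeCumulant,
    if_neg hR.card_ne_zero]

/-! ### The moment-cumulant relation -/

/-- The moment series of a distribution. -/
def Distribution.momentSeries {p : ℕ} (a : Distribution p Unit) : PowerSeries ℝ :=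
  PowerSeries.mk a.moment

lemma Distribution.moment_zero {p : ℕ} (a : Distribution p Unit) : a.moment 0 = 1 := by
  simp [Distribution.moment]

lemma choose_mul_factorials {u j : ℕ} (hj : j ≤ u) :
    (u.choose j : ℝ) * j.factorial * (u - j).factorial = u.factorial := by
  exact_mod_cast Nat.choose_mul_factorial_mul_factorial hj

/-- `D` is a union of `d` edges of δ, and each contributes one factor M. After division by |U|!
p^|U| the recursion of `insSum_step` becomes the Cauchy product M · M^d, with the choice of `R`
absorbed by a binomial coefficient. -/
lemma insSum_eq {p : ℕ} [NeZero p] {W : Type} [Fintype W] [DecidableEq W] (hp : Even p)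
    (hp2 : 2 ≤ p) (a : Distribution p Unit) {V : Finset W} {δ : Perm (W × ZMod p)}
    (hδ : IsPM V δ) (hδc : ConnOn V δ) (hV : V.Nonempty) (d : ℕ) :
    ∀ (D : Finset (W × ZMod p)), D.card = 2 * d → (∀ x ∈ D, x.1 ∈ V) → (∀ x ∈ D, δ x ∈ D) →
    ∀ U : Finset W, Disjoint V U → insSum a V δ D U =
      U.card.factorial * p ^ U.card * PowerSeries.coeff U.card (a.momentSeries ^ d) := by
  classical
  induction d with
  | zero =>
    intro D hD _ _ U hVU
    rw [mul_zero, Finset.card_eq_zero] at hD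
    rw [hD, insSum_empty hp hp2 a hVU hδ hδc hV, pow_zero, PowerSeries.coeff_one]
    by_cases hU : U = ∅
    · simp [hU]
    · simp [hU]
  | succ d ih =>
    intro D hD hDV hDδ U hVU
    obtain ⟨x, hx⟩ : D.Nonempty := by
      rw [← Finset.card_pos, hD]; omega
    have hyx : δ x ≠ x := hδ.1.2 x
    have hy := hDδ x hx
    have hD' : ((D.erase x).erase (δ x)).card = 2 * d := by
      rw [Finset.card_erase_of_mem (Finset.mem_erase.2 ⟨hyx, hy⟩), Finset.card_erase_of_mem hx, hD]
      omega
    have hDV' : ∀ z ∈ (D.erase x).erase (δ x), z.1 ∈ V := fun z hz =>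
      hDV z (Finset.mem_of_mem_erase (Finset.mem_of_mem_erase hz))
    have hDδ' : ∀ z ∈ (D.erase x).erase (δ x), δ z ∈ (D.erase x).erase (δ x) := by
      intro z hz
      simp only [Finset.mem_erase] at hz ⊢
      refine ⟨fun h => hz.2.1 (δ.injective h), fun h => hz.1 ?_, hDδ z hz.2.2⟩
      rw [← h, hδ.1.1]
    have hI := ih _ hD' hDV' hDδ'
    rw [insSum_step hp hp2 a hVU hδ hδc (hDV x hx) hx hy]
    let g : ℕ → ℝ := fun j => (j.factorial * p ^ j * a.moment j) *
      ((U.card - j).factorial * p ^ (U.card - j) *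
        PowerSeries.coeff (U.card - j) (a.momentSeries ^ d))
    have h1 : ∑ R ∈ U.powerset with R.Nonempty, (R.card * p : ℝ) * connSum a R *
        insSum a V δ ((D.erase x).erase (δ x)) (U \ R) =
        ∑ R ∈ U.powerset with R.Nonempty, g R.card := by
      refine Finset.sum_congr rfl fun R hR => ?_
      obtain ⟨hRU, hR⟩ := Finset.mem_filter.1 hR
      rw [Finset.mem_powerset] at hRU
      rw [connSum_eq hp hp2, a.mul_matchSum_val hp hp2 hR, hI _ (hVU.mono_right
        Finset.sdiff_subset), Finset.card_sdiff_of_subset hRU]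
    -- The edge kept by α is the term of the empty piece, because m_0 = 1. Adding it completes the
    -- sum to all subsets of `U`.
    have h2 : insSum a V δ ((D.erase x).erase (δ x)) U =
        ∑ R ∈ U.powerset with ¬ R.Nonempty, g R.card := by
      have : (U.powerset.filter fun R => ¬ R.Nonempty) = {∅} := by
        ext R
        simp only [Finset.mem_filter, Finset.mem_powerset, Finset.not_nonempty_iff_eq_empty,
          Finset.mem_singleton]
        exact ⟨fun h => h.2, fun h => ⟨h ▸ Finset.empty_subset _, h⟩⟩
      rw [this, Finset.sum_singleton, hI U hVU]
      simp [g, a.moment_zero]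
    rw [h1, h2, add_comm, Finset.sum_filter_add_sum_filter_not,
      Finset.sum_powerset_apply_card g, pow_succ', PowerSeries.coeff_mul,
      Finset.Nat.sum_antidiagonal_eq_sum_range_succ (fun i j =>
        PowerSeries.coeff i a.momentSeries * PowerSeries.coeff j (a.momentSeries ^ d)),
      Finset.mul_sum]
    refine Finset.sum_congr rfl fun j hj => ?_
    have hj' : j ≤ U.card := Nat.lt_succ_iff.1 (Finset.mem_range.1 hj)
    have hpow : (p : ℝ) ^ U.card = p ^ j * p ^ (U.card - j) := by
      rw [← pow_add, Nat.add_sub_cancel' hj']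
    rw [nsmul_eq_mul, Distribution.momentSeries, PowerSeries.coeff_mk,
      ← choose_mul_factorials hj', hpow]
    simp only [g, Distribution.momentSeries]
    ring

lemma sum_filter_mem_zero (n : ℕ) (F : ℕ → ℝ) :
    ∑ V : Finset (Fin (n + 1)) with (0 : Fin (n + 1)) ∈ V, F V.card =
      ∑ j ∈ Finset.range (n + 1), (n.choose j : ℝ) * F (j + 1) := by
  have hc : (Finset.univ.erase (0 : Fin (n + 1))).card = n := by simp
  have h := Finset.sum_powerset_apply_card (fun j => F (j + 1))
    (x := Finset.univ.erase (0 : Fin (n + 1)))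
  rw [hc] at h
  simp only [nsmul_eq_mul] at h
  rw [← h]
  refine Finset.sum_bij' (fun V _ => V.erase 0) (fun T _ => insert 0 T) ?_ ?_ ?_ ?_ ?_
  · intro V _
    exact Finset.mem_powerset.2 (Finset.erase_subset_erase _ (Finset.subset_univ V))
  · intro T _; simp
  · intro V hV
    exact Finset.insert_erase (Finset.mem_filter.1 hV).2
  · intro T hT
    refine Finset.erase_insert fun h => ?_
    have := Finset.mem_powerset.1 hT h
    simp at this
  · intro V hV
    have h0 := (Finset.mem_filter.1 hV).2
    rw [Finset.card_erase_add_one h0]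

/-- The moments in terms of the free cumulants. -/
lemma Distribution.moment_succ {p : ℕ} (hp : Even p) (hp2 : 2 ≤ p) (a : Distribution p Unit)
    (n : ℕ) : a.moment (n + 1) = ∑ j ∈ Finset.range (n + 1), a.freeCumulant (j + 1) *
      PowerSeries.coeff (n - j) (a.momentSeries ^ ((j + 1) * (p / 2))) := by
  classical
  have : NeZero p := ⟨by omega⟩
  have hp0 : (p : ℝ) ≠ 0 := by exact_mod_cast this.out
  obtain ⟨q, hq⟩ := hp.exists_two_nsmul
  rw [smul_eq_mul] at hq
  have hq2 : p / 2 = q := by omega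
  have h1 := a.mul_matchSum_val hp hp2 (Finset.univ_nonempty (α := Fin (n + 1)))
  rw [matchSum_univ hp hp2 a ((0 : Fin (n + 1)), 0)] at h1
  simp only [Finset.card_univ, Fintype.card_fin] at h1
  let c : ℕ → ℝ := fun k =>
    PowerSeries.coeff (n + 1 - k) (a.momentSeries ^ (k * (p / 2)))
  -- The contribution of a set `V` with k elements. The first factor is its cumulant sum over
  -- connected matchings, solved from `Distribution.mul_matchSum_cum`; the second is `insSum_eq`
  -- with d = k(p/2), as `V` carries kp half-edges.
  let F : ℕ → ℝ := fun k => (k.factorial * p ^ k * a.freeCumulant k / (k * p)) *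
    ((n + 1 - k).factorial * p ^ (n + 1 - k) * c k)
  have h2 : ∀ V ∈ (Finset.univ.filter fun V : Finset (Fin (n + 1)) => (0 : Fin (n + 1)) ∈ V),
      ∑ δ : Perm (Fin (n + 1) × ZMod p) with IsPM V δ ∧ ConnOn V δ,
        onSub a.cumFun (shift p (Fin (n + 1))) (On V) δ *
          insSum a V δ (V ×ˢ Finset.univ) Vᶜ = F V.card := by
    intro V hV
    have hne : V.Nonempty := ⟨_, (Finset.mem_filter.1 hV).2⟩
    have hk := a.mul_matchSum_cum hp hp2 hne
    have hVc : (V.card : ℝ) ≠ 0 := by exact_mod_cast hne.card_ne_zero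
    have h3 : ∀ δ ∈ (Finset.univ.filter fun δ : Perm (Fin (n + 1) × ZMod p) =>
        IsPM V δ ∧ ConnOn V δ), onSub a.cumFun (shift p (Fin (n + 1))) (On V) δ *
          insSum a V δ (V ×ˢ Finset.univ) Vᶜ =
        onSub a.cumFun (shift p (Fin (n + 1))) (On V) δ *
          ((n + 1 - V.card).factorial * p ^ (n + 1 - V.card) * c V.card) := by
      intro δ hδ
      obtain ⟨hδ1, hδ2⟩ := (Finset.mem_filter.1 hδ).2
      rw [insSum_eq hp hp2 a hδ1 hδ2 hne (V.card * (p / 2)) _ _ _ _ _ disjoint_compl_right,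
        Finset.card_compl, Fintype.card_fin]
      · rw [Finset.card_product, Finset.card_univ, ZMod.card, hq2, hq]; ring
      · intro z hz; exact (Finset.mem_product.1 hz).1
      · intro z hz
        rw [Finset.mem_product] at hz ⊢
        exact ⟨(hδ1.mem_iff z).2 hz.1, Finset.mem_univ _⟩
    rw [Finset.sum_congr rfl h3, ← Finset.sum_mul]
    simp only [F]
    congr 1
    rw [← hk, matchSum]
    field_simp
  rw [Finset.sum_congr rfl h2, sum_filter_mem_zero n F, Finset.mul_sum] at h1
  have hn0 : ((n + 1).factorial : ℝ) * p ^ (n + 1) ≠ 0 :=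
    mul_ne_zero (by exact_mod_cast (Nat.factorial_ne_zero _)) (pow_ne_zero _ hp0)
  apply mul_left_cancel₀ hn0
  rw [← h1, Finset.mul_sum]
  refine Finset.sum_congr rfl fun j hj => ?_
  have hj' : j ≤ n := Nat.lt_succ_iff.1 (Finset.mem_range.1 hj)
  have e1 : n + 1 - (j + 1) = n - j := by omega
  simp only [F, c, e1]
  have hj0 : ((j : ℝ) + 1) ≠ 0 := by positivity
  have hpow : (p : ℝ) ^ n = p ^ j * p ^ (n - j) := by
    rw [← pow_add, Nat.add_sub_cancel' hj']
  rw [Nat.factorial_succ n, Nat.factorial_succ j, pow_succ, pow_succ, hpow]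
  push_cast
  rw [← choose_mul_factorials hj']
  field_simp

lemma coeff_X_mul_pow_pow (M : PowerSeries ℝ) (q n k : ℕ) (h : k ≤ n) :
    PowerSeries.coeff n ((PowerSeries.X * M ^ q) ^ k) =
      PowerSeries.coeff (n - k) (M ^ (k * q)) := by
  rw [mul_pow, PowerSeries.coeff_X_pow_mul', if_pos h, ← pow_mul, mul_comm q k]

/-- `Distribution.moment_succ` is the recursion that defines `measureCumulant`, and the moments
coincide. -/
lemma Distribution.HasLaw.freeCumulant_eq {p : ℕ} (hp : Even p) (hp2 : 2 ≤ p)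
    {a : Distribution p Unit} {μ : Measure ℝ} (h : a.HasLaw μ) (n : ℕ) :
    a.freeCumulant n = measureCumulant p μ n := by
  have hM : TensorFree.momentSeries μ = a.momentSeries := by
    ext n
    simp [TensorFree.momentSeries, Distribution.momentSeries, h.2.2 n]
  induction n using Nat.strong_induction_on with
  | _ n ih =>
    rw [measureCumulant, hM]
    have h1 : ∑ s : Fin n, measureCumulant p μ s *
        PowerSeries.coeff n ((PowerSeries.X * a.momentSeries ^ (p / 2)) ^ (s : ℕ)) =
        ∑ s : Fin n, a.freeCumulant s *
        PowerSeries.coeff n ((PowerSeries.X * a.momentSeries ^ (p / 2)) ^ (s : ℕ)) :=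
      Finset.sum_congr rfl fun s _ => by rw [ih s s.2]
    rw [h1, Fin.sum_univ_eq_sum_range (fun s => a.freeCumulant s *
        PowerSeries.coeff n ((PowerSeries.X * a.momentSeries ^ (p / 2)) ^ s))]
    cases n with
    | zero => simp [Distribution.freeCumulant, Distribution.momentSeries, a.moment_zero]
    | succ n =>
      have h0 : PowerSeries.coeff 0 a.momentSeries = 1 := by
        simp [Distribution.momentSeries, a.moment_zero]
      have h2 : a.moment (n + 1) = a.freeCumulant (n + 1) + ∑ s ∈ Finset.range (n + 1),
          a.freeCumulant s *
          PowerSeries.coeff (n + 1) ((PowerSeries.X * a.momentSeries ^ (p / 2)) ^ s) := by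
        rw [a.moment_succ hp hp2, Finset.sum_range_succ, Finset.sum_range_succ', add_comm]
        congr 1
        · have : PowerSeries.coeff 0 (a.momentSeries ^ ((n + 1) * (p / 2))) = 1 := by
            rw [PowerSeries.coeff_zero_eq_constantCoeff_apply] at h0 ⊢
            rw [map_pow, h0, one_pow]
          rw [Nat.sub_self, this, mul_one]
        · rw [pow_zero, PowerSeries.coeff_one, if_neg (by omega), mul_zero, add_zero]
          refine Finset.sum_congr rfl fun j hj => ?_
          have hj' := Finset.mem_range.1 hj
          rw [coeff_X_mul_pow_pow _ _ _ _ (by omega)]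
          congr 3
          omega
      conv_rhs => rw [Distribution.momentSeries, PowerSeries.coeff_mk]
      rw [h2, Distribution.momentSeries]
      ring

lemma Distribution.Free.freeCumulant_sum {p : ℕ} (hp2 : 2 ≤ p) {φ : Distribution p Bool}
    (hφ : φ.Free) (n : ℕ) : φ.sum.freeCumulant (n + 1) =
      (φ.marginal false).freeCumulant (n + 1) + (φ.marginal true).freeCumulant (n + 1) := by
  simp only [Distribution.freeCumulant, Nat.succ_ne_zero, if_false]
  rw [← finsum_add_distrib (Set.toFinite _) (Set.toFinite _)]
  refine finsum_congr fun c => ?_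
  have : Nonempty (Fin ((n + 1) * p)) := ⟨⟨0, by positivity⟩⟩
  exact hφ.sum_cumulant _ (Quotient.out c).connected

/-! ### Growth of the cumulants of a measure -/

/-- With F = zu this is the residue of F'/F^(j+1). It vanishes for j > 0 because the form is exact,
and it is 1 for j = 0. -/
lemma lagrange_residue {u v : PowerSeries ℝ} (h : v * u = 1) (j : ℕ) :
    PowerSeries.coeff j (v ^ (j + 1) * (u + PowerSeries.X * PowerSeries.derivative ℝ u)) =
      if j = 0 then 1 else 0 := by
  cases j with
  | zero =>
    rw [zero_add, pow_one, mul_add, h, if_pos rfl, map_add, PowerSeries.coeff_one, if_pos rfl,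
      mul_left_comm, PowerSeries.coeff_zero_X_mul, add_zero]
  | succ j =>
    rw [if_neg (by omega)]
    have hd : v * PowerSeries.derivative ℝ u + u * PowerSeries.derivative ℝ v = 0 := by
      have := congrArg (PowerSeries.derivative ℝ) h
      rwa [Derivation.leibniz, smul_eq_mul, smul_eq_mul, PowerSeries.derivative_one] at this
    have h1 : v ^ (j + 1 + 1) * (u + PowerSeries.X * PowerSeries.derivative ℝ u) =
        v ^ (j + 1) - PowerSeries.X * (v ^ j * PowerSeries.derivative ℝ v) := by
      have e1 : v ^ (j + 1 + 1) * (u + PowerSeries.X * PowerSeries.derivative ℝ u) =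
        v ^ (j + 1) * (v * u) + PowerSeries.X * v ^ (j + 1) *
          (v * PowerSeries.derivative ℝ u + u * PowerSeries.derivative ℝ v) -
          PowerSeries.X * v ^ j * (v * u) * PowerSeries.derivative ℝ v := by ring
      rw [e1, hd, h]
      ring
    have h2 : (((j + 1 : ℕ) : ℝ)) * PowerSeries.coeff j (v ^ j * PowerSeries.derivative ℝ v) =
        (j + 1) * PowerSeries.coeff (j + 1) (v ^ (j + 1)) := by
      have := PowerSeries.coeff_derivative (R := ℝ) (v ^ (j + 1)) j
      rw [PowerSeries.derivative_pow, Nat.add_sub_cancel, mul_assoc,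
        ← nsmul_eq_mul, map_nsmul, nsmul_eq_mul] at this
      rw [this]; ring
    have h3 : PowerSeries.coeff j (v ^ j * PowerSeries.derivative ℝ v) =
        PowerSeries.coeff (j + 1) (v ^ (j + 1)) := by
      have hj : ((j : ℝ) + 1) ≠ 0 := by positivity
      push_cast at h2
      exact mul_left_cancel₀ hj h2
    rw [h1, map_sub, PowerSeries.coeff_succ_X_mul, h3, sub_self]

/-- Lagrange inversion for the cumulants of a moment series. -/
lemma lagrange_inversion {M v : PowerSeries ℝ} {q : ℕ} {κ : ℕ → ℝ} (hv : v * M ^ q = 1)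
    (h : ∀ n, PowerSeries.coeff n M = ∑ s ∈ Finset.range (n + 1),
      κ s * PowerSeries.coeff n ((PowerSeries.X * M ^ q) ^ s)) (n : ℕ) :
    (n + 1 : ℝ) * κ (n + 1) =
      PowerSeries.coeff n (PowerSeries.derivative ℝ M * v ^ (n + 1)) := by
  set u := M ^ q with hu
  set F := PowerSeries.X * u with hF
  -- A finite truncation of the composition avoids infinite sums. The coefficients up to n+1 are
  -- needed because the derivative lowers the index by one.
  let P : PowerSeries ℝ := ∑ s ∈ Finset.range (n + 2), PowerSeries.C (κ s) * F ^ s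
  have hP : ∀ i ≤ n + 1, PowerSeries.coeff i M = PowerSeries.coeff i P := by
    intro i hi
    rw [h i, map_sum]
    simp only [PowerSeries.coeff_C_mul]
    refine Finset.sum_subset (Finset.range_mono (by omega)) fun s _ hs => ?_
    rw [Finset.mem_range, not_lt] at hs
    rw [hF, mul_pow, PowerSeries.coeff_X_pow_mul', if_neg (by omega), mul_zero]
  have hdP : ∀ i ≤ n, PowerSeries.coeff i (PowerSeries.derivative ℝ M) =
      PowerSeries.coeff i (PowerSeries.derivative ℝ P) := by
    intro i hi
    rw [PowerSeries.coeff_derivative, PowerSeries.coeff_derivative, hP _ (by omega)]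
  have h1 : PowerSeries.coeff n (PowerSeries.derivative ℝ M * v ^ (n + 1)) =
      PowerSeries.coeff n (PowerSeries.derivative ℝ P * v ^ (n + 1)) := by
    rw [PowerSeries.coeff_mul, PowerSeries.coeff_mul]
    refine Finset.sum_congr rfl fun x hx => ?_
    have := Finset.HasAntidiagonal.mem_antidiagonal.1 hx
    rw [hdP x.1 (by omega)]
  have hdF : PowerSeries.derivative ℝ F = u + PowerSeries.X * PowerSeries.derivative ℝ u := by
    rw [hF, Derivation.leibniz, smul_eq_mul, smul_eq_mul, PowerSeries.derivative_X]
    ring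
  have h2 : PowerSeries.derivative ℝ P * v ^ (n + 1) =
      ∑ s ∈ Finset.range (n + 1), PowerSeries.C (κ (s + 1) * (s + 1)) *
        (PowerSeries.X ^ s * (v ^ (n - s + 1) *
          (u + PowerSeries.X * PowerSeries.derivative ℝ u))) := by
    rw [map_sum, Finset.sum_range_succ', pow_zero, mul_one, PowerSeries.derivative_C, add_zero,
      Finset.sum_mul]
    refine Finset.sum_congr rfl fun s hs => ?_
    have hs' := Finset.mem_range.1 hs
    obtain ⟨t, rfl⟩ : ∃ t, n = s + t := ⟨n - s, by omega⟩
    rw [Derivation.leibniz, PowerSeries.derivative_C, smul_zero, add_zero, smul_eq_mul,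
      PowerSeries.derivative_pow, Nat.add_sub_cancel, hdF, map_mul, map_add, map_natCast, map_one,
      Nat.add_sub_cancel_left]
    have e : F ^ s * v ^ (s + t + 1) = PowerSeries.X ^ s * v ^ (t + 1) := by
      have : F ^ s * v ^ (s + t + 1) = PowerSeries.X ^ s * (v * u) ^ s * v ^ (t + 1) := by
        rw [hF]; ring
      rw [this, hv, one_pow, mul_one]
    push_cast
    linear_combination (PowerSeries.C (κ (s + 1)) * ((s : PowerSeries ℝ) + 1) *
      (u + PowerSeries.X * PowerSeries.derivative ℝ u)) * e
  -- By `lagrange_residue` with j = n − s only the term s = n survives.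
  rw [h1, h2, map_sum, Finset.sum_eq_single n]
  · rw [PowerSeries.coeff_C_mul, PowerSeries.coeff_X_pow_mul', if_pos le_rfl, Nat.sub_self,
      lagrange_residue hv, if_pos rfl]
    ring
  · intro s hs hsn
    have hs' := Finset.mem_range.1 hs
    rw [PowerSeries.coeff_C_mul, PowerSeries.coeff_X_pow_mul', if_pos (by omega),
      lagrange_residue hv, if_neg (by omega), mul_zero]
  · intro hn
    simp at hn

/-! ### Weighted coefficient bounds -/

/-- The weighted sums of the absolute values of the coefficients are at most `c`. -/
def WeightBound (r : ℝ) (f : PowerSeries ℝ) (c : ℝ) : Prop :=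
  ∀ J, ∑ j ∈ Finset.range J, |PowerSeries.coeff j f| * r ^ j ≤ c

lemma WeightBound.nonneg {r : ℝ} {f : PowerSeries ℝ} {c : ℝ} (h : WeightBound r f c) : 0 ≤ c := by
  simpa using h 0

/-- The weighted ℓ¹ norm is submultiplicative: index pairs with sum below J lie in the square [0,
J)². -/
lemma WeightBound.mul {r : ℝ} (hr : 0 ≤ r) {f g : PowerSeries ℝ} {c d : ℝ}
    (hf : WeightBound r f c) (hg : WeightBound r g d) : WeightBound r (f * g) (c * d) := by
  intro J
  have h1 : ∑ j ∈ Finset.range J, |PowerSeries.coeff j (f * g)| * r ^ j ≤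
      ∑ j ∈ Finset.range J, ∑ x ∈ Finset.HasAntidiagonal.antidiagonal j,
        (|PowerSeries.coeff x.1 f| * r ^ x.1) * (|PowerSeries.coeff x.2 g| * r ^ x.2) := by
    refine Finset.sum_le_sum fun j _ => ?_
    rw [PowerSeries.coeff_mul]
    refine (mul_le_mul_of_nonneg_right (Finset.abs_sum_le_sum_abs _ _)
      (pow_nonneg hr j)).trans (le_of_eq ?_)
    rw [Finset.sum_mul]
    refine Finset.sum_congr rfl fun x hx => ?_
    rw [← Finset.HasAntidiagonal.mem_antidiagonal.1 hx, abs_mul, pow_add]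
    ring
  have h2 : ∑ j ∈ Finset.range J, ∑ x ∈ Finset.HasAntidiagonal.antidiagonal j,
        (|PowerSeries.coeff x.1 f| * r ^ x.1) * (|PowerSeries.coeff x.2 g| * r ^ x.2) ≤
      ∑ x ∈ Finset.range J ×ˢ Finset.range J,
        (|PowerSeries.coeff x.1 f| * r ^ x.1) * (|PowerSeries.coeff x.2 g| * r ^ x.2) := by
    rw [Finset.sum_sigma']
    have hinj : Set.InjOn (fun y : Σ _ : ℕ, ℕ × ℕ => y.2)
        ((Finset.range J).sigma fun j => Finset.HasAntidiagonal.antidiagonal j) := by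
      rintro ⟨j, x⟩ hx ⟨j', x'⟩ hx' h
      simp only [Finset.coe_sigma, Set.mem_sigma_iff, Finset.mem_coe,
        Finset.HasAntidiagonal.mem_antidiagonal] at hx hx' h
      subst h
      obtain rfl : j = j' := hx.2.symm.trans hx'.2
      rfl
    rw [← Finset.sum_image (f := fun x : ℕ × ℕ =>
      (|PowerSeries.coeff x.1 f| * r ^ x.1) * (|PowerSeries.coeff x.2 g| * r ^ x.2)) hinj]
    refine Finset.sum_le_sum_of_subset_of_nonneg ?_ fun x _ _ => by positivity
    intro x hx
    obtain ⟨⟨j, y⟩, hy, rfl⟩ := Finset.mem_image.1 hx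
    simp only [Finset.mem_sigma, Finset.mem_range, Finset.HasAntidiagonal.mem_antidiagonal] at hy
    simp only [Finset.mem_product, Finset.mem_range]
    omega
  refine (h1.trans h2).trans ?_
  rw [Finset.sum_product]
  dsimp only
  rw [← Finset.sum_mul_sum]
  exact mul_le_mul (hf J) (hg J) (Finset.sum_nonneg fun _ _ => by positivity) hf.nonneg

lemma WeightBound.pow {r : ℝ} (hr : 0 ≤ r) {f : PowerSeries ℝ} {c : ℝ}
    (hf : WeightBound r f c) (n : ℕ) : WeightBound r (f ^ n) (c ^ n) := by
  induction n with
  | zero =>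
    intro J
    rw [pow_zero, pow_zero]
    cases J with
    | zero => simp
    | succ J =>
      rw [Finset.sum_range_succ', Finset.sum_eq_zero]
      · simp
      · intro j _
        rw [PowerSeries.coeff_one, if_neg (by omega), abs_zero, zero_mul]
  | succ n ih =>
    rw [pow_succ, pow_succ]
    exact ih.mul hr hf

lemma WeightBound.coeff_le {r : ℝ} (hr : 0 ≤ r) {f : PowerSeries ℝ} {c : ℝ}
    (hf : WeightBound r f c) (n : ℕ) : |PowerSeries.coeff n f| * r ^ n ≤ c := by
  refine le_trans ?_ (hf (n + 1))
  exact Finset.single_le_sum (f := fun j => |PowerSeries.coeff j f| * r ^ j)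
    (fun j _ => by positivity) (Finset.self_mem_range_succ n)

lemma weightBound_of_le_geometric {r K : ℝ} (hK : 0 ≤ K) {f : PowerSeries ℝ}
    (h : ∀ j, |PowerSeries.coeff j f| * r ^ j ≤ K * (1 / 2) ^ j) : WeightBound r f (K * 2) := by
  intro J
  refine (Finset.sum_le_sum fun j _ => h j).trans ?_
  rw [← Finset.mul_sum]
  refine mul_le_mul_of_nonneg_left ?_ hK
  rw [geom_sum_eq (by norm_num)]
  have : (0 : ℝ) ≤ (1 / 2) ^ J := by positivity
  rw [div_le_iff_of_neg (by norm_num)]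
  linarith

/-- The recursion for the inverse bounds the next coefficient by B^(n+1)(1 + 2 + ... + 2^n), which
is less than (2B)^(n+1). -/
lemma abs_coeff_inv_le {M : PowerSeries ℝ} {B : ℝ} (hB : 0 ≤ B)
    (h0 : PowerSeries.constantCoeff M = 1) (h : ∀ n, |PowerSeries.coeff n M| ≤ B ^ n) (n : ℕ) :
    |PowerSeries.coeff n M⁻¹| ≤ (2 * B) ^ n := by
  induction n using Nat.strong_induction_on with
  | _ n ih =>
    cases n with
    | zero => simp [h0]
    | succ n =>
      have h1 := congrArg (PowerSeries.coeff (n + 1))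
        (PowerSeries.inv_mul_cancel M (by rw [h0]; exact one_ne_zero))
      rw [PowerSeries.coeff_mul, PowerSeries.coeff_one, if_neg (by omega),
        Finset.Nat.sum_antidiagonal_eq_sum_range_succ (fun i j =>
        PowerSeries.coeff i M⁻¹ * PowerSeries.coeff j M), Finset.sum_range_succ, Nat.sub_self,
        PowerSeries.coeff_zero_eq_constantCoeff_apply, h0, mul_one] at h1
      rw [eq_neg_of_add_eq_zero_right h1, abs_neg]
      refine (Finset.abs_sum_le_sum_abs _ _).trans ?_
      have h2 : ∀ i ∈ Finset.range (n + 1),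
          |PowerSeries.coeff i M⁻¹ * PowerSeries.coeff (n + 1 - i) M| ≤ B ^ (n + 1) * 2 ^ i := by
        intro i hi
        have hi' := Finset.mem_range.1 hi
        rw [abs_mul]
        refine (mul_le_mul (ih i hi') (h _) (abs_nonneg _) (by positivity)).trans (le_of_eq ?_)
        have : B ^ (n + 1) = B ^ i * B ^ (n + 1 - i) := by
          rw [← pow_add]; congr 1; omega
        rw [this, mul_pow]
        ring
      refine (Finset.sum_le_sum h2).trans ?_
      rw [← Finset.mul_sum, geom_sum_eq (by norm_num), mul_pow, mul_comm]
      have : (0 : ℝ) ≤ B ^ (n + 1) := by positivity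
      norm_num
      nlinarith

lemma CompactlySupported.abs_moment_le {μ : Measure ℝ} [IsProbabilityMeasure μ]
    (h : CompactlySupported μ) : ∃ B : ℝ, 1 ≤ B ∧ ∀ n : ℕ, |∫ x, x ^ n ∂μ| ≤ B ^ n := by
  obtain ⟨M, hM, hμ⟩ := h
  refine ⟨max M 1, le_max_right _ _, fun n => ?_⟩
  have hae : ∀ᵐ x ∂μ, ‖x ^ n‖ ≤ (max M 1) ^ n := by
    have : ∀ᵐ x ∂μ, x ∈ Set.Icc (-M) M := by
      rw [ae_iff]
      exact hμ
    filter_upwards [this] with x hx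
    rw [norm_pow, Real.norm_eq_abs]
    exact pow_le_pow_left₀ (abs_nonneg x) ((abs_le.2 hx).trans (le_max_left _ _)) n
  have := norm_integral_le_of_norm_le_const hae
  simpa using this

lemma momentSeries_coeff_eq_sum (p : ℕ) (μ : Measure ℝ) [IsProbabilityMeasure μ] (n : ℕ) :
    PowerSeries.coeff n (momentSeries μ) = ∑ s ∈ Finset.range (n + 1), measureCumulant p μ s *
      PowerSeries.coeff n ((PowerSeries.X * momentSeries μ ^ (p / 2)) ^ s) := by
  have h1 : PowerSeries.constantCoeff (momentSeries μ) = 1 := by simp [momentSeries]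
  have hn : PowerSeries.coeff n ((PowerSeries.X * momentSeries μ ^ (p / 2)) ^ n) = 1 := by
    rw [mul_pow, PowerSeries.coeff_X_pow_mul', if_pos le_rfl]
    simp [h1]
  rw [Finset.sum_range_succ, hn, measureCumulant, ← Fin.sum_univ_eq_sum_range (fun s =>
    measureCumulant p μ s *
      PowerSeries.coeff n ((PowerSeries.X * momentSeries μ ^ (p / 2)) ^ s))]
  ring

/-- The cumulants of a compactly supported probability measure grow at most exponentially. -/
lemma CompactlySupported.abs_measureCumulant_le (p : ℕ) {μ : Measure ℝ} [IsProbabilityMeasure μ]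
    (h : CompactlySupported μ) :
    ∃ K L : ℝ, 0 < L ∧ ∀ n, |measureCumulant p μ (n + 1)| ≤ K * L ^ n := by
  obtain ⟨B, hB1, hB⟩ := h.abs_moment_le
  have hB0 : 0 < B := by linarith
  set M := momentSeries μ with hM
  have hM0 : PowerSeries.constantCoeff M = 1 := by simp [hM, momentSeries]
  have hMB : ∀ n, |PowerSeries.coeff n M| ≤ B ^ n := fun n => by
    simpa [hM, momentSeries] using hB n
  have hv : (M⁻¹) ^ (p / 2) * M ^ (p / 2) = 1 := by
    rw [← mul_pow, PowerSeries.inv_mul_cancel M (by rw [hM0]; exact one_ne_zero), one_pow]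
  have hL := lagrange_inversion hv (momentSeries_coeff_eq_sum p μ)
  -- At radius 1/(4B) the bound (2B)^j for 1/M and the bound (j+1)B^(j+1) ≤ B(2B)^j for M' both
  -- decay like 2^(-j).
  have hr : 0 ≤ 1 / (4 * B) := by positivity
  have hW : WeightBound (1 / (4 * B)) M⁻¹ (1 * 2) := by
    refine weightBound_of_le_geometric zero_le_one fun j => ?_
    refine (mul_le_mul_of_nonneg_right (abs_coeff_inv_le hB0.le hM0 hMB j)
      (pow_nonneg hr j)).trans (le_of_eq ?_)
    rw [← mul_pow, one_mul]
    congr 1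
    field_simp
    norm_num
  have hD : WeightBound (1 / (4 * B)) (PowerSeries.derivative ℝ M) (B * 2) := by
    refine weightBound_of_le_geometric hB0.le fun j => ?_
    rw [PowerSeries.coeff_derivative, abs_mul]
    have h1 : |(j : ℝ) + 1| ≤ 2 ^ j := by
      rw [abs_of_nonneg (by positivity)]
      exact_mod_cast Nat.lt_two_pow_self (n := j)
    refine (mul_le_mul_of_nonneg_right (mul_le_mul (hMB _) h1 (abs_nonneg _) (by positivity))
      (pow_nonneg hr j)).trans (le_of_eq ?_)
    rw [pow_succ, mul_comm (B ^ j) B, mul_assoc, mul_assoc, ← mul_pow, ← mul_pow]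
    congr 2
    field_simp
    norm_num
  -- The norms 2B of M' and 2 of 1/M give 2B · 2^((p/2)(n+1)) for the product, and extracting the
  -- n-th coefficient costs (4B)^n.
  refine ⟨B * 2 * 2 ^ (p / 2), 4 * B * 2 ^ (p / 2), by positivity, fun n => ?_⟩
  have h1 := ((hD.mul hr ((hW.pow hr (p / 2)).pow hr (n + 1))).coeff_le hr n)
  rw [← hL n, abs_mul] at h1
  have h2 : |measureCumulant p μ (n + 1)| * (1 / (4 * B)) ^ n ≤
      B * 2 * ((1 * 2) ^ (p / 2)) ^ (n + 1) := by
    refine le_trans ?_ h1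
    refine mul_le_mul_of_nonneg_right ?_ (pow_nonneg hr n)
    have : (1 : ℝ) ≤ |(n : ℝ) + 1| := by
      rw [abs_of_nonneg (by positivity)]
      have : (0 : ℝ) ≤ n := by positivity
      linarith
    exact le_mul_of_one_le_left (abs_nonneg _) this
  rw [one_div, inv_pow, ← div_eq_mul_inv, div_le_iff₀ (by positivity), one_mul] at h2
  refine h2.trans (le_of_eq ?_)
  rw [mul_pow (4 * B), pow_succ]
  ring

lemma rTerm_eq (p : ℕ) (μ : Measure ℝ) (z : ℂ) (n : ℕ) :
    rTerm p μ z n = ((measureCumulant p μ (n + 1) : ℝ) : ℂ) * z ^ n := by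
  simp [rTerm, rTransform, cumulantSeries, PowerSeries.coeff_one]

lemma CompactlySupported.exists_summable_rTerm (p : ℕ) {μ : Measure ℝ} [IsProbabilityMeasure μ]
    (h : CompactlySupported μ) :
    ∃ r : ℝ, 0 < r ∧ ∀ z : ℂ, ‖z‖ < r → Summable (rTerm p μ z) := by
  obtain ⟨K, L, hL, hK⟩ := h.abs_measureCumulant_le p
  refine ⟨1 / L, by positivity, fun z hz => ?_⟩
  have hz' : L * ‖z‖ < 1 := by
    rw [lt_div_iff₀ hL] at hz
    linarith
  refine Summable.of_norm_bounded (g := fun n => K * (L * ‖z‖) ^ n)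
    ((summable_geometric_of_lt_one (by positivity) hz').mul_left K) fun n => ?_
  rw [rTerm_eq, norm_mul, norm_pow, Complex.norm_real, Real.norm_eq_abs, mul_pow, ← mul_assoc]
  exact mul_le_mul_of_nonneg_right (hK n) (by positivity)

end TensorFree

end

/-! ### The theorem -/

theorem mainTheorem10 (p : ℕ) (hp : Even p) (hp2 : 2 ≤ p)
    (μ ν : MeasureTheory.Measure ℝ)
    [MeasureTheory.IsProbabilityMeasure μ] [MeasureTheory.IsProbabilityMeasure ν]
    (hμ : TensorFree.CompactlySupported μ) (hν : TensorFree.CompactlySupported ν) :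
    ∃ r : ℝ, 0 < r ∧ ∀ z : ℂ, ‖z‖ < r →
      Summable (TensorFree.rTerm p μ z) ∧ Summable (TensorFree.rTerm p ν z) ∧
      (∀ ρ : MeasureTheory.Measure ℝ, TensorFree.IsTensorFreeConvolution p μ ν ρ →
        Summable (TensorFree.rTerm p ρ z) ∧
        TensorFree.rValue p ρ z = TensorFree.rValue p μ z + TensorFree.rValue p ν z) ∧
      (∀ φ : TensorFree.Distribution p Bool, φ.Free →
        (φ.marginal false).HasLaw μ → (φ.marginal true).HasLaw ν →
        HasSum (fun n : ℕ => (((φ.marginal false).freeCumulant (n + 1) : ℝ) : ℂ) * z ^ n)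
          (TensorFree.rValue p μ z) ∧
        HasSum (fun n : ℕ => (((φ.marginal true).freeCumulant (n + 1) : ℝ) : ℂ) * z ^ n)
          (TensorFree.rValue p ν z) ∧
        HasSum (fun n : ℕ => ((φ.sum.freeCumulant (n + 1) : ℝ) : ℂ) * z ^ n)
          (TensorFree.rValue p μ z + TensorFree.rValue p ν z)) := by
  obtain ⟨r₁, hr₁, h₁⟩ := hμ.exists_summable_rTerm p
  obtain ⟨r₂, hr₂, h₂⟩ := hν.exists_summable_rTerm p
  refine ⟨min r₁ r₂, lt_min hr₁ hr₂, fun z hz => ?_⟩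
  have s₁ := h₁ z (hz.trans_le (min_le_left _ _))
  have s₂ := h₂ z (hz.trans_le (min_le_right _ _))
  have key : ∀ φ : TensorFree.Distribution p Bool, φ.Free →
        (φ.marginal false).HasLaw μ → (φ.marginal true).HasLaw ν →
        HasSum (fun n : ℕ => (((φ.marginal false).freeCumulant (n + 1) : ℝ) : ℂ) * z ^ n)
          (TensorFree.rValue p μ z) ∧
        HasSum (fun n : ℕ => (((φ.marginal true).freeCumulant (n + 1) : ℝ) : ℂ) * z ^ n)
          (TensorFree.rValue p ν z) ∧
        HasSum (fun n : ℕ => ((φ.sum.freeCumulant (n + 1) : ℝ) : ℂ) * z ^ n)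
          (TensorFree.rValue p μ z + TensorFree.rValue p ν z) := by
    intro φ hφ hφμ hφν
    have e₁ : (fun n : ℕ => (((φ.marginal false).freeCumulant (n + 1) : ℝ) : ℂ) * z ^ n) =
        TensorFree.rTerm p μ z := by
      funext n
      rw [TensorFree.rTerm_eq, hφμ.freeCumulant_eq hp hp2]
    have e₂ : (fun n : ℕ => (((φ.marginal true).freeCumulant (n + 1) : ℝ) : ℂ) * z ^ n) =
        TensorFree.rTerm p ν z := by
      funext n
      rw [TensorFree.rTerm_eq, hφν.freeCumulant_eq hp hp2]
    have t₁ := s₁.hasSum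
    have t₂ := s₂.hasSum
    rw [← e₁] at t₁
    rw [← e₂] at t₂
    refine ⟨?_, ?_, ?_⟩
    · rw [TensorFree.rValue, ← e₁]; exact t₁
    · rw [TensorFree.rValue, ← e₂]; exact t₂
    · rw [TensorFree.rValue, TensorFree.rValue, ← e₁, ← e₂]
      convert t₁.add t₂ using 2 with n
      rw [hφ.freeCumulant_sum hp2]
      push_cast
      ring
  refine ⟨s₁, s₂, ?_, key⟩
  rintro ρ ⟨φ, hφ, hφμ, hφν, hφρ⟩
  -- The law ρ of the sum gives the same series term by term, so its convergence and value are
  -- inherited and no separate radius for ρ is needed.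
  have h := (key φ hφ hφμ hφν).2.2
  have e : (fun n : ℕ => ((φ.sum.freeCumulant (n + 1) : ℝ) : ℂ) * z ^ n) =
      TensorFree.rTerm p ρ z := by
    funext n
    rw [TensorFree.rTerm_eq, hφρ.freeCumulant_eq hp hp2]
  rw [e] at h
  exact ⟨h.summable, h.tsum_eq⟩
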